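/- Let $\varphi\in(0,\tfrac{\pi}{2})$ and $\rho>1$. Let $\mathcal W_\rho$ be the Banach space of loops $h=\sum_{k\in\mathbb Z}h_k\lambda^k$ on the unit circle with $\|h\|_\rho=\sum_k|h_k|\rho^{|k|}<\infty$, and let $\mathcal W^{\ge0}_{\mathbb R,\rho}$ be the real subspace of those $h$ with $h_k=0$ for $k<0$ and all $h_k$ real. For a parameter vector $\mathbf x=(\tilde a,\tilde b,\tilde c,r,\theta)\in(\mathcal W^{\ge0}_{\mathbb R,\rho})^3\times\mathbb R^2$ put $$a=\tfrac12(\lambda^{-1}-\lambda)+\tilde a,\qquad b=-\tfrac12\sin(\varphi)(\lambda^{-1}+\lambda)+\tilde b,\qquad c=-\tfrac12\cos(\varphi)(\lambda^{-1}+\lambda)+\tilde c .$$ The central value of the parameters is $\underline{\mathbf x}=(0,0,0,1,\tfrac{\pi}{2})$. Let $p_1=e^{i\varphi}$, $p_2=-e^{-i\varphi}$, $p_3=-e^{i\varphi}$, $p_4=e^{-i\varphi}$ and $$A_1=\begin{pmatrix} ia& b+ic\\ b-ic&-ia\end{pmatrix},\quad A_2=\begin{pmatrix} -ia& -b+ic\\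 -b-ic&ia\end{pmatrix},\quad A_3=\begin{pmatrix} ia& -b-ic\\ -b+ic&-ia\end{pmatrix},\quad A_4=\begin{pmatrix} -ia& b-ic\\ b+ic&ia\end{pmatrix}.$$ For real $t$ let $\eta=r\,t\sum_{k=1}^4A_k(\lambda)\frac{dz}{z-p_k}$, let $\Phi$ be the solution of $d\Phi=\Phi\eta$, $\Phi(0)=\mathrm{Id}$, along the segments from $z=0$ to $z=1$ and to $z=i$, and put $\mathcal P=\Phi(1)$, $\mathcal Q=\Phi(i)$, $$\mathfrak p=\mathcal P_{11}\mathcal P_{21}-\mathcal P_{12}\mathcal P_{22},\qquad \mathfrak q=i\left(\mathcal Q_{11}\mathcal Q_{21}+\mathcal Q_{12}\mathcal Q_{22}\right).$$ With $\mathbf x$ fixed, let $\widehat{\mathfrak p}(t)=(\mathfrak p(t)-\mathfrak p(0))/t$ for $t\neq0$ and $\widehat{\mathfrak p}(0)=\frac{d\mathfrak p}{dt}(0)$; define $\widehat{\mathfrak q}$ in the same way. Write $f^*(\lambda)=\overline{f(1/\overline\lambda)}$. The pair $(t,\mathbf x)$ solves the Monodromy Problem if, on the unit circle, $\widehat{\mathfrak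 p}=\widehat{\mathfrak p}^*$, $\widehat{\mathfrak q}=\widehat{\mathfrak q}^*$ and $\det(rA_1)=-1$, and if $\theta\in(0,\pi)$ and $\widehat{\mathfrak p}=\widehat{\mathfrak q}=0$ at $\lambda=e^{i\theta}$. Then there is a family $t\mapsto\mathbf x(t)$, continuous at $t=0$ with $\mathbf x(0)=\underline{\mathbf x}$, such that $(t,\mathbf x(t))$ solves the Monodromy Problem for all $t$ close to $0$, and this family is locally unique: every solution $(t,\mathbf y)$ of the Monodromy Problem sufficiently close to $(0,\underline{\mathbf x})$ has $\mathbf y=\mathbf x(t)$. The parameters $a,b,c$ (as $\mathcal W_\rho$-valued functions of $t$), $r$ and $\theta$ of this family are differentiable at $t=0$, and their $t$-derivatives there are $$a'=a'_0+a'_2\lambda^2,\qquad b'=b'_0+b'_2\lambda^2,\qquad c'=c'_0+c'_2\lambda^2$$ with $$\begin{aligned} a'_0&=a'_2=\sin(2\varphi)\log(\tan\varphi),\\ b'_2&=-2\cos(\varphi)\log(\cos\varphi),\qquad c'_2=2\sin(\varphi)\log(\sin\varphi),\\ b'_0&=b'_2\cos(2\varphi)-c'_2\sin(2\varphi),\qquad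 c'_0=-b'_2\sin(2\varphi)-c'_2\cos(2\varphi). \end{aligned}$$ Moreover $r'=0$ and $\theta'=2\sin(2\varphi)\log(\tan\varphi)$. -/

import Mathlib

open Filter Topology

noncomputable section

namespace DPW

/-! ## The Wiener space of loops -/

/-- Families of Fourier coefficients `(h_k)`, `k ∈ ℤ`. (A separate type, so that it does not carry
the product topology.) -/
def Coeffs : Type := ℤ → ℂ

instance : AddCommGroup Coeffs := inferInstanceAs (AddCommGroup (ℤ → ℂ))
instance : Module ℂ Coeffs := inferInstanceAs (Module ℂ (ℤ → ℂ))

/-- Loops `h = ∑ h_k λ^k` on the unit circle with `∑ |h_k| ρ^|k| < ∞`, given by their Fourier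
coefficients. -/
def wienerSubmodule (ρ : ℝ) [Fact (1 < ρ)] : Submodule ℂ Coeffs where
  carrier := {h | Summable fun k : ℤ => ‖h k‖ * ρ ^ k.natAbs}
  zero_mem' := by
    have h : (fun k : ℤ => ‖(0 : Coeffs) k‖ * ρ ^ k.natAbs) = fun _ => 0 := by
      funext k
      change ‖(0 : ℂ)‖ * _ = 0
      simp
    change Summable fun k : ℤ => ‖(0 : Coeffs) k‖ * ρ ^ k.natAbs
    rw [h]
    exact summable_zero
  add_mem' := by
    intro f g hf hg
    have hρ : 0 < ρ := lt_trans one_pos Fact.out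
    refine Summable.of_nonneg_of_le (fun k => by positivity) (fun k => ?_) (hf.add hg)
    change ‖f k + g k‖ * _ ≤ _
    rw [← add_mul]
    exact mul_le_mul_of_nonneg_right (norm_add_le _ _) (by positivity)
  smul_mem' := by
    intro c f hf
    refine (hf.mul_left ‖c‖).congr (fun k => ?_)
    change ‖c‖ * (‖f k‖ * _) = ‖c * f k‖ * _
    rw [norm_mul, mul_assoc]

/-- The space `𝒲_ρ`. -/
def W (ρ : ℝ) [Fact (1 < ρ)] : Type := wienerSubmodule ρ

section Wiener

variable {ρ : ℝ} [Fact (1 < ρ)]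

instance : AddCommGroup (W ρ) := inferInstanceAs (AddCommGroup (wienerSubmodule ρ))
instance : Module ℂ (W ρ) := inferInstanceAs (Module ℂ (wienerSubmodule ρ))

/-- The `k`-th Fourier coefficient of a loop. -/
def W.coeff (h : W ρ) (k : ℤ) : ℂ := h.1 k

/-- The value `h(λ) = ∑ h_k λ^k`. -/
def W.eval (h : W ρ) (l : ℂ) : ℂ := ∑' k : ℤ, h.coeff k * l ^ k

instance : Norm (W ρ) := ⟨fun h => ∑' k : ℤ, ‖h.coeff k‖ * ρ ^ k.natAbs⟩

theorem W.norm_def (h : W ρ) : ‖h‖ = ∑' k : ℤ, ‖h.coeff k‖ * ρ ^ k.natAbs := rfl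

theorem W.summable (h : W ρ) : Summable fun k : ℤ => ‖h.coeff k‖ * ρ ^ k.natAbs := h.2

theorem W.coeff_add (f g : W ρ) (k : ℤ) : (f + g).coeff k = f.coeff k + g.coeff k := rfl

theorem W.coeff_smul (c : ℂ) (f : W ρ) (k : ℤ) : (c • f).coeff k = c * f.coeff k := rfl

theorem W.coeff_zero (k : ℤ) : (0 : W ρ).coeff k = 0 := rfl

theorem W.ext_coeff {f g : W ρ} (h : ∀ k, f.coeff k = g.coeff k) : f = g :=
  Subtype.ext (funext h)

theorem W.term_nonneg (f : W ρ) (k : ℤ) : 0 ≤ ‖f.coeff k‖ * ρ ^ k.natAbs :=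
  mul_nonneg (norm_nonneg _) (pow_nonneg (le_trans zero_le_one (Fact.out : 1 < ρ).le) _)

theorem W.core : NormedSpace.Core ℂ (W ρ) where
  norm_nonneg f := tsum_nonneg f.term_nonneg
  norm_smul c f := by
    rw [W.norm_def, W.norm_def, ← tsum_mul_left]
    refine tsum_congr fun k => ?_
    rw [W.coeff_smul, norm_mul, mul_assoc]
  norm_triangle f g := by
    rw [W.norm_def, W.norm_def, W.norm_def, ← f.summable.tsum_add g.summable]
    refine (f + g).summable.tsum_le_tsum (fun k => ?_) (f.summable.add g.summable)
    rw [W.coeff_add, ← add_mul]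
    exact mul_le_mul_of_nonneg_right (norm_add_le _ _)
      (pow_nonneg (le_trans zero_le_one (Fact.out : 1 < ρ).le) _)
  norm_eq_zero_iff f := by
    have hρ : 0 < ρ := lt_trans one_pos Fact.out
    constructor
    · intro h
      have hs := f.summable.hasSum
      rw [← W.norm_def, h] at hs
      have h0 := (hasSum_zero_iff_of_nonneg f.term_nonneg).1 hs
      refine W.ext_coeff fun k => ?_
      have hk := congrFun h0 k
      simpa [hρ.ne', W.coeff_zero] using hk
    · rintro rfl
      rw [W.norm_def]
      simp [W.coeff_zero]

instance : NormedAddCommGroup (W ρ) := NormedAddCommGroup.ofCore W.core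
instance : NormedSpace ℂ (W ρ) := NormedSpace.ofCore W.core

/-- The monomial loop `c λ^n`. -/
def W.mono (n : ℤ) (c : ℂ) : W ρ :=
  ⟨(Pi.single n c : ℤ → ℂ), by
    refine summable_of_ne_finset_zero (s := {n}) fun k hk => ?_
    have hk' : k ≠ n := by simpa using hk
    change ‖(Pi.single n c : ℤ → ℂ) k‖ * _ = 0
    simp [hk']⟩

variable (ρ) in
/-- `𝒲_{ℝ,ρ}^{≥0}`: loops `h` with `h_k = 0` for `k < 0` and
`conj (h (conj λ)) = h λ`, i.e. with real Fourier coefficients. -/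
def WRplus : Submodule ℝ (W ρ) where
  carrier := {h | (∀ k < 0, h.coeff k = 0) ∧ ∀ k, starRingEnd ℂ (h.coeff k) = h.coeff k}
  zero_mem' := ⟨fun k _ => W.coeff_zero k, fun k => by simp [W.coeff_zero]⟩
  add_mem' := by
    rintro f g ⟨hf, hf'⟩ ⟨hg, hg'⟩
    exact ⟨fun k hk => by rw [W.coeff_add, hf k hk, hg k hk, add_zero],
      fun k => by rw [W.coeff_add, map_add, hf', hg']⟩
  smul_mem' := by
    rintro c f ⟨hf, hf'⟩
    have h : ∀ k, (c • f).coeff k = (c : ℂ) * f.coeff k := fun _ => rfl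
    exact ⟨fun k hk => by rw [h, hf k hk, mul_zero],
      fun k => by rw [h, map_mul, hf', Complex.conj_ofReal]⟩

variable (ρ) in
/-- Parameter vectors `(ã, b̃, c̃, r, θ)`. -/
def Param : Type := WRplus ρ × WRplus ρ × WRplus ρ × ℝ × ℝ

instance : NormedAddCommGroup (Param ρ) :=
  inferInstanceAs (NormedAddCommGroup (WRplus ρ × WRplus ρ × WRplus ρ × ℝ × ℝ))
instance : NormedSpace ℝ (Param ρ) :=
  inferInstanceAs (NormedSpace ℝ (WRplus ρ × WRplus ρ × WRplus ρ × ℝ × ℝ))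

/-- The loop `a = (λ⁻¹ - λ)/2 + ã`. -/
def Param.a (x : Param ρ) : W ρ := W.mono (-1) (1 / 2) - W.mono 1 (1 / 2) + (x.1 : W ρ)

/-- The loop `b = -(sin φ)(λ⁻¹ + λ)/2 + b̃`. -/
def Param.b (φ : ℝ) (x : Param ρ) : W ρ :=
  W.mono (-1) (-(1 / 2) * Real.sin φ) + W.mono 1 (-(1 / 2) * Real.sin φ) + (x.2.1 : W ρ)

/-- The loop `c = -(cos φ)(λ⁻¹ + λ)/2 + c̃`. -/
def Param.c (φ : ℝ) (x : Param ρ) : W ρ :=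
  W.mono (-1) (-(1 / 2) * Real.cos φ) + W.mono 1 (-(1 / 2) * Real.cos φ) + (x.2.2.1 : W ρ)

def Param.r (x : Param ρ) : ℝ := x.2.2.2.1

def Param.θ (x : Param ρ) : ℝ := x.2.2.2.2

variable (ρ) in
/-- The central value `(0, 0, 0, 1, π/2)`. -/
def Param.center : Param ρ := (0, 0, 0, 1, Real.pi / 2)

end Wiener

/-! ## The Fuchsian potential and its principal solutions -/

/-- The punctures `e^{iφ}, -e^{-iφ}, -e^{iφ}, e^{-iφ}`. -/
def puncture (φ : ℝ) : Fin 4 → ℂ :=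
  ![Complex.exp (Complex.I * φ), -Complex.exp (-(Complex.I * φ)),
    -Complex.exp (Complex.I * φ), Complex.exp (-(Complex.I * φ))]

open Complex in
/-- The residue matrices `A_1, …, A_4` at a point `λ`, in terms of the values there of the
loops `a, b, c`. -/
def residueMatrix (a b c : ℂ) : Fin 4 → Matrix (Fin 2) (Fin 2) ℂ :=
  ![!![I * a, b + I * c; b - I * c, -(I * a)],
    !![-(I * a), -b + I * c; -b - I * c, I * a],
    !![I * a, -b - I * c; -b + I * c, -(I * a)],
    !![-(I * a), b - I * c; b + I * c, I * a]]

/-- `Y` is the solution of `dΦ = Φ η`, `Φ(0) = Id`, along the segment `s ↦ s w`, `0 ≤ s ≤ 1`, where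
`η = E(z) dz`. -/
def IsFrameAlong (E : ℂ → Matrix (Fin 2) (Fin 2) ℂ) (w : ℂ)
    (Y : ℝ → Matrix (Fin 2) (Fin 2) ℂ) : Prop :=
  Y 0 = 1 ∧ ∀ s ∈ Set.Icc (0 : ℝ) 1, ∀ i j,
    HasDerivWithinAt (fun u => Y u i j) ((Y s * (w • E (s * w))) i j) (Set.Icc 0 1) s

open Classical in
/-- The principal solution along the segment from `0` to `w`: the value at `w` of the solution of
`dΦ = Φ η`, `Φ(0) = Id`. If `E` is continuous on the segment, the linear equation has exactly one
solution there; the value `1` in the other case is a dummy. -/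
def principal (E : ℂ → Matrix (Fin 2) (Fin 2) ℂ) (w : ℂ) : Matrix (Fin 2) (Fin 2) ℂ :=
  if h : ∃ Y, IsFrameAlong E w Y then h.choose 1 else 1

section Monodromy

variable {ρ : ℝ} [Fact (1 < ρ)]

/-- The residue `A_{k+1}(λ)` for the parameter vector `x`. -/
def A (φ : ℝ) (x : Param ρ) (l : ℂ) (k : Fin 4) : Matrix (Fin 2) (Fin 2) ℂ :=
  residueMatrix (x.a.eval l) ((x.b φ).eval l) ((x.c φ).eval l) k

/-- The coefficient of `dz` in the potential `η = r t ∑ A_k(λ) dz / (z - p_k)`. -/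
def potential (φ t : ℝ) (x : Param ρ) (l z : ℂ) : Matrix (Fin 2) (Fin 2) ℂ :=
  ((x.r : ℂ) * t) • ∑ k, (z - puncture φ k)⁻¹ • A φ x l k

/-- `𝒫 = Φ(1)`. -/
def P (φ t : ℝ) (x : Param ρ) (l : ℂ) : Matrix (Fin 2) (Fin 2) ℂ :=
  principal (potential φ t x l) 1

/-- `𝒬 = Φ(i)`. -/
def Q (φ t : ℝ) (x : Param ρ) (l : ℂ) : Matrix (Fin 2) (Fin 2) ℂ :=
  principal (potential φ t x l) Complex.I

/-- `𝔭 = 𝒫₁₁ 𝒫₂₁ - 𝒫₁₂ 𝒫₂₂`. -/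
def frakP (φ t : ℝ) (x : Param ρ) (l : ℂ) : ℂ :=
  P φ t x l 0 0 * P φ t x l 1 0 - P φ t x l 0 1 * P φ t x l 1 1

/-- `𝔮 = i (𝒬₁₁ 𝒬₂₁ + 𝒬₁₂ 𝒬₂₂)`. -/
def frakQ (φ t : ℝ) (x : Param ρ) (l : ℂ) : ℂ :=
  Complex.I * (Q φ t x l 0 0 * Q φ t x l 1 0 + Q φ t x l 0 1 * Q φ t x l 1 1)

/-- `𝔭̂`: the difference quotient `(𝔭(t) - 𝔭(0)) / t` if `t ≠ 0`, and the derivative `𝔭'(0)` if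
`t = 0`, at a fixed parameter vector. -/
def hatP (φ t : ℝ) (x : Param ρ) (l : ℂ) : ℂ := dslope (fun s : ℝ => frakP φ s x l) 0 t

/-- `𝔮̂`, likewise. -/
def hatQ (φ t : ℝ) (x : Param ρ) (l : ℂ) : ℂ := dslope (fun s : ℝ => frakQ φ s x l) 0 t

/-- `f*(λ) = conj (f (1 / conj λ))`. -/
def starInv (f : ℂ → ℂ) (l : ℂ) : ℂ := starRingEnd ℂ (f (1 / starRingEnd ℂ l))

/-- The Monodromy Problem: `𝓕 = 𝔭̂ - 𝔭̂* = 0`, `𝓖 = 𝔮̂ - 𝔮̂* = 0` and `𝓚 = det (r A₁) = -1` as loops,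
and `𝓗₁ = 𝔭̂(e^{iθ}) = 0`, `𝓗₂ = 𝔮̂(e^{iθ}) = 0` with `θ ∈ (0, π)`. -/
structure SolvesMonodromyProblem (φ t : ℝ) (x : Param ρ) : Prop where
  F_eq : ∀ l : ℂ, ‖l‖ = 1 → hatP φ t x l - starInv (hatP φ t x) l = 0
  G_eq : ∀ l : ℂ, ‖l‖ = 1 → hatQ φ t x l - starInv (hatQ φ t x) l = 0
  K_eq : ∀ l : ℂ, ‖l‖ = 1 → ((x.r : ℂ) • A φ x l 0).det = -1
  θ_mem : x.θ ∈ Set.Ioo 0 Real.pi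
  H₁_eq : hatP φ t x (Complex.exp (Complex.I * x.θ)) = 0
  H₂_eq : hatQ φ t x (Complex.exp (Complex.I * x.θ)) = 0

end Monodromy

end DPW

end

/-! The Monodromy Problem is rewritten as one equation `monodromySystem` $=0$ between Banach spaces,
and the theorem is the implicit function theorem at $t=0$ and the central value. The derivatives of
the family are $-(\partial_x)^{-1}\partial_t$ evaluated there.

Smoothness. On the segment $[0,1]$ the four poles combine to real coefficient functions, so the
frame lives in $2\times2$ matrices over the algebra of loops with real Fourier coefficients. It
solves $Y=1+tV(YE)$ with $V$ the Volterra operator, hence $Y=(1-tT_E)^{-1}1$, which is $C^1$ in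
$(t,E)$ near $t=0$. A rotation by $i$ and a conjugation by $\mathrm{diag}(1,i)$ turn the segment
$[0,i]$ into the same problem with $\varphi\to\pi/2-\varphi$ and $(a,b,c)\to(-a,c,b)$, so
$\widehat{\mathfrak q}$ is another instance of $\widehat{\mathfrak p}$.

Expansion. Two Picard steps give $\widehat{\mathfrak p}=2\pi rc+t\,R$, where at $t=0$ the remainder
is $R=-8\pi\log(\sin\varphi)\,r^2ab$ (`hatRem_zero`). The constant is an integral of a logarithm
against a rational function, computed by differentiating in an auxiliary angle
(`integral_logRatio_mul_coefA`).

Equations. For real coefficients $h=h^*$ means $h_k=h_{-k}$. This says nothing at $k=0$, so the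
value $h(e^{i\theta})$ is stored in that slot: `boundaryOp` maps each pair of conditions to one
equation in $\mathcal W^{\ge0}_{\mathbb R,\rho}$. The determinant condition, multiplied by
$\lambda$, lies in the same space because the central loops satisfy $a^2-b^2-c^2=-1$.

Invertibility. The first two equations determine $c'$ and $b'$ in terms of $\theta'$. The third
becomes a division of a power series by $1-\lambda^2$: the quotient gives $a'$, and the two
coefficients of the remainder give $\theta'$ and $r'$ (`systemDeriv_injective`,
`systemDeriv_surjective`). Solving the linear system with the explicit $t$-derivative gives the
stated formulas (`systemDeriv_paramDeriv`). -/

noncomputable section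

namespace DPW

/-! ### The Wiener algebra of loops and its subalgebra with real coefficients. -/

section Wiener
variable {ρ : ℝ} [Fact (1 < ρ)]

theorem one_lt_radius : 1 < ρ := Fact.out

theorem weight_one_le (k : ℤ) : 1 ≤ ρ ^ k.natAbs := one_le_pow₀ (Fact.out : 1 < ρ).le

theorem weight_pos (k : ℤ) : 0 < ρ ^ k.natAbs := pow_pos (lt_trans one_pos Fact.out) _

theorem weight_le_mul (n k : ℤ) : ρ ^ n.natAbs ≤ ρ ^ k.natAbs * ρ ^ (n - k).natAbs := by
  rw [← pow_add]
  exact pow_le_pow_right₀ (Fact.out : 1 < ρ).le (by omega)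

theorem W.summable_norm_coeff (f : W ρ) : Summable fun k => ‖f.coeff k‖ :=
  f.summable.of_nonneg_of_le (fun _ => norm_nonneg _)
    fun k => le_mul_of_one_le_right (norm_nonneg _) (weight_one_le k)

theorem W.norm_coeff_mul_le (f : W ρ) (k : ℤ) : ‖f.coeff k‖ * ρ ^ k.natAbs ≤ ‖f‖ :=
  f.summable.le_tsum k fun j _ => f.term_nonneg j

theorem W.norm_coeff_le (f : W ρ) (k : ℤ) : ‖f.coeff k‖ ≤ ‖f‖ :=
  (le_mul_of_one_le_right (norm_nonneg _) (weight_one_le k)).trans (f.norm_coeff_mul_le k)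

theorem W.coeff_sub (f g : W ρ) (k : ℤ) : (f - g).coeff k = f.coeff k - g.coeff k := rfl

theorem W.coeff_real_smul (c : ℝ) (f : W ρ) (k : ℤ) : (c • f).coeff k = (c : ℂ) * f.coeff k := rfl

theorem W.coeff_mono (n : ℤ) (c : ℂ) (k : ℤ) :
    (W.mono n c : W ρ).coeff k = if k = n then c else 0 :=
  Pi.single_apply n c k

/-- A loop given by its coefficients. -/
def W.mk (c : ℤ → ℂ) (h : Summable fun k : ℤ => ‖c k‖ * ρ ^ k.natAbs) : W ρ := ⟨c, h⟩

theorem W.coeff_mk (c : ℤ → ℂ) (h : Summable fun k : ℤ => ‖c k‖ * ρ ^ k.natAbs) (k : ℤ) :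
    (W.mk c h).coeff k = c k := rfl

/-- `𝒲_ρ` as a weighted `ℓ¹` space. -/
def W.toLp : W ρ ≃ lp (fun _ : ℤ => ℂ) 1 where
  toFun h := ⟨fun k => h.coeff k * (ρ ^ k.natAbs : ℝ), by
    refine memℓp_gen ?_
    simpa [abs_of_pos (weight_pos (ρ := ρ) _), abs_of_pos (one_pos.trans (one_lt_radius (ρ := ρ)))]
      using h.summable⟩
  invFun u := W.mk (fun k => u k / (ρ ^ k.natAbs : ℝ)) (by
    have h := (memℓp_gen_iff (p := 1) (by simp)).1 u.2
    refine h.congr fun k => ?_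
    rw [norm_div, Complex.norm_real, Real.norm_of_nonneg (weight_pos k).le,
      div_mul_cancel₀ _ (weight_pos k).ne']
    simp)
  left_inv h := W.ext_coeff fun k => by
    have := (weight_pos (ρ := ρ) k).ne'
    rw [W.coeff_mk]
    exact mul_div_cancel_right₀ _ (by exact_mod_cast this)
  right_inv u := by
    ext k
    have := (weight_pos (ρ := ρ) k).ne'
    change (u k / _) * _ = u k
    exact div_mul_cancel₀ _ (Complex.ofReal_ne_zero.2 this)

theorem W.isometry_toLp : Isometry (W.toLp (ρ := ρ)) := by
  refine Isometry.of_dist_eq fun f g => ?_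
  rw [dist_eq_norm, dist_eq_norm, lp.norm_eq_tsum_rpow (by simp), W.norm_def]
  simp only [ENNReal.toReal_one, Real.rpow_one, div_one]
  refine tsum_congr fun k => ?_
  change ‖f.coeff k * _ - g.coeff k * _‖ = _
  rw [← sub_mul, norm_mul, Complex.norm_real, Real.norm_of_nonneg (weight_pos k).le]
  rfl

instance : CompleteSpace (W ρ) :=
  (IsometryEquiv.mk W.toLp W.isometry_toLp).completeSpace

theorem W.summable_eval (f : W ρ) {l : ℂ} (hl : ‖l‖ = 1) :
    Summable fun k : ℤ => ‖f.coeff k * l ^ k‖ := by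
  simpa [norm_mul, norm_zpow, hl] using f.summable_norm_coeff

/-- Loops are determined by their values on the unit circle. -/
theorem W.ext_eval {f g : W ρ} (h : ∀ l : ℂ, ‖l‖ = 1 → f.eval l = g.eval l) : f = g := by
  have key : ∀ u : W ρ, (∀ l : ℂ, ‖l‖ = 1 → u.eval l = 0) → ∀ n, u.coeff n = 0 := by
    intro u hu n
    have hexp : ∀ s : ℝ, ‖Complex.exp (s * Complex.I)‖ = 1 := Complex.norm_exp_ofReal_mul_I
    have hcont : ∀ k : ℤ, Continuous fun s : ℝ =>
        u.coeff k * Complex.exp (s * Complex.I) ^ k * Complex.exp (s * Complex.I) ^ (-n) := by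
      intro k
      have : ∀ m : ℤ, Continuous fun s : ℝ => Complex.exp (s * Complex.I) ^ m := fun m =>
        Continuous.zpow₀ (by fun_prop) m fun s => Or.inl (Complex.exp_ne_zero _)
      exact (continuous_const.mul (this k)).mul (this (-n))
    -- Termwise integration of the series against $e^{-ins}$ over a period isolates the $n$-th
    -- coefficient.
    have hs := intervalIntegral.hasSum_intervalIntegral_of_summable_norm (ι := ℤ) (a := 0)
      (b := 2 * Real.pi) (f := fun k => ⟨_, hcont k⟩) (by
        refine u.summable_norm_coeff.of_nonneg_of_le (fun _ => norm_nonneg _) fun k => ?_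
        refine (ContinuousMap.norm_le _ (norm_nonneg _)).2 fun s => ?_
        simp [norm_zpow, hexp])
    have h0 : ∀ s : ℝ, ∑' k : ℤ, u.coeff k * Complex.exp (s * Complex.I) ^ k *
        Complex.exp (s * Complex.I) ^ (-n) = 0 := by
      intro s
      rw [tsum_mul_right]
      have := hu _ (hexp s)
      rw [W.eval] at this
      rw [this, zero_mul]
    simp only [ContinuousMap.coe_mk, h0, intervalIntegral.integral_zero] at hs
    have hk : ∀ k : ℤ, (∫ s in (0 : ℝ)..2 * Real.pi, u.coeff k * Complex.exp (s * Complex.I) ^ k *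
        Complex.exp (s * Complex.I) ^ (-n)) = if k = n then 2 * Real.pi * u.coeff n else 0 := by
      intro k
      have h1 : ∀ s : ℝ, u.coeff k * Complex.exp (s * Complex.I) ^ k *
        Complex.exp (s * Complex.I) ^ (-n) = u.coeff k * Complex.exp (((k - n : ℤ) * Complex.I) * s) := by
        intro s
        rw [mul_assoc, ← zpow_add₀ (Complex.exp_ne_zero _), ← Complex.exp_int_mul]
        congr 2
        push_cast
        ring
      simp only [h1, intervalIntegral.integral_const_mul]
      split_ifs with hkn
      · subst hkn
        simp [mul_comm]
      · have hne : (((k - n : ℤ) : ℂ) * Complex.I) ≠ 0 :=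
          mul_ne_zero (by exact_mod_cast sub_ne_zero.2 hkn) Complex.I_ne_zero
        rw [integral_exp_mul_complex hne]
        have : (((k - n : ℤ) : ℂ) * Complex.I) * ((2 * Real.pi : ℝ) : ℂ)
            = (k - n : ℤ) * (2 * Real.pi * Complex.I) := by
          push_cast
          ring
        rw [this, Complex.exp_int_mul_two_pi_mul_I]
        simp
    simp only [hk] at hs
    have := hs.unique (hasSum_ite_eq n _)
    have hpi : (2 * Real.pi : ℂ) ≠ 0 := by
      exact_mod_cast (mul_pos two_pos Real.pi_pos).ne'
    exact (mul_eq_zero.1 this.symm).resolve_left hpi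
  refine W.ext_coeff fun n => sub_eq_zero.1 ?_
  refine key (f - g) (fun l hl => ?_) n
  have := (f.summable_eval hl).of_norm.tsum_sub (g.summable_eval hl).of_norm
  rw [W.eval]
  simp only [W.coeff_sub, sub_mul]
  rw [this]
  exact sub_eq_zero.2 (h l hl)

/-- The substitution $(n,k)\mapsto(k,n-k)$ groups the double series of a product by total degree; it
underlies both the norm estimate and the evaluation of products. -/
theorem W.summable_mul_terms (f g : W ρ) : Summable fun p : ℤ × ℤ =>
    (‖f.coeff p.2‖ * ρ ^ p.2.natAbs) * (‖g.coeff (p.1 - p.2)‖ * ρ ^ (p.1 - p.2).natAbs) := by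
  have h := f.summable.mul_of_nonneg g.summable f.term_nonneg g.term_nonneg
  let e : ℤ × ℤ ≃ ℤ × ℤ :=
    ⟨fun p => (p.2, p.1 - p.2), fun p => (p.1 + p.2, p.1), fun p => by simp, fun p => by simp⟩
  exact e.summable_iff.2 h

theorem W.norm_mul_term_le (f g : W ρ) (n k : ℤ) :
    ‖f.coeff k * g.coeff (n - k)‖ * ρ ^ n.natAbs ≤
      (‖f.coeff k‖ * ρ ^ k.natAbs) * (‖g.coeff (n - k)‖ * ρ ^ (n - k).natAbs) := by
  rw [norm_mul]
  calc _ ≤ ‖f.coeff k‖ * ‖g.coeff (n - k)‖ * (ρ ^ k.natAbs * ρ ^ (n - k).natAbs) :=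
        mul_le_mul_of_nonneg_left (weight_le_mul n k) (by positivity)
    _ = _ := by ring

theorem W.summable_mul_coeff (f g : W ρ) (n : ℤ) :
    Summable fun k => ‖f.coeff k * g.coeff (n - k)‖ := by
  refine ((W.summable_mul_terms f g).prod_factor n).of_nonneg_of_le (fun _ => norm_nonneg _)
    fun k => ?_
  exact (le_mul_of_one_le_right (norm_nonneg _) (weight_one_le n)).trans
    (W.norm_mul_term_le f g n k)

theorem W.norm_conv_le (f g : W ρ) (n : ℤ) :
    ‖∑' k, f.coeff k * g.coeff (n - k)‖ * ρ ^ n.natAbs ≤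
      ∑' k, (‖f.coeff k‖ * ρ ^ k.natAbs) * (‖g.coeff (n - k)‖ * ρ ^ (n - k).natAbs) := by
  calc _ ≤ (∑' k, ‖f.coeff k * g.coeff (n - k)‖) * ρ ^ n.natAbs :=
        mul_le_mul_of_nonneg_right (norm_tsum_le_tsum_norm (W.summable_mul_coeff f g n))
          (weight_pos n).le
    _ = ∑' k, ‖f.coeff k * g.coeff (n - k)‖ * ρ ^ n.natAbs := tsum_mul_right.symm
    _ ≤ _ := ((W.summable_mul_coeff f g n).mul_right _).tsum_le_tsum
        (W.norm_mul_term_le f g n) ((W.summable_mul_terms f g).prod_factor n)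

theorem W.summable_conv (f g : W ρ) :
    Summable fun n : ℤ => ‖∑' k, f.coeff k * g.coeff (n - k)‖ * ρ ^ n.natAbs :=
  (W.summable_mul_terms f g).prod.of_nonneg_of_le
    (fun n => mul_nonneg (norm_nonneg _) (weight_pos n).le) (W.norm_conv_le f g)

instance : Mul (W ρ) := ⟨fun f g => W.mk _ (W.summable_conv f g)⟩

theorem W.coeff_mul (f g : W ρ) (n : ℤ) :
    (f * g).coeff n = ∑' k, f.coeff k * g.coeff (n - k) := rfl

theorem W.norm_mul_le' (f g : W ρ) : ‖f * g‖ ≤ ‖f‖ * ‖g‖ := by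
  have h := f.summable.mul_of_nonneg g.summable f.term_nonneg g.term_nonneg
  let e : ℤ × ℤ ≃ ℤ × ℤ :=
    ⟨fun p => (p.2, p.1 - p.2), fun p => (p.1 + p.2, p.1), fun p => by simp, fun p => by simp⟩
  calc ‖f * g‖ ≤ ∑' n : ℤ, ∑' k, (‖f.coeff k‖ * ρ ^ k.natAbs) *
        (‖g.coeff (n - k)‖ * ρ ^ (n - k).natAbs) :=
        (W.summable_conv f g).tsum_le_tsum (W.norm_conv_le f g) (W.summable_mul_terms f g).prod
    _ = ∑' p : ℤ × ℤ, (‖f.coeff p.2‖ * ρ ^ p.2.natAbs) *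
        (‖g.coeff (p.1 - p.2)‖ * ρ ^ (p.1 - p.2).natAbs) :=
        ((W.summable_mul_terms f g).tsum_prod).symm
    _ = ∑' p : ℤ × ℤ, (‖f.coeff p.1‖ * ρ ^ p.1.natAbs) * (‖g.coeff p.2‖ * ρ ^ p.2.natAbs) :=
        e.tsum_eq fun p => (‖f.coeff p.1‖ * ρ ^ p.1.natAbs) * (‖g.coeff p.2‖ * ρ ^ p.2.natAbs)
    _ = ‖f‖ * ‖g‖ := (f.summable.tsum_mul_tsum g.summable h).symm

theorem W.eval_mul (f g : W ρ) {l : ℂ} (hl : ‖l‖ = 1) :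
    (f * g).eval l = f.eval l * g.eval l := by
  have hl0 : l ≠ 0 := fun h => by simp [h] at hl
  have h := summable_mul_of_summable_norm (f.summable_eval hl) (g.summable_eval hl)
  let e : ℤ × ℤ ≃ ℤ × ℤ :=
    ⟨fun p => (p.2, p.1 - p.2), fun p => (p.1 + p.2, p.1), fun p => by simp, fun p => by simp⟩
  have h' := e.summable_iff.2 h
  rw [W.eval, W.eval, W.eval, tsum_mul_tsum_of_summable_norm (f.summable_eval hl)
    (g.summable_eval hl), ← e.tsum_eq]
  refine Eq.trans ?_ (Summable.tsum_prod h').symm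
  refine tsum_congr fun n => ?_
  rw [W.coeff_mul, ← tsum_mul_right]
  refine tsum_congr fun k => ?_
  change _ = (f.coeff k * l ^ k) * (g.coeff (n - k) * l ^ (n - k))
  have : l ^ n = l ^ k * l ^ (n - k) := by rw [← zpow_add₀ hl0]; congr 1; ring
  rw [this]
  ring

theorem W.eval_add (f g : W ρ) {l : ℂ} (hl : ‖l‖ = 1) :
    (f + g).eval l = f.eval l + g.eval l := by
  rw [W.eval, W.eval, W.eval, ← (f.summable_eval hl).of_norm.tsum_add (g.summable_eval hl).of_norm]
  exact tsum_congr fun k => by rw [W.coeff_add, add_mul]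

theorem W.eval_smul (c : ℂ) (f : W ρ) (l : ℂ) : (c • f).eval l = c * f.eval l := by
  rw [W.eval, W.eval, ← tsum_mul_left]
  exact tsum_congr fun k => by rw [W.coeff_smul, mul_assoc]

theorem W.eval_mono (n : ℤ) (c l : ℂ) : (W.mono n c : W ρ).eval l = c * l ^ n := by
  rw [W.eval, tsum_eq_single n fun k hk => by rw [W.coeff_mono, if_neg hk, zero_mul],
    W.coeff_mono, if_pos rfl]

theorem W.eval_zero (l : ℂ) : (0 : W ρ).eval l = 0 := by
  simp [W.eval, W.coeff_zero]

instance : One (W ρ) := ⟨W.mono 0 1⟩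

theorem W.one_def : (1 : W ρ) = W.mono 0 1 := rfl

theorem W.eval_one (l : ℂ) : (1 : W ρ).eval l = 1 := by
  rw [W.one_def, W.eval_mono, zpow_zero, mul_one]

/-- A loop is determined by its values on the circle, where convolution becomes pointwise
multiplication, so each ring axiom is inherited from $\mathbb C$. -/
abbrev W.normedCommRing (ρ : ℝ) [Fact (1 < ρ)] : NormedCommRing (W ρ) where
  __ := (inferInstance : NormedAddCommGroup (W ρ))
  mul_assoc f g h := W.ext_eval fun l hl => by simp only [W.eval_mul, hl, mul_assoc]
  one_mul f := W.ext_eval fun l hl => by rw [W.eval_mul _ _ hl, W.eval_one, one_mul]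
  mul_one f := W.ext_eval fun l hl => by rw [W.eval_mul _ _ hl, W.eval_one, mul_one]
  left_distrib f g h := W.ext_eval fun l hl => by
    simp only [W.eval_mul, W.eval_add, hl, mul_add]
  right_distrib f g h := W.ext_eval fun l hl => by
    simp only [W.eval_mul, W.eval_add, hl, add_mul]
  zero_mul f := W.ext_eval fun l hl => by rw [W.eval_mul _ _ hl, W.eval_zero, zero_mul]
  mul_zero f := W.ext_eval fun l hl => by rw [W.eval_mul _ _ hl, W.eval_zero, mul_zero]
  mul_comm f g := W.ext_eval fun l hl => by rw [W.eval_mul _ _ hl, W.eval_mul _ _ hl, mul_comm]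
  norm_mul_le := W.norm_mul_le'

attribute [local instance] W.normedCommRing

abbrev W.algebra (ρ : ℝ) [Fact (1 < ρ)] : Algebra ℂ (W ρ) := Algebra.ofModule
  (fun c f g => W.ext_eval fun l hl => by simp only [W.eval_mul, W.eval_smul, hl, mul_assoc])
  (fun c f g => W.ext_eval fun l hl => by
    simp only [W.eval_mul, W.eval_smul, hl, mul_left_comm])

attribute [local instance] W.algebra

abbrev W.normedAlgebra (ρ : ℝ) [Fact (1 < ρ)] : NormedAlgebra ℂ (W ρ) where
  norm_smul_le := norm_smul_le

attribute [local instance] W.normedAlgebra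

/-- Multiplication by a monomial shifts the coefficients. -/
theorem W.coeff_mono_mul (n : ℤ) (c : ℂ) (f : W ρ) (k : ℤ) :
    (W.mono n c * f).coeff k = c * f.coeff (k - n) := by
  rw [W.coeff_mul, tsum_eq_single n fun j hj => by rw [W.coeff_mono, if_neg hj, zero_mul],
    W.coeff_mono, if_pos rfl]

theorem W.mono_mul_mono (m n : ℤ) (c d : ℂ) :
    (W.mono m c * W.mono n d : W ρ) = W.mono (m + n) (c * d) := by
  refine W.ext_coeff fun k => ?_
  rw [W.coeff_mono_mul, W.coeff_mono, W.coeff_mono]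
  by_cases h : k = m + n
  · rw [if_pos h, if_pos (by omega)]
  · rw [if_neg h, if_neg (by omega), mul_zero]

/-- The coefficient functional. -/
def W.coeffL (k : ℤ) : W ρ →L[ℂ] ℂ :=
  LinearMap.mkContinuous ⟨⟨fun f => f.coeff k, fun _ _ => rfl⟩, fun _ _ => rfl⟩ 1
    fun f => (f.norm_coeff_le k).trans_eq (one_mul _).symm

theorem W.coeffL_apply (k : ℤ) (f : W ρ) : W.coeffL k f = f.coeff k := rfl

/-- The exponential decay in $|k|$, due to $\rho>1$, is what later makes evaluation at $e^{i\theta}$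
differentiable in $\theta$ in operator norm. -/
theorem W.norm_coeffL_le (k : ℤ) : ‖(W.coeffL k : W ρ →L[ℂ] ℂ)‖ ≤ (ρ ^ k.natAbs)⁻¹ := by
  refine ContinuousLinearMap.opNorm_le_bound _ (inv_nonneg.2 (weight_pos k).le) fun f => ?_
  rw [W.coeffL_apply, inv_mul_eq_div, le_div_iff₀ (weight_pos k)]
  exact f.norm_coeff_mul_le k

theorem W.norm_eval_le (f : W ρ) {l : ℂ} (hl : ‖l‖ = 1) : ‖f.eval l‖ ≤ ‖f‖ := by
  refine (norm_tsum_le_tsum_norm (f.summable_eval hl)).trans ?_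
  refine (f.summable_eval hl).tsum_le_tsum (fun k => ?_) f.summable
  rw [norm_mul, norm_zpow, hl, one_zpow, mul_one]
  exact le_mul_of_one_le_right (norm_nonneg _) (weight_one_le k)

/-- Evaluation at a point of the unit circle. -/
def W.evalL (l : ℂ) (hl : ‖l‖ = 1) : W ρ →L[ℂ] ℂ :=
  LinearMap.mkContinuous ⟨⟨fun f => f.eval l, fun f g => W.eval_add f g hl⟩,
    fun c f => W.eval_smul c f l⟩ 1 fun f => (f.norm_eval_le hl).trans_eq (one_mul _).symm

theorem W.evalL_apply (l : ℂ) (hl : ‖l‖ = 1) (f : W ρ) : W.evalL l hl f = f.eval l := rfl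

/-- Loops with real Fourier coefficients. -/
def realLoops (ρ : ℝ) [Fact (1 < ρ)] : Subalgebra ℝ (W ρ) where
  carrier := {h | ∀ k, starRingEnd ℂ (h.coeff k) = h.coeff k}
  mul_mem' := by
    intro f g hf hg k
    rw [W.coeff_mul, Complex.conj_tsum]
    exact tsum_congr fun j => by rw [map_mul, hf j, hg]
  add_mem' := by
    intro f g hf hg k
    rw [W.coeff_add, map_add, hf, hg]
  algebraMap_mem' := by
    intro r k
    have : (algebraMap ℝ (W ρ) r) = (r : ℂ) • (1 : W ρ) := rfl
    rw [this, W.coeff_smul, W.one_def, W.coeff_mono]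
    split_ifs <;> simp

theorem mem_realLoops {h : W ρ} :
    h ∈ realLoops ρ ↔ ∀ k, starRingEnd ℂ (h.coeff k) = h.coeff k := Iff.rfl

theorem isClosed_realLoops : IsClosed (realLoops ρ : Set (W ρ)) := by
  have : (realLoops ρ : Set (W ρ)) =
      ⋂ k : ℤ, {h | starRingEnd ℂ (W.coeffL k h) = W.coeffL k h} := by
    ext h
    simp [mem_realLoops, W.coeffL_apply]
  rw [this]
  exact isClosed_iInter fun k => isClosed_eq
    (Complex.continuous_conj.comp (W.coeffL k).continuous) (W.coeffL k).continuous

/-- The Banach algebra of loops with real Fourier coefficients. -/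
def RealLoops (ρ : ℝ) [Fact (1 < ρ)] : Type := realLoops ρ

def RealLoops.normedCommRing (ρ : ℝ) [Fact (1 < ρ)] : NormedCommRing (RealLoops ρ) :=
  inferInstanceAs (NormedCommRing (realLoops ρ))

instance : NormedCommRing (RealLoops ρ) := RealLoops.normedCommRing ρ

def RealLoops.normedAlgebra (ρ : ℝ) [Fact (1 < ρ)] : NormedAlgebra ℝ (RealLoops ρ) :=
  inferInstanceAs (NormedAlgebra ℝ (realLoops ρ))

instance : NormedAlgebra ℝ (RealLoops ρ) := RealLoops.normedAlgebra ρ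

instance : CompleteSpace (RealLoops ρ) :=
  show CompleteSpace (realLoops ρ) from isClosed_realLoops.completeSpace_coe

/-- The inclusion of the loops with real coefficients in `𝒲_ρ`. -/
def RealLoops.val : RealLoops ρ →L[ℝ] W ρ :=
  (⟨(realLoops ρ).val.toLinearMap, continuous_subtype_val⟩ : realLoops ρ →L[ℝ] W ρ)

theorem RealLoops.val_mul (f g : RealLoops ρ) : (f * g).val = f.val * g.val := rfl

theorem RealLoops.conj_coeff (f : RealLoops ρ) (k : ℤ) :
    starRingEnd ℂ (f.val.coeff k) = f.val.coeff k := f.2 k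

/-- A loop with real coefficients, given as an element of `𝒲_ρ`. -/
def RealLoops.mk (h : W ρ) (hh : ∀ k, starRingEnd ℂ (h.coeff k) = h.coeff k) : RealLoops ρ :=
  ⟨h, hh⟩

theorem isClosed_WRplus : IsClosed (WRplus ρ : Set (W ρ)) := by
  have : (WRplus ρ : Set (W ρ)) =
      (⋂ k : Set.Iio (0 : ℤ), {h | W.coeffL k h = 0}) ∩ (realLoops ρ : Set (W ρ)) := by
    ext h
    simp [WRplus, mem_realLoops, W.coeffL_apply]
  rw [this]
  exact (isClosed_iInter fun k : Set.Iio (0 : ℤ) => isClosed_eq (W.coeffL (ρ := ρ) (k : ℤ)).continuous continuous_const).inter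
    isClosed_realLoops

instance : CompleteSpace (WRplus ρ) := isClosed_WRplus.completeSpace_coe

instance : CompleteSpace (Param ρ) :=
  inferInstanceAs (CompleteSpace (WRplus ρ × WRplus ρ × WRplus ρ × ℝ × ℝ))

end Wiener

/-! ### Linear differential equations in a Banach algebra, solved by inverting a Picard operator. -/

section Volterra

/-! ### Picard operators in a Banach algebra -/

section Picard

variable {X : Type*} [NormedRing X] [NormedAlgebra ℝ X]

/-- The operator `Y ↦ V (Y E)`, as a linear function of `E`. -/
def picardOp (V : X →L[ℝ] X) : X →L[ℝ] (X →L[ℝ] X) :=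
  (ContinuousLinearMap.compL ℝ X X X V).comp (ContinuousLinearMap.mul ℝ X).flip

/-- The solution of `Y = 1 + t V (Y E)`, when `1 - t T_E` is invertible. -/
def frame (V : X →L[ℝ] X) (t : ℝ) (E : X) : X := Ring.inverse (1 - t • picardOp V E) 1

theorem frame_zero (V : X →L[ℝ] X) (E : X) : frame V 0 E = 1 := by
  rw [frame, zero_smul ℝ (picardOp V E), sub_zero, Ring.inverse_one]
  rfl

theorem frame_eq {V : X →L[ℝ] X} {t : ℝ} {E : X} (h : IsUnit (1 - t • picardOp V E)) :
    frame V t E = 1 + t • V (frame V t E * E) := by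
  have := congrArg (fun L => L (1 : X)) (Ring.mul_inverse_cancel _ h)
  change frame V t E - t • V (frame V t E * E) = 1 at this
  rw [← this, sub_add_cancel]

/-- One more substitution of the fixed-point equation into itself makes the division by $t$
explicit, also at $t=0$, and leaves a remainder that is again $C^1$. -/
theorem frame_eq_second {V : X →L[ℝ] X} {t : ℝ} {E : X} (h : IsUnit (1 - t • picardOp V E)) :
    frame V t E = 1 + t • (V E + t • V (V (frame V t E * E) * E)) := by
  conv_lhs => rw [frame_eq h, frame_eq h, add_mul, one_mul, map_add, smul_mul_assoc, map_smul]

variable [CompleteSpace X]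

theorem isUnit_of_norm_lt {V : X →L[ℝ] X} {t : ℝ} {E : X} (h : |t| * ‖picardOp V E‖ < 1) :
    IsUnit (1 - t • picardOp V E) :=
  isUnit_one_sub_of_norm_lt_one (by rwa [norm_smul, Real.norm_eq_abs])

/-- At $t=0$ the operator $1-tT_E$ is the identity for every $E$, and inversion in the Banach
algebra of operators is smooth there. This replaces differentiation of a differential equation in
its parameters. -/
theorem contDiffAt_frame (V : X →L[ℝ] X) (E : X) :
    ContDiffAt ℝ 1 (fun p : ℝ × X => frame V p.1 p.2) (0, E) := by
  have hi := contDiffAt_ringInverse ℝ (n := 1) (R := X →L[ℝ] X) 1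
  have hg : ContDiffAt ℝ 1 (fun p : ℝ × X => 1 - p.1 • picardOp V p.2) (0, E) := by
    refine contDiffAt_const.sub (contDiffAt_fst.smul ?_)
    exact (picardOp V).contDiff.contDiffAt.comp _ contDiffAt_snd
  have h1 : ContDiffAt ℝ 1 (fun p : ℝ × X => Ring.inverse (1 - p.1 • picardOp V p.2)) (0, E) := by
    refine ContDiffAt.comp (g := Ring.inverse) (0, E) ?_ hg
    simpa [zero_smul ℝ (picardOp V E)] using hi
  exact h1.clm_apply contDiffAt_const

theorem contDiffAt_frame_second (V : X →L[ℝ] X) (E : X) :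
    ContDiffAt ℝ 1 (fun p : ℝ × X => V (V (frame V p.1 p.2 * p.2) * p.2)) (0, E) := by
  have hv := V.contDiff (n := 1)
  exact hv.contDiffAt.comp _ ((hv.contDiffAt.comp _
    ((contDiffAt_frame V E).mul contDiffAt_snd)).mul contDiffAt_snd)

end Picard

open unitInterval

variable {B : Type*} [NormedRing B] [NormedAlgebra ℝ B]

theorem continuous_IccExtend {B : Type*} [TopologicalSpace B] (f : C(I, B)) :
    Continuous (Set.IccExtend (zero_le_one' ℝ) f) := f.continuous.Icc_extend'

/-- The operator `f ↦ (s ↦ ∫₀ˢ f)` on `C([0, 1], B)`. -/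
def volterra (B : Type*) [NormedRing B] [NormedAlgebra ℝ B] : C(I, B) →L[ℝ] C(I, B) :=
  LinearMap.mkContinuous
    { toFun := fun f => ⟨fun s => ∫ u in (0 : ℝ)..s, Set.IccExtend (zero_le_one' ℝ) f u,
        (intervalIntegral.continuous_primitive
          (fun a b => (continuous_IccExtend f).intervalIntegrable a b) 0).comp
          continuous_subtype_val⟩
      map_add' := fun f g => by
        ext s
        exact intervalIntegral.integral_add ((continuous_IccExtend f).intervalIntegrable _ _)
          ((continuous_IccExtend g).intervalIntegrable _ _)
      map_smul' := fun c f => by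
        ext s
        exact intervalIntegral.integral_smul c _ }
    1 fun f => by
      refine (ContinuousMap.norm_le _ (by positivity)).2 fun s => ?_
      refine (intervalIntegral.norm_integral_le_of_norm_le_const
        fun u _ => f.norm_coe_le_norm (Set.projIcc 0 1 zero_le_one u)).trans ?_
      rw [sub_zero, abs_of_nonneg s.2.1, one_mul]
      exact mul_le_of_le_one_right (norm_nonneg _) s.2.2

theorem volterra_apply (f : C(I, B)) (s : I) :
    volterra B f s = ∫ u in (0 : ℝ)..s, Set.IccExtend (zero_le_one' ℝ) f u := rfl

/-- The linear equation `Y' = t Y E` can be solved by inverting `1 - t T_E`. -/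
def IsRegular (t : ℝ) (E : C(I, B)) : Prop := IsUnit (1 - t • picardOp (volterra B) E)

/-- The solution of `Y' = t Y E`, `Y(0) = 1`. -/
def solution (t : ℝ) (E : C(I, B)) : C(I, B) := frame (volterra B) t E

/-- The norm of the Picard operator `T_E`. -/
def picardNorm (E : C(I, B)) : ℝ := ‖picardOp (volterra B) E‖

theorem continuous_picardNorm : Continuous (picardNorm (B := B)) :=
  (picardOp (volterra B)).continuous.norm

theorem isRegular_of_lt [CompleteSpace B] {t : ℝ} {E : C(I, B)} (h : |t| * picardNorm E < 1) :
    IsRegular t E :=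
  isUnit_of_norm_lt h

theorem solution_apply_zero {t : ℝ} {E : C(I, B)} (h : IsRegular t E) :
    solution t E 0 = 1 := by
  rw [solution, frame_eq h]
  change 1 + t • volterra B _ (0 : I) = (1 : B)
  rw [volterra_apply]
  simp

theorem hasDerivWithinAt_solution [CompleteSpace B] {t : ℝ} {E : C(I, B)}
    (h : IsRegular t E) (s : I) :
    HasDerivWithinAt (Set.IccExtend (zero_le_one' ℝ) ⇑(solution t E))
      (t • (solution t E s * E s)) (Set.Icc 0 1) s := by
  have h1 := (((continuous_IccExtend (solution t E * E)).integral_hasStrictDerivAt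
    0 s).hasDerivAt.const_smul t).const_add 1
  rw [Set.IccExtend_val] at h1
  refine h1.hasDerivWithinAt.congr_of_mem (fun u hu => ?_) s.2
  rw [Set.IccExtend_of_mem _ _ hu]
  conv_lhs => rw [solution, frame_eq h]
  rfl

/-- The remainder `R` in `Φ(1) = 1 + t (∫₀¹ E + t R)`. -/
def frameRem (t : ℝ) (E : C(I, B)) : B :=
  volterra B (volterra B (solution t E * E) * E) 1

theorem solution_apply_one {t : ℝ} {E : C(I, B)} (h : IsRegular t E) :
    solution t E 1 = 1 + t • (volterra B E 1 + t • frameRem t E) := by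
  conv_lhs => rw [solution, frame_eq_second h]
  rfl

theorem frameRem_zero (E : C(I, B)) : frameRem 0 E = volterra B (volterra B E * E) 1 := by
  rw [frameRem, solution, frame_zero, one_mul]

theorem contDiffAt_frameRem [CompleteSpace B] (E : C(I, B)) :
    ContDiffAt ℝ 1 (fun p : ℝ × C(I, B) => frameRem p.1 p.2) (0, E) :=
  (ContinuousMap.evalCLM ℝ (1 : I) : C(I, B) →L[ℝ] B).contDiff.contDiffAt.comp (0, E)
    (contDiffAt_frame_second (volterra B) E)

end Volterra

/-! ### The real coefficient functions of the potential and their integrals over $[0,1]$. -/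

section Integrals
open Real

/-- `|z - e^{iφ}|²` for real `z`. -/
def den (φ z : ℝ) : ℝ := z ^ 2 - 2 * z * cos φ + 1

/-- Completing the square: `den φ z` is $(z-\cos\varphi)^2+\sin^2\varphi$. -/
theorem sq_sin_le_den (φ z : ℝ) : sin φ ^ 2 ≤ den φ z := by
  have := sin_sq_add_cos_sq φ
  unfold den
  nlinarith [sq_nonneg (z - cos φ)]

theorem den_pos {φ : ℝ} (h : sin φ ≠ 0) (z : ℝ) : 0 < den φ z :=
  (by positivity : 0 < sin φ ^ 2).trans_le (sq_sin_le_den φ z)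

/-- For two angles these products differ by $4z^2$ times the difference of the $\sin^2$. This is the
partial fraction identity behind `integral_coefC_mul_coefA`. -/
theorem den_mul_den (φ z : ℝ) :
    den φ z * den φ (-z) = (1 - z ^ 2) ^ 2 + 4 * z ^ 2 * sin φ ^ 2 := by
  have := sin_sq_add_cos_sq φ
  unfold den
  linear_combination (-4 * z ^ 2) * this

theorem continuous_den (φ : ℝ) : Continuous (den φ) := by unfold den; fun_prop

/-- The coefficients of the potential on the real axis. -/
def coefA (φ z : ℝ) : ℝ := -(4 * z * sin (2 * φ)) / (den φ z * den φ (-z))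

def coefB (φ z : ℝ) : ℝ := 2 * (z - cos φ) / den φ z - 2 * (z + cos φ) / den φ (-z)

def coefC (φ z : ℝ) : ℝ := -(2 * sin φ) * (1 / den φ z + 1 / den φ (-z))

theorem continuous_coefA {φ : ℝ} (h : sin φ ≠ 0) : Continuous (coefA φ) := by
  have := continuous_den φ
  refine Continuous.div (by fun_prop) (by fun_prop) fun z => ?_
  exact (mul_pos (den_pos h _) (den_pos h _)).ne'

theorem continuous_coefB {φ : ℝ} (h : sin φ ≠ 0) : Continuous (coefB φ) := by
  have := continuous_den φ
  exact (Continuous.div (by fun_prop) this fun z => (den_pos h _).ne').sub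
    (Continuous.div (by fun_prop) (by fun_prop) fun z => (den_pos h _).ne')

theorem continuous_coefC {φ : ℝ} (h : sin φ ≠ 0) : Continuous (coefC φ) := by
  have := continuous_den φ
  exact continuous_const.mul ((continuous_const.div this fun z => (den_pos h _).ne').add
    (Continuous.div continuous_const (by fun_prop) fun z => (den_pos h _).ne'))

/-- `log (|z - e^{iφ}|² / |z + e^{iφ}|²)`. -/
def logRatio (φ z : ℝ) : ℝ := log (den φ z) - log (den φ (-z))

theorem hasDerivAt_den (φ z : ℝ) : HasDerivAt (den φ) (2 * (z - cos φ)) z := by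
  unfold den
  have h := (((hasDerivAt_id z).pow 2).sub (((hasDerivAt_id z).const_mul 2).mul_const
    (cos φ))).add_const 1
  refine h.congr_deriv ?_
  simp
  ring

theorem hasDerivAt_logRatio {φ : ℝ} (h : sin φ ≠ 0) (z : ℝ) :
    HasDerivAt (logRatio φ) (coefB φ z) z := by
  have h1 := (hasDerivAt_den φ z).log (den_pos h z).ne'
  have h2 := ((hasDerivAt_den φ (-z)).scomp z (hasDerivAt_neg z)).log (den_pos h (-z)).ne'
  refine (h1.sub h2).congr_deriv ?_
  rw [coefB]
  congr 1
  simp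
  ring

theorem continuous_logRatio {φ : ℝ} (h : sin φ ≠ 0) : Continuous (logRatio φ) :=
  continuous_iff_continuousAt.2 fun z => (hasDerivAt_logRatio h z).continuousAt

theorem logRatio_zero (φ : ℝ) : logRatio φ 0 = 0 := by simp [logRatio]

theorem integral_coefB {φ : ℝ} (h : sin φ ≠ 0) (s : ℝ) :
    ∫ u in (0 : ℝ)..s, coefB φ u = logRatio φ s := by
  rw [intervalIntegral.integral_eq_sub_of_hasDerivAt (fun z _ => hasDerivAt_logRatio h z)
    ((continuous_coefB h).intervalIntegrable _ _), logRatio_zero, sub_zero]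

theorem integral_coefC {φ : ℝ} (h : φ ∈ Set.Ioo 0 π) : ∫ z in (0 : ℝ)..1, coefC φ z = -π := by
  have hs : 0 < sin φ := sin_pos_of_mem_Ioo h
  have hd : ∀ z, HasDerivAt
      (fun z => -2 * (arctan ((z - cos φ) / sin φ) + arctan ((z + cos φ) / sin φ)))
      (coefC φ z) z := by
    intro z
    have h1 := (((hasDerivAt_id z).sub_const (cos φ)).div_const (sin φ)).arctan
    have h2 := (((hasDerivAt_id z).add_const (cos φ)).div_const (sin φ)).arctan
    refine ((h1.add h2).const_mul (-2)).congr_deriv ?_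
    have e1 : 1 + ((z - cos φ) / sin φ) ^ 2 = den φ z / sin φ ^ 2 := by
      rw [den]
      field_simp
      linear_combination sin_sq_add_cos_sq φ
    have e2 : 1 + ((z + cos φ) / sin φ) ^ 2 = den φ (-z) / sin φ ^ 2 := by
      rw [den]
      field_simp
      linear_combination sin_sq_add_cos_sq φ
    simp only [id, e1, e2, coefC]
    have := den_pos hs.ne' z
    have := den_pos hs.ne' (-z)
    field_simp
  rw [intervalIntegral.integral_eq_sub_of_hasDerivAt (fun z _ => hd z)
    ((continuous_coefC hs.ne').intervalIntegrable _ _)]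
  have hc : cos φ < 1 := by
    have := cos_lt_cos_of_nonneg_of_le_pi (le_refl 0) h.2.le h.1
    simpa using this
  -- The two arguments at $z=1$ are positive and reciprocal, so their arctangents add up to $\pi/2$;
  -- at $z=0$ the two arctangents cancel.
  have e : (1 + cos φ) / sin φ = ((1 - cos φ) / sin φ)⁻¹ := by
    rw [inv_div, div_eq_div_iff hs.ne' (by linarith)]
    linear_combination -sin_sq_add_cos_sq φ
  rw [e, arctan_inv_of_pos (div_pos (by linarith) hs), zero_sub, zero_add, neg_div, arctan_neg]
  ring

/-- Differentiating in the angle removes the logarithm and leaves a rational function of $z$. -/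
theorem hasDerivAt_logRatio_angle {a : ℝ} (h : sin a ≠ 0) (z : ℝ) :
    HasDerivAt (fun a => logRatio a z) (-z * coefC a z) a := by
  have hd : ∀ w, HasDerivAt (fun a => den a w) (2 * w * sin a) a := by
    intro w
    unfold den
    refine ((((hasDerivAt_cos a).const_mul (2 * w)).const_sub (w ^ 2)).add_const 1).congr_deriv ?_
    ring
  refine (((hd z).log (den_pos h z).ne').sub ((hd (-z)).log (den_pos h (-z)).ne')).congr_deriv ?_
  rw [coefC]
  ring

theorem abs_coefC_le {a m : ℝ} (hm : 0 < m) (h : m < sin a) (z : ℝ) :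
    |coefC a z| ≤ 4 / m ^ 2 := by
  have h1 : ∀ w, 1 / den a w ≤ 1 / m ^ 2 := fun w =>
    one_div_le_one_div_of_le (by positivity)
      ((pow_le_pow_left₀ hm.le h.le 2).trans (sq_sin_le_den a w))
  have h0 : ∀ w, 0 < 1 / den a w := fun w => one_div_pos.2 (den_pos (hm.trans h).ne' w)
  rw [coefC, abs_mul, abs_of_pos (add_pos (h0 z) (h0 (-z))), abs_neg, abs_mul, abs_two,
    abs_of_pos (hm.trans h)]
  calc 2 * sin a * (1 / den a z + 1 / den a (-z)) ≤ 2 * 1 * (1 / m ^ 2 + 1 / m ^ 2) := by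
        have := h0 z
        have := h0 (-z)
        have := h1 z
        have := h1 (-z)
        have := sin_le_one a
        gcongr
    _ = 4 / m ^ 2 := by ring

/-- The integral whose diagonal value is the second order term of the monodromy. -/
def logIntegral (φ a : ℝ) : ℝ := ∫ z in (0 : ℝ)..1, logRatio a z * coefA φ z

theorem hasDerivAt_logIntegral {φ a : ℝ} (hφ : sin φ ≠ 0) (ha : 0 < sin a) :
    HasDerivAt (logIntegral φ) (∫ z in (0 : ℝ)..1, -z * coefC a z * coefA φ z) a := by
  -- On this neighbourhood of $a$ the denominators stay above $(\sin a/2)^2$, which gives a uniform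
  -- bound for differentiation under the integral.
  have hopen : IsOpen {b : ℝ | sin a / 2 < sin b} := isOpen_lt continuous_const continuous_sin
  have hpos : ∀ b ∈ {b : ℝ | sin a / 2 < sin b}, sin b ≠ 0 := fun b hb =>
    ((half_pos ha).trans hb).ne'
  have hmem : {b : ℝ | sin a / 2 < sin b} ∈ 𝓝 a := hopen.mem_nhds (half_lt_self ha)
  have hA := continuous_coefA hφ
  refine (intervalIntegral.hasDerivAt_integral_of_dominated_loc_of_deriv_le
    (F := fun b z => logRatio b z * coefA φ z)
    (F' := fun b z => -z * coefC b z * coefA φ z)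
    (bound := fun z => 4 / (sin a / 2) ^ 2 * |coefA φ z|) hmem ?_ ?_ ?_ ?_ ?_ ?_).2
  · filter_upwards [hmem] with b hb
    exact ((continuous_logRatio (hpos b hb)).mul hA).aestronglyMeasurable
  · exact ((continuous_logRatio ha.ne').mul hA).intervalIntegrable _ _
  · exact ((continuous_neg.mul (continuous_coefC ha.ne')).mul hA).aestronglyMeasurable
  · refine Eventually.of_forall fun z hz b hb => ?_
    rw [Set.uIoc_of_le zero_le_one] at hz
    rw [norm_eq_abs, abs_mul, abs_mul, abs_neg, abs_of_pos hz.1]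
    refine mul_le_mul_of_nonneg_right ?_ (abs_nonneg _)
    exact (mul_le_of_le_one_left (abs_nonneg _) hz.2).trans (abs_coefC_le (half_pos ha) hb z)
  · exact (continuous_const.mul hA.abs).intervalIntegrable _ _
  · exact Eventually.of_forall fun z _ b hb =>
      (hasDerivAt_logRatio_angle (hpos b hb) z).mul_const _

/-- Partial fractions reduce the integrand to a combination of `coefC` at the two angles, and each
of those integrates to $-\pi$. The decomposition divides by $\sin^2a-\sin^2\varphi$, hence the last
hypothesis. -/
theorem integral_coefC_mul_coefA {φ a : ℝ} (hφ : φ ∈ Set.Ioo 0 π) (ha : a ∈ Set.Ioo 0 π)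
    (hne : sin a ^ 2 - sin φ ^ 2 ≠ 0) :
    ∫ z in (0 : ℝ)..1, -z * coefC a z * coefA φ z = -(2 * π * cos φ / (sin a + sin φ)) := by
  have hs : 0 < sin φ := sin_pos_of_mem_Ioo hφ
  have hs' : 0 < sin a := sin_pos_of_mem_Ioo ha
  have key : ∀ z : ℝ, -z * coefC a z * coefA φ z =
      (2 * sin φ * cos φ * sin a / (sin a ^ 2 - sin φ ^ 2)) *
        (coefC φ z / sin φ - coefC a z / sin a) := by
    intro z
    have e := den_mul_den φ z
    have e' := den_mul_den a z
    have hp : den φ z + den φ (-z) = 2 * (z ^ 2 + 1) := by unfold den; ring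
    have hp' : den a z + den a (-z) = 2 * (z ^ 2 + 1) := by unfold den; ring
    have p1 := den_pos hs.ne' z
    have p2 := den_pos hs.ne' (-z)
    have p3 := den_pos hs'.ne' z
    have p4 := den_pos hs'.ne' (-z)
    have c1 : coefC φ z = -(4 * sin φ * (z ^ 2 + 1)) / (den φ z * den φ (-z)) := by
      rw [coefC, div_add_div _ _ p1.ne' p2.ne', one_mul, mul_one, add_comm, hp]
      ring
    have c2 : coefC a z = -(4 * sin a * (z ^ 2 + 1)) / (den a z * den a (-z)) := by
      rw [coefC, div_add_div _ _ p3.ne' p4.ne', one_mul, mul_one, add_comm, hp']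
      ring
    rw [c1, c2, coefA, sin_two_mul, e, e']
    have q1 : 0 < (1 - z ^ 2) ^ 2 + 4 * z ^ 2 * sin φ ^ 2 := e ▸ mul_pos p1 p2
    have q2 : 0 < (1 - z ^ 2) ^ 2 + 4 * z ^ 2 * sin a ^ 2 := e' ▸ mul_pos p3 p4
    have q : (1 - z ^ 2) ^ 2 + 4 * z ^ 2 * sin a ^ 2 - ((1 - z ^ 2) ^ 2 + 4 * z ^ 2 * sin φ ^ 2) =
      4 * z ^ 2 * (sin a ^ 2 - sin φ ^ 2) := by ring
    generalize (1 - z ^ 2) ^ 2 + 4 * z ^ 2 * sin a ^ 2 = Y at q q2 ⊢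
    generalize (1 - z ^ 2) ^ 2 + 4 * z ^ 2 * sin φ ^ 2 = X at q q1 ⊢
    generalize sin a ^ 2 - sin φ ^ 2 = Δ at q hne ⊢
    field_simp
    linear_combination cos φ * q
  simp only [key]
  rw [intervalIntegral.integral_const_mul, intervalIntegral.integral_sub,
    intervalIntegral.integral_div, intervalIntegral.integral_div, integral_coefC hφ,
    integral_coefC ha]
  · have : sin a + sin φ ≠ 0 := by positivity
    have hne' : sin a - sin φ ≠ 0 := fun h0 => hne (by rw [sq_sub_sq, h0, mul_zero])
    rw [sq_sub_sq]
    field_simp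
    ring
  · exact ((continuous_coefC hs.ne').div_const _).intervalIntegrable _ _
  · exact ((continuous_coefC hs'.ne').div_const _).intervalIntegrable _ _

/-- The angle in the logarithm is decoupled from the one in `coefA` and moved from $\varphi$ to
$\pi/2$. There `den` is even in $z$ and the logarithm vanishes. -/
theorem integral_logRatio_mul_coefA {φ : ℝ} (h : φ ∈ Set.Ioo 0 (π / 2)) :
    ∫ z in (0 : ℝ)..1, logRatio φ z * coefA φ z = -(2 * π * log (sin φ)) := by
  have hπ := pi_pos
  have hφ : φ ∈ Set.Ioo 0 π := ⟨h.1, by linarith [h.2]⟩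
  have hs : 0 < sin φ := sin_pos_of_mem_Ioo hφ
  -- An antiderivative of $2\pi\cos\varphi/(\sin a+\sin\varphi)$ that vanishes at $a=\pi/2$, so that
  -- `logIntegral φ + G` should be constant.
  let G : ℝ → ℝ := fun a => 2 * π * (log (sin ((a + φ) / 2)) - log (cos ((a - φ) / 2)))
  have hsin : ∀ a ∈ Set.Icc φ (π / 2), 0 < sin ((a + φ) / 2) := fun a ha =>
    sin_pos_of_pos_of_lt_pi (by linarith [ha.1, h.1]) (by linarith [ha.2, h.2])
  have hcos : ∀ a ∈ Set.Icc φ (π / 2), 0 < cos ((a - φ) / 2) := fun a ha =>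
    cos_pos_of_mem_Ioo ⟨by linarith [ha.1, h.1], by linarith [ha.2, h.1]⟩
  have hG : ∀ a ∈ Set.Icc φ (π / 2), HasDerivAt G (2 * π * cos φ / (sin a + sin φ)) a := by
    intro a ha
    have h1 := (((hasDerivAt_id a).add_const φ).div_const 2).sin.log (hsin a ha).ne'
    have h2 := (((hasDerivAt_id a).sub_const φ).div_const 2).cos.log (hcos a ha).ne'
    refine ((h1.sub h2).const_mul (2 * π)).congr_deriv ?_
    have p1 := hsin a ha
    have p2 := hcos a ha
    have e1 : sin a + sin φ = 2 * sin ((a + φ) / 2) * cos ((a - φ) / 2) := by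
      rw [two_mul_sin_mul_cos]
      ring_nf
    have e2 : cos φ = cos ((a + φ) / 2) * cos ((a - φ) / 2)
        + sin ((a + φ) / 2) * sin ((a - φ) / 2) := by
      rw [← cos_sub]
      ring_nf
    rw [e1, e2]
    simp only [id]
    field_simp
    ring
  have hF : ∀ a ∈ Set.Icc φ (π / 2), HasDerivAt (logIntegral φ)
      (∫ z in (0 : ℝ)..1, -z * coefC a z * coefA φ z) a := fun a ha =>
    hasDerivAt_logIntegral hs.ne' (sin_pos_of_pos_of_lt_pi (h.1.trans_le ha.1)
      (by linarith [ha.2]))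
  -- The mean value theorem evaluates the derivative only at an interior $a>\varphi$, where $\sin
  -- a\ne\sin\varphi$ and the partial fraction formula is available.
  obtain ⟨a, ha, hslope⟩ := exists_hasDerivAt_eq_slope (fun a => logIntegral φ a + G a)
    (fun a => (∫ z in (0 : ℝ)..1, -z * coefC a z * coefA φ z) + 2 * π * cos φ / (sin a + sin φ))
    h.2 (fun a ha => ((hF a ha).add (hG a ha)).continuousAt.continuousWithinAt)
    (fun a ha => (hF a (Set.Ioo_subset_Icc_self ha)).add (hG a (Set.Ioo_subset_Icc_self ha)))
  have hlt : sin φ < sin a := sin_lt_sin_of_lt_of_le_pi_div_two (by linarith [h.1]) ha.2.le ha.1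
  rw [integral_coefC_mul_coefA hφ ⟨h.1.trans ha.1, by linarith [ha.2]⟩ (by nlinarith),
    neg_add_cancel, eq_comm, div_eq_zero_iff, sub_eq_zero] at hslope
  have hend := hslope.resolve_right (by linarith [h.2])
  have h0 : logIntegral φ (π / 2) = 0 := by
    simp [logIntegral, logRatio, den]
  have hG0 : G (π / 2) = 0 := by
    have : cos ((π / 2 - φ) / 2) = sin ((π / 2 + φ) / 2) := by
      rw [← cos_pi_div_two_sub]
      ring_nf
    simp [G, this]
  have hG1 : G φ = 2 * π * log (sin φ) := by simp [G]
  rw [h0, hG0, hG1] at hend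
  change logIntegral φ φ = _
  linarith

/-- Integration by parts reduces the other ordering of the double integral to the known one; its
boundary term cancels in `hatRem_zero`. -/
theorem integral_coefA_mul_logRatio_parts {φ : ℝ} (h : sin φ ≠ 0) :
    ∫ z in (0 : ℝ)..1, (∫ u in (0 : ℝ)..z, coefA φ u) * coefB φ z =
      (∫ u in (0 : ℝ)..1, coefA φ u) * logRatio φ 1 -
        ∫ z in (0 : ℝ)..1, logRatio φ z * coefA φ z := by
  have hA := continuous_coefA h
  rw [intervalIntegral.integral_mul_deriv_eq_deriv_mul
    (fun z _ => (hA.integral_hasStrictDerivAt 0 z).hasDerivAt)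
    (fun z _ => hasDerivAt_logRatio h z) (hA.intervalIntegrable _ _)
    ((continuous_coefB h).intervalIntegrable _ _), intervalIntegral.integral_same, zero_mul,
    sub_zero]
  simp only [mul_comm]

end Integrals

/-! ### The potential over a commutative Banach algebra and the expansion of $\widehat{\mathfrak
p}$. -/

section LoopPotential

set_option linter.unusedSectionVars false

open unitInterval

variable {R : Type*} [NormedCommRing R] [NormedAlgebra ℝ R]

/-- The Banach algebra of `2 × 2` matrices over `R`, with the operator norm for the sup norm. -/
def Mat2 (R : Type*) : Type _ := Matrix (Fin 2) (Fin 2) R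

def Mat2.normedRing (R : Type*) [NormedCommRing R] : NormedRing (Mat2 R) :=
  Matrix.linftyOpNormedRing (n := Fin 2) (α := R)

instance : NormedRing (Mat2 R) := Mat2.normedRing R

def Mat2.normedAlgebra (R : Type*) [NormedCommRing R] [NormedAlgebra ℝ R] :
    NormedAlgebra ℝ (Mat2 R) := Matrix.linftyOpNormedAlgebra (n := Fin 2) (α := R)

instance : NormedAlgebra ℝ (Mat2 R) := Mat2.normedAlgebra R

instance [CompleteSpace R] : CompleteSpace (Mat2 R) :=
  inferInstanceAs (CompleteSpace (Fin 2 → Fin 2 → R))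

/-- The matrix with rows `(a, b)` and `(c, d)`. -/
def Mat2.mk (a b c d : R) : Mat2 R := !![a, b; c, d]

/-- The entries of a matrix. -/
def Mat2.entry (i j : Fin 2) : Mat2 R →L[ℝ] R :=
  ⟨Matrix.entryLinearMap ℝ R i j, (continuous_id (X := Matrix (Fin 2) (Fin 2) R)).matrix_elem i j⟩

theorem Mat2.ext {M N : Mat2 R} (h : ∀ i j, M.entry i j = N.entry i j) : M = N :=
  Matrix.ext h

theorem Mat2.entry_mul (M N : Mat2 R) (i j : Fin 2) : (M * N).entry i j =
    M.entry i 0 * N.entry 0 j + M.entry i 1 * N.entry 1 j :=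
  (Matrix.mul_apply (M := M) (N := N)).trans (Fin.sum_univ_two _)

theorem Mat2.entry_one (i j : Fin 2) : (1 : Mat2 R).entry i j = if i = j then 1 else 0 :=
  Matrix.one_apply

theorem Mat2.entry_mk (a b c d : R) : (Mat2.mk a b c d).entry 0 0 = a ∧
    (Mat2.mk a b c d).entry 0 1 = b ∧ (Mat2.mk a b c d).entry 1 0 = c ∧
      (Mat2.mk a b c d).entry 1 1 = d := ⟨rfl, rfl, rfl, rfl⟩

theorem Mat2.continuous_mk {T : Type*} [TopologicalSpace T] {a b c d : T → R}
    (ha : Continuous a) (hb : Continuous b) (hc : Continuous c) (hd : Continuous d) :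
    Continuous fun x => Mat2.mk (a x) (b x) (c x) (d x) := by
  refine continuous_matrix (f := fun x => !![a x, b x; c x, d x]) fun i j => ?_
  fin_cases i <;> fin_cases j <;> simpa

/-- The matrix of the potential with real coefficients `α, β, γ` and entries `p = (a, b, c)`. -/
def potentialMatrix (α β γ : ℝ) (p : R × R × R) : Mat2 R :=
  Mat2.mk (α • p.1) (β • p.2.1 + γ • p.2.2) (β • p.2.1 - γ • p.2.2) (-(α • p.1))

theorem entry_potentialMatrix (α β γ : ℝ) (p : R × R × R) :
    (potentialMatrix α β γ p).entry 0 0 = α • p.1 ∧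
    (potentialMatrix α β γ p).entry 0 1 = β • p.2.1 + γ • p.2.2 ∧
    (potentialMatrix α β γ p).entry 1 0 = β • p.2.1 - γ • p.2.2 ∧
    (potentialMatrix α β γ p).entry 1 1 = -(α • p.1) := Mat2.entry_mk _ _ _ _

theorem potentialMatrix_eq (α β γ : ℝ) (p : R × R × R) : potentialMatrix α β γ p =
    α • potentialMatrix 1 0 0 p + β • potentialMatrix 0 1 0 p + γ • potentialMatrix 0 0 1 p := by
  refine Mat2.ext fun i j => ?_
  fin_cases i <;> fin_cases j <;> simp [entry_potentialMatrix, sub_eq_add_neg]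

/-- The potential along the real segment `[0, 1]`, for a fixed parameter. -/
def realPotential (φ : ℝ) (hφ : Real.sin φ ≠ 0) : R × R × R →L[ℝ] C(I, Mat2 R) where
  toFun p := ⟨fun s => potentialMatrix (coefA φ s) (coefB φ s) (coefC φ s) p, by
    have h1 := (continuous_coefA hφ).comp (continuous_subtype_val (p := (· ∈ I)))
    have h2 := (continuous_coefB hφ).comp (continuous_subtype_val (p := (· ∈ I)))
    have h3 := (continuous_coefC hφ).comp (continuous_subtype_val (p := (· ∈ I)))
    simp only [potentialMatrix_eq (coefA _ _)]
    exact ((h1.smul continuous_const).add (h2.smul continuous_const)).add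
      (h3.smul continuous_const)⟩
  map_add' p q := by
    refine ContinuousMap.ext fun s => Mat2.ext fun i j => ?_
    simp only [ContinuousMap.coe_mk, ContinuousMap.add_apply, map_add]
    fin_cases i <;> fin_cases j <;> simp [entry_potentialMatrix] <;> abel
  map_smul' c p := by
    refine ContinuousMap.ext fun s => Mat2.ext fun i j => ?_
    simp only [ContinuousMap.coe_mk, ContinuousMap.smul_apply, map_smul, RingHom.id_apply]
    fin_cases i <;> fin_cases j <;>
      simp [entry_potentialMatrix, smul_smul, mul_comm c, smul_sub]
  cont := by
    refine ContinuousMap.continuous_of_continuous_uncurry _ ?_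
    have k1 := (continuous_coefA hφ).comp
      (continuous_subtype_val.comp (continuous_snd (X := R × R × R) (Y := I)))
    have k2 := (continuous_coefB hφ).comp
      (continuous_subtype_val.comp (continuous_snd (X := R × R × R) (Y := I)))
    have k3 := (continuous_coefC hφ).comp
      (continuous_subtype_val.comp (continuous_snd (X := R × R × R) (Y := I)))
    simp only [Function.comp_def] at k1 k2 k3
    exact Mat2.continuous_mk (by fun_prop) (by fun_prop) (by fun_prop) (by fun_prop)

theorem realPotential_apply (φ : ℝ) (hφ : Real.sin φ ≠ 0) (p : R × R × R) (s : I) :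
    realPotential φ hφ p s = potentialMatrix (coefA φ s) (coefB φ s) (coefC φ s) p := rfl

variable [CompleteSpace R]

theorem integral_potentialMatrix {f g h : ℝ → ℝ} (hf : Continuous f) (hg : Continuous g)
    (hh : Continuous h) (p : R × R × R) (s : ℝ) :
    ∫ u in (0 : ℝ)..s, potentialMatrix (f u) (g u) (h u) p =
      potentialMatrix (∫ u in (0 : ℝ)..s, f u) (∫ u in (0 : ℝ)..s, g u)
        (∫ u in (0 : ℝ)..s, h u) p := by
  have key : ∀ {k : ℝ → ℝ} (_ : Continuous k) (M : Mat2 R),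
      IntervalIntegrable (fun u => k u • M) MeasureTheory.volume 0 s := fun hk M =>
    (hk.smul continuous_const).intervalIntegrable _ _
  rw [potentialMatrix_eq (∫ u in (0 : ℝ)..s, f u)]
  simp only [potentialMatrix_eq (f _)]
  rw [intervalIntegral.integral_add ((key hf _).add (key hg _)) (key hh _),
    intervalIntegral.integral_add (key hf _) (key hg _), intervalIntegral.integral_smul_const,
    intervalIntegral.integral_smul_const, intervalIntegral.integral_smul_const]

theorem volterra_realPotential (φ : ℝ) (hφ : Real.sin φ ≠ 0) (p : R × R × R) (s : I) :
    volterra _ (realPotential φ hφ p) s = potentialMatrix (∫ u in (0 : ℝ)..s, coefA φ u)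
      (∫ u in (0 : ℝ)..s, coefB φ u) (∫ u in (0 : ℝ)..s, coefC φ u) p := by
  rw [volterra_apply, ← integral_potentialMatrix (continuous_coefA hφ) (continuous_coefB hφ)
    (continuous_coefC hφ)]
  refine intervalIntegral.integral_congr fun u hu => ?_
  rw [Set.uIcc_of_le s.2.1] at hu
  rw [Set.IccExtend_of_mem _ _ ⟨hu.1, hu.2.trans s.2.2⟩]
  rfl

/-- The functional `M ↦ M₂₁ - M₁₂`. -/
def skewPart : Mat2 R →L[ℝ] R := Mat2.entry (R := R) 1 0 - Mat2.entry (R := R) 0 1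

theorem skewPart_apply (M : Mat2 R) : skewPart M = M.entry 1 0 - M.entry 0 1 := rfl

/-- All terms containing the third loop cancel, so only the product of the first two survives at
second order. -/
theorem skewPart_mul (α β γ α' β' γ' : ℝ) (p : R × R × R) :
    skewPart (potentialMatrix α β γ p * potentialMatrix α' β' γ' p) =
      (2 * (β * α') - 2 * (α * β')) • (p.1 * p.2.1) := by
  simp only [skewPart_apply, Mat2.entry_mul, entry_potentialMatrix,
    Algebra.smul_def, map_sub, map_mul, map_ofNat]
  ring

theorem skewPart_frameRem_zero (φ : ℝ) (hφ : Real.sin φ ≠ 0) (p : R × R × R) :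
    skewPart (frameRem 0 (realPotential φ hφ p)) =
      (2 * (∫ z in (0 : ℝ)..1, logRatio φ z * coefA φ z) -
        2 * ∫ z in (0 : ℝ)..1, (∫ u in (0 : ℝ)..z, coefA φ u) * coefB φ z) • (p.1 * p.2.1) := by
  have hA := continuous_coefA hφ
  have hB := continuous_coefB hφ
  have hL := continuous_logRatio hφ
  have hI : Continuous fun z => ∫ u in (0 : ℝ)..z, coefA φ u :=
    intervalIntegral.continuous_primitive (fun a b => hA.intervalIntegrable a b) 0
  have h1 : Continuous fun z => 2 * (logRatio φ z * coefA φ z) := by fun_prop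
  have h2 : Continuous fun z => 2 * ((∫ u in (0 : ℝ)..z, coefA φ u) * coefB φ z) := by fun_prop
  rw [frameRem_zero, volterra_apply, ← ContinuousLinearMap.intervalIntegral_comp_comm (skewPart (R := R))
    ((continuous_IccExtend _).intervalIntegrable _ _)]
  rw [← intervalIntegral.integral_const_mul, ← intervalIntegral.integral_const_mul,
    ← intervalIntegral.integral_sub (h1.intervalIntegrable _ _) (h2.intervalIntegrable _ _),
    ← intervalIntegral.integral_smul_const]
  refine intervalIntegral.integral_congr fun u hu => ?_
  change u ∈ Set.uIcc 0 1 at hu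
  rw [Set.uIcc_of_le zero_le_one] at hu
  change skewPart (Set.IccExtend (zero_le_one' ℝ) _ u) = _
  rw [Set.IccExtend_of_mem _ _ hu]
  change skewPart (volterra _ (realPotential φ hφ p) ⟨u, hu⟩ * realPotential φ hφ p ⟨u, hu⟩) = _
  rw [volterra_realPotential, realPotential_apply, skewPart_mul, integral_coefB hφ]

/-- `(Φ(1) - 1) / t`. -/
def frameQuot (φ : ℝ) (hφ : Real.sin φ ≠ 0) (t : ℝ) (p : R × R × R) : Mat2 R :=
  volterra _ (realPotential φ hφ p) 1 + t • frameRem t (realPotential φ hφ p)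

/-- The remainder in the first order expansion of the loop `𝔭̂`. -/
def hatRem (φ : ℝ) (hφ : Real.sin φ ≠ 0) (t : ℝ) (p : R × R × R) : R :=
  skewPart (frameRem t (realPotential φ hφ p)) +
    ((frameQuot φ hφ t p).entry 0 0 * (frameQuot φ hφ t p).entry 1 0 -
      (frameQuot φ hφ t p).entry 0 1 * (frameQuot φ hφ t p).entry 1 1)

/-- The loop `𝔭̂` as a function of `(r a, r b, r c)`. -/
def hatLoop (φ : ℝ) (hφ : Real.sin φ ≠ 0) (t : ℝ) (p : R × R × R) : R :=
  (2 * Real.pi) • p.2.2 + t • hatRem φ hφ t p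

theorem contDiffAt_hatRem (φ : ℝ) (hφ : Real.sin φ ≠ 0) (p : R × R × R) :
    ContDiffAt ℝ 1 (fun q : ℝ × R × R × R => hatRem φ hφ q.1 q.2) (0, p) := by
  have h1 : ContDiffAt ℝ 1 (fun q : ℝ × R × R × R => frameRem q.1 (realPotential φ hφ q.2))
      (0, p) := by
    have := contDiffAt_frameRem (B := Mat2 R) (realPotential φ hφ p)
    exact this.comp (0, p) (contDiffAt_fst.prodMk
      ((realPotential φ hφ).contDiff.contDiffAt.comp (0, p) contDiffAt_snd))
  have h2 : ContDiffAt ℝ 1 (fun q : ℝ × R × R × R => frameQuot φ hφ q.1 q.2) (0, p) := by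
    refine ContDiffAt.add ?_ (contDiffAt_fst.smul h1)
    exact (((ContinuousMap.evalCLM ℝ (1 : I) : C(I, Mat2 R) →L[ℝ] _).comp
      (volterra _)).comp (realPotential φ hφ)).contDiff.contDiffAt.comp (0, p) contDiffAt_snd
  have h3 : ∀ i j, ContDiffAt ℝ 1
      (fun q : ℝ × R × R × R => (frameQuot φ hφ q.1 q.2).entry i j) (0, p) := fun i j =>
    (Mat2.entry (R := R) i j).contDiff.contDiffAt.comp (0, p) h2
  exact ((skewPart (R := R)).contDiff.contDiffAt.comp (0, p) h1).add
    (((h3 0 0).mul (h3 1 0)).sub ((h3 0 1).mul (h3 1 1)))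

/-- Let $K=\int LA$, with $A$ for `coefA`, $L$ for `logRatio`, and let $I=\int A$. After integration
by parts the skew part contributes $4K-2I\,L(1)$ times $ab$ and the quadratic part contributes
$2I\,L(1)$ times $ab$, leaving $4K\,ab$. -/
theorem hatRem_zero {φ : ℝ} (h : φ ∈ Set.Ioo 0 (Real.pi / 2)) (hφ : Real.sin φ ≠ 0)
    (p : R × R × R) :
    hatRem φ hφ 0 p = (-(8 * Real.pi * Real.log (Real.sin φ))) • (p.1 * p.2.1) := by
  have hκ := integral_logRatio_mul_coefA h
  rw [hatRem, skewPart_frameRem_zero, integral_coefA_mul_logRatio_parts hφ, hκ]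
  have hq : frameQuot φ hφ 0 p = potentialMatrix (∫ u in (0 : ℝ)..1, coefA φ u)
      (∫ u in (0 : ℝ)..1, coefB φ u) (∫ u in (0 : ℝ)..1, coefC φ u) p := by
    rw [frameQuot, zero_smul, add_zero, volterra_realPotential, Set.Icc.coe_one]
  simp only [hq, entry_potentialMatrix, integral_coefB hφ, Algebra.smul_def, map_sub, map_mul, map_ofNat, map_neg]
  ring

/-- At first order only the skew coefficient `coefC` contributes, and its integral $-\pi$ produces
the factor $2\pi$ of the leading term. -/
theorem skewPart_frameQuot {φ : ℝ} (h : φ ∈ Set.Ioo 0 Real.pi) (hφ : Real.sin φ ≠ 0)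
    (t : ℝ) (p : R × R × R) :
    skewPart (frameQuot φ hφ t p) =
      (2 * Real.pi) • p.2.2 + t • skewPart (frameRem t (realPotential φ hφ p)) := by
  rw [frameQuot, map_add, map_smul, volterra_realPotential]
  congr 1
  rw [Set.Icc.coe_one, integral_coefC h]
  simp only [skewPart_apply, entry_potentialMatrix, Algebra.smul_def, map_mul, map_ofNat, map_neg]
  ring

/-- The expression `Φ₁₁ Φ₂₁ - Φ₁₂ Φ₂₂` at the end point is `t 𝔭̂`. -/
theorem solution_quadratic {φ : ℝ} (h : φ ∈ Set.Ioo 0 Real.pi) (hφ : Real.sin φ ≠ 0) {t : ℝ}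
    {p : R × R × R} (hu : IsRegular t (realPotential φ hφ p))
    {Y : Mat2 R} (hY : Y = solution t (realPotential φ hφ p) 1) :
    Y.entry 0 0 * Y.entry 1 0 - Y.entry 0 1 * Y.entry 1 1 = t • hatLoop φ hφ t p := by
  -- With $Y=1+tM$ the quadratic expression is $t(M_{21}-M_{12})+t^2(M_{11}M_{21}-M_{12}M_{22})$.
  have h1 : Y = 1 + t • frameQuot φ hφ t p := by rw [hY, solution_apply_one hu]; rfl
  have h2 := skewPart_frameQuot h hφ t p
  rw [skewPart_apply] at h2
  rw [hatLoop, hatRem, smul_add t (skewPart _), ← add_assoc, ← h2, h1]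
  simp only [map_add, map_smul, Mat2.entry_one, reduceIte, Fin.isValue, zero_ne_one, one_ne_zero,
    zero_add]
  simp only [Algebra.smul_def]
  ring

end LoopPotential

/-! ### Identification of the principal solutions on the two segments. -/

section PrincipalSolutions

/-- The bound on the coefficients makes the equation Lipschitz, so the solution picked by choice in
`principal` coincides with any solution at hand. -/
theorem principal_eq {E : ℂ → Matrix (Fin 2) (Fin 2) ℂ} {w : ℂ} {Y : ℝ → Matrix (Fin 2) (Fin 2) ℂ}
    (hY : IsFrameAlong E w Y) {K : ℝ}
    (hK : ∀ s ∈ Set.Icc (0 : ℝ) 1, ∀ i j, ‖(w • E (s * w)) i j‖ ≤ K) :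
    principal E w = Y 1 := by
  have hex : ∃ Y, IsFrameAlong E w Y := ⟨Y, hY⟩
  rw [principal, dif_pos hex]
  have hZ := hex.choose_spec
  generalize hex.choose = Z at hZ ⊢
  have hK0 : 0 ≤ K := (norm_nonneg _).trans (hK 0 (by simp) 0 0)
  let v : ℝ → (Fin 2 → Fin 2 → ℂ) → Fin 2 → Fin 2 → ℂ := fun s X i j =>
    ∑ k, X i k * (w • E (s * w)) k j
  have hv : ∀ s ∈ Set.Ico (0 : ℝ) 1, LipschitzOnWith (2 * K).toNNReal (v s) Set.univ := by
    intro s hs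
    refine LipschitzOnWith.of_dist_le_mul fun X _ X' _ => ?_
    rw [Real.coe_toNNReal _ (by positivity), dist_eq_norm, dist_eq_norm]
    refine (pi_norm_le_iff_of_nonneg (by positivity)).2 fun i =>
      (pi_norm_le_iff_of_nonneg (by positivity)).2 fun j => ?_
    change ‖∑ k, X i k * (w • E (s * w)) k j - ∑ k, X' i k * (w • E (s * w)) k j‖ ≤ _
    rw [← Finset.sum_sub_distrib]
    refine (norm_sum_le _ _).trans ((Finset.sum_le_card_nsmul _ _ (K * ‖X - X'‖) fun k _ => ?_).trans
      (by simp [mul_assoc]))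
    rw [← sub_mul, norm_mul, mul_comm]
    refine mul_le_mul (hK s (Set.Ico_subset_Icc_self hs) k j) ?_ (norm_nonneg _) hK0
    exact (norm_le_pi_norm ((X - X') i) k).trans (norm_le_pi_norm (X - X') i)
  have hd : ∀ X : ℝ → Matrix (Fin 2) (Fin 2) ℂ, IsFrameAlong E w X → ∀ s ∈ Set.Icc (0 : ℝ) 1,
      HasDerivWithinAt (F := Fin 2 → Fin 2 → ℂ) X (v s (X s)) (Set.Icc 0 1) s := by
    intro X hX s hs
    refine hasDerivWithinAt_pi.2 fun i => hasDerivWithinAt_pi.2 fun j => ?_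
    exact (hX.2 s hs i j).congr_deriv (Matrix.mul_apply ..)
  have hc : ∀ X : ℝ → Matrix (Fin 2) (Fin 2) ℂ, IsFrameAlong E w X →
      ContinuousOn (Y := Fin 2 → Fin 2 → ℂ) X (Set.Icc 0 1) :=
    fun X hX s hs => (hd X hX s hs).continuousWithinAt
  have hd' : ∀ X : ℝ → Matrix (Fin 2) (Fin 2) ℂ, IsFrameAlong E w X → ∀ s ∈ Set.Ico (0 : ℝ) 1,
      HasDerivWithinAt (F := Fin 2 → Fin 2 → ℂ) X (v s (X s)) (Set.Ici s) s := fun X hX s hs =>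
    (hd X hX s (Set.Ico_subset_Icc_self hs)).mono_of_mem_nhdsWithin (Icc_mem_nhdsGE_of_mem hs)
  exact ODE_solution_unique_of_mem_Icc_right (E := Fin 2 → Fin 2 → ℂ) (s := fun _ => Set.univ) hv
    (hc Z hZ) (hd' Z hZ) (fun _ _ => trivial) (hc Y hY) (hd' Y hY) (fun _ _ => trivial)
    (hZ.1.trans hY.1.symm) (Set.right_mem_Icc.2 zero_le_one)

section Values

open unitInterval

variable {R : Type*} [NormedCommRing R] [NormedAlgebra ℝ R] [CompleteSpace R]

/-- The values of a matrix of loops, twisted by `diag (1, u)`. -/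
def twistedValue (ev : R →L[ℝ] ℂ) (u : ℂ) (M : Mat2 R) : Matrix (Fin 2) (Fin 2) ℂ :=
  !![ev (M.entry 0 0), u * ev (M.entry 0 1); u⁻¹ * ev (M.entry 1 0), ev (M.entry 1 1)]

/-- Evaluation is a unital ring homomorphism and the twist is conjugation by $\mathrm{diag}(1,u)$.
Both commute with solving the equation, so the solution over the Banach algebra specializes to the
frame at a point. -/
theorem principal_eq_twistedValue {ev : R →L[ℝ] ℂ} (hmul : ∀ x y, ev (x * y) = ev x * ev y)
    (hone : ev 1 = 1) {u : ℂ} (hu : u ≠ 0) {t : ℝ} {X : C(I, Mat2 R)}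
    (h : IsRegular t X) {E : ℂ → Matrix (Fin 2) (Fin 2) ℂ} {w : ℂ}
    (hE : ∀ s : I, w • E ((s : ℝ) * w) = (t : ℂ) • twistedValue ev u (X s)) :
    principal E w = twistedValue ev u (solution t X 1) := by
  have hcont : ∀ i j, Continuous fun s : I => (twistedValue ev u (X s)) i j := by
    intro i j
    have : ∀ i j, Continuous fun s : I => ev ((X s).entry i j) := fun i j =>
      ev.continuous.comp ((Mat2.entry (R := R) i j).continuous.comp X.continuous)
    fin_cases i <;> fin_cases j
    · exact this 0 0
    · exact continuous_const.mul (this 0 1)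
    · exact continuous_const.mul (this 1 0)
    · exact this 1 1
  have hb : ∀ i j, ∃ K, ∀ s : I, ‖((t : ℂ) • twistedValue ev u (X s)) i j‖ ≤ K := by
    intro i j
    obtain ⟨K, hK⟩ := (isCompact_range ((continuous_const.mul (hcont i j)).norm :
      Continuous fun s : I => ‖(t : ℂ) * (twistedValue ev u (X s)) i j‖)).bddAbove
    exact ⟨K, fun s => hK ⟨s, rfl⟩⟩
  choose K hK using hb
  have hframe : IsFrameAlong E w fun s =>
      twistedValue ev u (Set.IccExtend (zero_le_one' ℝ) ⇑(solution t X) s) := by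
    constructor
    · have h0 : Set.IccExtend (zero_le_one' ℝ) ⇑(solution t X) 0 = 1 := by
        rw [Set.IccExtend_of_mem _ _ (Set.left_mem_Icc.2 zero_le_one)]
        exact solution_apply_zero h
      ext i j
      simp only [h0]
      fin_cases i <;> fin_cases j <;> simp [twistedValue, Mat2.entry_one, hone]
    · intro s hs i j
      beta_reduce
      rw [hE ⟨s, hs⟩, Set.IccExtend_of_mem _ _ hs]
      have hd := hasDerivWithinAt_solution h ⟨s, hs⟩
      generalize hF : solution t X = F at hd ⊢
      have hd' : ∀ i j, HasDerivWithinAt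
          (fun s => ev ((Set.IccExtend (zero_le_one' ℝ) ⇑F s).entry i j))
          (ev ((t • (F ⟨s, hs⟩ * X ⟨s, hs⟩)).entry i j)) (Set.Icc 0 1) s := fun i j =>
        (ev.comp (Mat2.entry i j)).hasFDerivAt.comp_hasDerivWithinAt s hd
      simp only [map_smul, Mat2.entry_mul, map_add, hmul] at hd'
      have hu' := mul_inv_cancel₀ hu
      fin_cases i <;> fin_cases j
      · refine (hd' 0 0).congr_deriv ?_
        simp [twistedValue, Matrix.mul_apply]
        linear_combination (-(t : ℂ) * ev ((F ⟨s, hs⟩).entry 0 1) * ev ((X ⟨s, hs⟩).entry 1 0)) * hu'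
      · refine ((hd' 0 1).const_mul u).congr_deriv ?_
        simp [twistedValue, Matrix.mul_apply]
        ring
      · refine ((hd' 1 0).const_mul u⁻¹).congr_deriv ?_
        simp [twistedValue, Matrix.mul_apply]
        ring
      · refine (hd' 1 1).congr_deriv ?_
        simp [twistedValue, Matrix.mul_apply]
        linear_combination (-(t : ℂ) * ev ((F ⟨s, hs⟩).entry 1 0) * ev ((X ⟨s, hs⟩).entry 0 1)) * hu'
  rw [principal_eq hframe (K := K 0 0 + K 0 1 + K 1 0 + K 1 1) fun s hs i j => ?_,
    Set.IccExtend_of_mem _ _ (Set.right_mem_Icc.2 zero_le_one)]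
  · rfl
  · rw [hE ⟨s, hs⟩]
    have hpos : ∀ i j, 0 ≤ K i j := fun i j => (norm_nonneg _).trans (hK i j 0)
    have h1 := hpos 0 0
    have h2 := hpos 0 1
    have h3 := hpos 1 0
    have h4 := hpos 1 1
    refine (hK i j ⟨s, hs⟩).trans ?_
    fin_cases i <;> fin_cases j <;> simp <;> linarith

end Values

open Complex in
theorem inv_sub_puncture {φ : ℝ} (h : Real.sin φ ≠ 0) (z : ℝ) :
    ((z : ℂ) - puncture φ 0)⁻¹ = (z - Real.cos φ + Real.sin φ * I) * (den φ z : ℂ)⁻¹ ∧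
    ((z : ℂ) - puncture φ 1)⁻¹ = (z + Real.cos φ + Real.sin φ * I) * (den φ (-z) : ℂ)⁻¹ ∧
    ((z : ℂ) - puncture φ 2)⁻¹ = (z + Real.cos φ - Real.sin φ * I) * (den φ (-z) : ℂ)⁻¹ ∧
    ((z : ℂ) - puncture φ 3)⁻¹ = (z - Real.cos φ - Real.sin φ * I) * (den φ z : ℂ)⁻¹ := by
  have e1 : Complex.exp (I * φ) = Real.cos φ + Real.sin φ * I := by
    rw [mul_comm, exp_mul_I, ofReal_cos, ofReal_sin]
  have e2 : Complex.exp (-(I * φ)) = Real.cos φ - Real.sin φ * I := by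
    rw [mul_comm, ← neg_mul, exp_mul_I, ofReal_cos, ofReal_sin, cos_neg, sin_neg]
    ring
  have hc : (Real.sin φ : ℂ) ^ 2 + (Real.cos φ : ℂ) ^ 2 = 1 := by
    exact_mod_cast Real.sin_sq_add_cos_sq φ
  have d1 : (den φ z : ℂ) ≠ 0 := ofReal_ne_zero.2 (den_pos h z).ne'
  have d2 : (den φ (-z) : ℂ) ≠ 0 := ofReal_ne_zero.2 (den_pos h (-z)).ne'
  have f1 : (den φ z : ℂ) = (z - Real.cos φ - Real.sin φ * I) * (z - Real.cos φ + Real.sin φ * I) := by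
    simp only [den, ofReal_add, ofReal_sub, ofReal_mul, ofReal_pow, ofReal_one, ofReal_ofNat]
    linear_combination -hc + (Real.sin φ : ℂ) ^ 2 * I_sq
  have f2 : (den φ (-z) : ℂ) =
      (z + Real.cos φ - Real.sin φ * I) * (z + Real.cos φ + Real.sin φ * I) := by
    simp only [den, ofReal_add, ofReal_sub, ofReal_mul, ofReal_pow, ofReal_one, ofReal_ofNat,
      ofReal_neg]
    linear_combination -hc + (Real.sin φ : ℂ) ^ 2 * I_sq
  refine ⟨?_, ?_, ?_, ?_⟩ <;> refine inv_eq_of_mul_eq_one_right ?_ <;>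
    simp only [puncture, Matrix.cons_val, e1, e2]
  · field_simp
    rw [f1]
    ring
  · field_simp
    rw [f2]
    ring
  · field_simp
    rw [f2]
    ring
  · field_simp
    rw [f1]
    ring

theorem coefA_eq {φ : ℝ} (h : Real.sin φ ≠ 0) (z : ℝ) :
    coefA φ z = -2 * Real.sin φ * ((den φ z)⁻¹ - (den φ (-z))⁻¹) := by
  have h1 := (den_pos h z).ne'
  have h2 := (den_pos h (-z)).ne'
  have : den φ (-z) - den φ z = 4 * z * Real.cos φ := by unfold den; ring
  rw [coefA, Real.sin_two_mul, inv_sub_inv h1 h2, this]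
  ring

open Complex in
-- The punctures form two conjugate pairs, so on the real axis the imaginary parts cancel. The
-- resulting real coefficients keep the frame over loops with real Fourier coefficients.
theorem sum_residueMatrix_real {φ : ℝ} (h : Real.sin φ ≠ 0) (z : ℝ) (a b c : ℂ) :
    ∑ k, ((z : ℂ) - puncture φ k)⁻¹ • residueMatrix a b c k =
      !![coefA φ z * a, coefB φ z * b + coefC φ z * c;
        coefB φ z * b - coefC φ z * c, -(coefA φ z * a)] := by
  obtain ⟨h0, h1, h2, h3⟩ := inv_sub_puncture h z
  rw [Fin.sum_univ_four, h0, h1, h2, h3, coefA_eq h, coefB, coefC]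
  ext i j
  fin_cases i <;> fin_cases j <;> simp [residueMatrix] <;> ring_nf <;> simp only [I_sq] <;> ring

open Complex in
-- Multiplication by $i$ carries the punctures for $\pi/2-\varphi$ to those for $\varphi$ with a
-- cyclic shift of the index, taken modulo 4.
theorem inv_sub_puncture_imaginary (φ z : ℝ) (k : Fin 4) :
    I * ((z : ℂ) * I - puncture φ (k + 1))⁻¹ = ((z : ℂ) - puncture (Real.pi / 2 - φ) k)⁻¹ := by
  have e1 : Complex.exp (I * (Real.pi / 2 - φ : ℝ)) = I * Complex.exp (-(I * φ)) := by
    rw [ofReal_sub, mul_sub, sub_eq_add_neg, exp_add]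
    congr 1
    rw [mul_comm]
    push_cast
    exact exp_pi_div_two_mul_I
  have e2 : Complex.exp (-(I * (Real.pi / 2 - φ : ℝ))) = -I * Complex.exp (I * φ) := by
    rw [exp_neg, e1, mul_inv, inv_I, ← exp_neg, neg_neg]
  have key : puncture φ (k + 1) = I * puncture (Real.pi / 2 - φ) k := by
    generalize Real.pi / 2 - φ = ψ at e1 e2
    fin_cases k <;> simp [puncture, e1, e2, ← mul_assoc]
  rw [key, mul_comm (z : ℂ), ← mul_sub, mul_inv, ← mul_assoc, mul_inv_cancel₀ I_ne_zero, one_mul]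

open Complex in
-- Up to conjugation by $\mathrm{diag}(1,i)$ this is the real form at the angle $\pi/2-\varphi$ with
-- $(-a,c,b)$ in place of $(a,b,c)$, so the imaginary segment needs no separate analysis.
theorem sum_residueMatrix_imaginary {φ : ℝ} (h : Real.sin (Real.pi / 2 - φ) ≠ 0) (z : ℝ)
    (a b c : ℂ) :
    I • ∑ k, ((z : ℂ) * I - puncture φ k)⁻¹ • residueMatrix a b c k =
      !![coefA (Real.pi / 2 - φ) z * -a,
        I * (coefB (Real.pi / 2 - φ) z * c + coefC (Real.pi / 2 - φ) z * b);
        I⁻¹ * (coefB (Real.pi / 2 - φ) z * c - coefC (Real.pi / 2 - φ) z * b),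
        -(coefA (Real.pi / 2 - φ) z * -a)] := by
  obtain ⟨h0, h1, h2, h3⟩ := inv_sub_puncture h z
  rw [Finset.smul_sum, ← Equiv.sum_comp (Equiv.addRight (1 : Fin 4)) fun k =>
    I • ((z : ℂ) * I - puncture φ k)⁻¹ • residueMatrix a b c k]
  simp only [smul_smul, Equiv.coe_addRight, inv_sub_puncture_imaginary]
  rw [Fin.sum_univ_four, h0, h1, h2, h3, coefA_eq h, coefB, coefC, inv_I]
  ext i j
  fin_cases i <;> fin_cases j <;> simp [residueMatrix] <;> ring_nf <;> simp only [I_sq] <;> ring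

section Quadratic

set_option linter.unusedSectionVars false

variable {R : Type*} [NormedCommRing R] [NormedAlgebra ℝ R] [CompleteSpace R]

theorem solution_quadratic_value {ev : R →L[ℝ] ℂ} (hmul : ∀ x y, ev (x * y) = ev x * ev y)
    {φ : ℝ} (h : φ ∈ Set.Ioo 0 Real.pi) (hφ : Real.sin φ ≠ 0) {t : ℝ} {p : R × R × R}
    (hu : IsRegular t (realPotential φ hφ p))
    {Y : Mat2 R} (hY : Y = solution t (realPotential φ hφ p) 1) :
    ev (Y.entry 0 0) * ev (Y.entry 1 0) - ev (Y.entry 0 1) * ev (Y.entry 1 1) =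
      t * ev (hatLoop φ hφ t p) := by
  rw [← hmul, ← hmul, ← map_sub, solution_quadratic h hφ hu hY, map_smul, Complex.real_smul]

/-- The norm of the Picard operator of the potential. -/
def potentialNorm (φ : ℝ) (hφ : Real.sin φ ≠ 0) (p : R × R × R) : ℝ :=
  picardNorm (realPotential φ hφ p)

theorem continuous_potentialNorm (φ : ℝ) (hφ : Real.sin φ ≠ 0) :
    Continuous (potentialNorm (R := R) φ hφ) :=
  continuous_picardNorm.comp (realPotential φ hφ).continuous

/-- The quadratic expression in the principal solution along the real segment. -/
theorem quadratic_principal_real {ev : R →L[ℝ] ℂ} (hmul : ∀ x y, ev (x * y) = ev x * ev y)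
    (hone : ev 1 = 1) {φ : ℝ} (h : φ ∈ Set.Ioo 0 Real.pi) (hφ : Real.sin φ ≠ 0) {t : ℝ}
    {p : R × R × R} (hu : |t| * potentialNorm φ hφ p < 1)
    {E : ℂ → Matrix (Fin 2) (Fin 2) ℂ} (hE : ∀ z, E z = (t : ℂ) • ∑ k, (z - puncture φ k)⁻¹ •
      residueMatrix (ev p.1) (ev p.2.1) (ev p.2.2) k) :
    principal E 1 0 0 * principal E 1 1 0 - principal E 1 0 1 * principal E 1 1 1 =
      t * ev (hatLoop φ hφ t p) := by
  replace hu : IsRegular t (realPotential φ hφ p) := isRegular_of_lt hu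
  rw [principal_eq_twistedValue hmul hone one_ne_zero hu fun s => ?_,
    ← solution_quadratic_value hmul h hφ hu rfl]
  · simp [twistedValue]
  · rw [one_smul, mul_one, hE, sum_residueMatrix_real hφ]
    ext i j
    fin_cases i <;> fin_cases j <;>
      simp [twistedValue, realPotential_apply, entry_potentialMatrix]

/-- The quadratic expression in the principal solution along the imaginary segment. -/
theorem quadratic_principal_imaginary {ev : R →L[ℝ] ℂ} (hmul : ∀ x y, ev (x * y) = ev x * ev y)
    (hone : ev 1 = 1) {φ ψ : ℝ} (hψ : ψ = Real.pi / 2 - φ) (h : ψ ∈ Set.Ioo 0 Real.pi)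
    (hφ : Real.sin ψ ≠ 0) {t : ℝ}
    {p : R × R × R} (hu : |t| * potentialNorm ψ hφ p < 1)
    {E : ℂ → Matrix (Fin 2) (Fin 2) ℂ} (hE : ∀ z, E z = (t : ℂ) • ∑ k, (z - puncture φ k)⁻¹ •
      residueMatrix (-ev p.1) (ev p.2.2) (ev p.2.1) k) :
    Complex.I * (principal E Complex.I 0 0 * principal E Complex.I 1 0 +
      principal E Complex.I 0 1 * principal E Complex.I 1 1) = t * ev (hatLoop ψ hφ t p) := by
  subst hψ
  replace hu : IsRegular t (realPotential (Real.pi / 2 - φ) hφ p) := isRegular_of_lt hu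
  have hE' : ∀ s : unitInterval, Complex.I • E ((s : ℝ) * Complex.I) =
      (t : ℂ) • twistedValue ev Complex.I (realPotential (Real.pi / 2 - φ) hφ p s) := by
    intro s
    rw [hE, smul_comm, sum_residueMatrix_imaginary hφ]
    ext i j
    fin_cases i <;> fin_cases j <;>
      simp [twistedValue, realPotential_apply, entry_potentialMatrix]
  have hP := principal_eq_twistedValue hmul hone Complex.I_ne_zero hu hE'
  have hq := solution_quadratic_value hmul h hφ hu rfl
  rw [hP, ← hq]
  -- The factor $i$ and the plus sign in $\mathfrak q$ are exactly undone by the twist.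
  have key : ∀ e f g k : ℂ, Complex.I * (e * (Complex.I⁻¹ * f) + Complex.I * g * k) = e * f - g * k := by
    intro e f g k
    linear_combination (g * k) * Complex.I_mul_I + (e * f) * mul_inv_cancel₀ Complex.I_ne_zero
  exact key _ _ _ _

end Quadratic

end PrincipalSolutions

/-! ### The functions $\widehat{\mathfrak p}$ and $\widehat{\mathfrak q}$ as values of loops
depending on the parameters. -/

section HatLoops

attribute [local instance] W.normedCommRing W.algebra W.normedAlgebra

open unitInterval

variable {ρ : ℝ} [Fact (1 < ρ)]

/-- Values of loops with real coefficients. -/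
def realEval (l : ℂ) (hl : ‖l‖ = 1) : RealLoops ρ →L[ℝ] ℂ :=
  ((W.evalL l hl).restrictScalars ℝ).comp RealLoops.val

theorem realEval_apply (l : ℂ) (hl : ‖l‖ = 1) (f : RealLoops ρ) :
    realEval l hl f = f.val.eval l := rfl

theorem realEval_mul (l : ℂ) (hl : ‖l‖ = 1) (f g : RealLoops ρ) :
    realEval l hl (f * g) = realEval l hl f * realEval l hl g := W.eval_mul _ _ hl

theorem realEval_one (l : ℂ) (hl : ‖l‖ = 1) : realEval l hl (1 : RealLoops ρ) = 1 := W.eval_one l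

/-- The monomial loop with a real coefficient. -/
def realMono (n : ℤ) (c : ℝ) : RealLoops ρ := RealLoops.mk (W.mono n c) fun k => by
  rw [W.coeff_mono]
  split_ifs <;> simp

/-- The inclusion of `𝒲_{ℝ,ρ}^{≥0}` in the loops with real coefficients. -/
def plusIncl : WRplus ρ →L[ℝ] RealLoops ρ :=
  ((WRplus ρ).subtypeL.codRestrict (Subalgebra.toSubmodule (realLoops ρ)) fun h => h.2.2 :
    WRplus ρ →L[ℝ] realLoops ρ)

theorem val_plusIncl (h : WRplus ρ) : (plusIncl h).val = h := rfl

/-- The components of a parameter vector. -/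
def Param.aL : Param ρ →L[ℝ] WRplus ρ :=
  ContinuousLinearMap.fst ℝ (WRplus ρ) (WRplus ρ × WRplus ρ × ℝ × ℝ)

def Param.tailL : Param ρ →L[ℝ] WRplus ρ × WRplus ρ × ℝ × ℝ :=
  ContinuousLinearMap.snd ℝ (WRplus ρ) (WRplus ρ × WRplus ρ × ℝ × ℝ)

def Param.bL : Param ρ →L[ℝ] WRplus ρ := (ContinuousLinearMap.fst ℝ _ _).comp Param.tailL

def Param.cL : Param ρ →L[ℝ] WRplus ρ :=
  (ContinuousLinearMap.fst ℝ _ _).comp ((ContinuousLinearMap.snd ℝ _ _).comp Param.tailL)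

def Param.rL : Param ρ →L[ℝ] ℝ := (ContinuousLinearMap.fst ℝ _ _).comp
  ((ContinuousLinearMap.snd ℝ _ _).comp ((ContinuousLinearMap.snd ℝ _ _).comp Param.tailL))

def Param.θL : Param ρ →L[ℝ] ℝ := (ContinuousLinearMap.snd ℝ _ _).comp
  ((ContinuousLinearMap.snd ℝ _ _).comp ((ContinuousLinearMap.snd ℝ _ _).comp Param.tailL))

/-- The loops `a, b, c` of a parameter vector as loops with real coefficients. -/
def loopA (x : Param ρ) : RealLoops ρ :=
  realMono (-1) (1 / 2) - realMono 1 (1 / 2) + plusIncl (Param.aL x)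

def loopB (φ : ℝ) (x : Param ρ) : RealLoops ρ :=
  realMono (-1) (-(1 / 2) * Real.sin φ) + realMono 1 (-(1 / 2) * Real.sin φ) +
    plusIncl (Param.bL x)

def loopC (φ : ℝ) (x : Param ρ) : RealLoops ρ :=
  realMono (-1) (-(1 / 2) * Real.cos φ) + realMono 1 (-(1 / 2) * Real.cos φ) +
    plusIncl (Param.cL x)

theorem val_realMono (n : ℤ) (c : ℝ) : (realMono n c : RealLoops ρ).val = W.mono n c := rfl

theorem val_loopA (x : Param ρ) : (loopA x).val = x.a := by
  rw [loopA, map_add, map_sub, val_plusIncl, val_realMono, val_realMono, Param.a]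
  push_cast
  rfl

theorem val_loopB (φ : ℝ) (x : Param ρ) : (loopB φ x).val = x.b φ := by
  rw [loopB, map_add, map_add, val_plusIncl, val_realMono, val_realMono, Param.b]
  push_cast
  rfl

theorem val_loopC (φ : ℝ) (x : Param ρ) : (loopC φ x).val = x.c φ := by
  rw [loopC, map_add, map_add, val_plusIncl, val_realMono, val_realMono, Param.c]
  push_cast
  rfl

theorem realEval_loopA (l : ℂ) (hl : ‖l‖ = 1) (x : Param ρ) :
    realEval l hl (loopA x) = x.a.eval l := by rw [realEval_apply, val_loopA]

theorem realEval_loopB (l : ℂ) (hl : ‖l‖ = 1) (φ : ℝ) (x : Param ρ) :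
    realEval l hl (loopB φ x) = (x.b φ).eval l := by rw [realEval_apply, val_loopB]

theorem realEval_loopC (l : ℂ) (hl : ‖l‖ = 1) (φ : ℝ) (x : Param ρ) :
    realEval l hl (loopC φ x) = (x.c φ).eval l := by rw [realEval_apply, val_loopC]

/-- The scaled loops entering `𝒫`. -/
def tripleP (φ : ℝ) (x : Param ρ) : RealLoops ρ × RealLoops ρ × RealLoops ρ :=
  (x.r • loopA x, x.r • loopB φ x, x.r • loopC φ x)

/-- The scaled loops entering `𝒬`. -/
def tripleQ (φ : ℝ) (x : Param ρ) : RealLoops ρ × RealLoops ρ × RealLoops ρ :=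
  (-(x.r • loopA x), x.r • loopC φ x, x.r • loopB φ x)

/-- The factorization is assumed on a whole interval because `dslope` at $t=0$ is a derivative and
at $t\ne0$ also involves the value at $0$. -/
theorem dslope_eq_of_eq_mul {f g : ℝ → ℂ} {δ t : ℝ} (hf : ∀ s, |s| < δ → f s = s * g s)
    (hg : DifferentiableAt ℝ g 0) (ht : |t| < δ) : dslope f 0 t = g t := by
  have hδ : 0 < δ := (abs_nonneg t).trans_lt ht
  have h0 : f 0 = 0 := by rw [hf 0 (by simpa), Complex.ofReal_zero, zero_mul]
  by_cases h : t = 0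
  · subst h
    rw [dslope_same]
    have hd : HasDerivAt (fun s : ℝ => (s : ℂ) * g s) (g 0) 0 := by
      refine ((Complex.ofRealCLM.hasDerivAt (x := 0)).mul hg.hasDerivAt).congr_deriv ?_
      simp
    refine (hd.congr_of_eventuallyEq ?_).deriv
    filter_upwards [Metric.ball_mem_nhds (0 : ℝ) hδ] with s hs
    exact hf s (by simpa using hs)
  · rw [dslope_of_ne _ h, slope_def_module, sub_zero, h0, sub_zero, hf t ht, Complex.real_smul,
      Complex.ofReal_inv, inv_mul_cancel_left₀ (Complex.ofReal_ne_zero.2 h)]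

theorem differentiableAt_realEval_hatLoop (φ : ℝ) (hφ : Real.sin φ ≠ 0) (l : ℂ) (hl : ‖l‖ = 1)
    (p : RealLoops ρ × RealLoops ρ × RealLoops ρ) :
    DifferentiableAt ℝ (fun t => realEval l hl (hatLoop φ hφ t p)) 0 := by
  have h1 : ContDiffAt ℝ 1 (fun t : ℝ => hatRem φ hφ t p) 0 :=
    (contDiffAt_hatRem φ hφ p).comp (0 : ℝ) (contDiffAt_id.prodMk contDiffAt_const)
  have h2 : DifferentiableAt ℝ (fun t : ℝ => hatLoop φ hφ t p) 0 :=
    (differentiableAt_id.smul (h1.differentiableAt one_ne_zero)).const_add _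
  exact (realEval l hl).differentiableAt.comp (0 : ℝ) h2

theorem residueMatrix_smul (r : ℝ) (a b c : ℂ) (k : Fin 4) :
    residueMatrix (r • a) (r • b) (r • c) k = (r : ℂ) • residueMatrix a b c k := by
  ext i j
  fin_cases k <;> fin_cases i <;> fin_cases j <;> simp [residueMatrix] <;> ring

theorem frakP_eq {φ : ℝ} (h : φ ∈ Set.Ioo 0 Real.pi) (hφ : Real.sin φ ≠ 0) {t : ℝ} {x : Param ρ}
    (hu : |t| * potentialNorm φ hφ (tripleP φ x) < 1)
    (l : ℂ) (hl : ‖l‖ = 1) :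
    frakP φ t x l = t * realEval l hl (hatLoop φ hφ t (tripleP φ x)) := by
  refine quadratic_principal_real (realEval_mul l hl) (realEval_one l hl) h hφ hu fun z => ?_
  simp only [tripleP, map_smul, realEval_loopA, realEval_loopB, realEval_loopC, potential, A]
  rw [mul_comm, mul_smul, Finset.smul_sum]
  refine congrArg _ (Finset.sum_congr rfl fun k _ => ?_)
  rw [smul_comm, residueMatrix_smul]

theorem frakQ_eq {φ ψ : ℝ} (hψ : ψ = Real.pi / 2 - φ) (h : ψ ∈ Set.Ioo 0 Real.pi)
    (hφ : Real.sin ψ ≠ 0) {t : ℝ} {x : Param ρ}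
    (hu : |t| * potentialNorm ψ hφ (tripleQ φ x) < 1)
    (l : ℂ) (hl : ‖l‖ = 1) :
    frakQ φ t x l = t * realEval l hl (hatLoop ψ hφ t (tripleQ φ x)) := by
  refine quadratic_principal_imaginary (realEval_mul l hl) (realEval_one l hl) hψ h hφ hu
    fun z => ?_
  simp only [tripleQ, map_neg, neg_neg, map_smul, realEval_loopA, realEval_loopB, realEval_loopC,
    potential, A]
  rw [mul_comm, mul_smul, Finset.smul_sum]
  refine congrArg _ (Finset.sum_congr rfl fun k _ => ?_)
  rw [smul_comm, residueMatrix_smul]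

end HatLoops

/-! ### Projections, evaluation on the circle, the boundary operator, and division by $1-\lambda^2$.
-/

section LoopOperators

attribute [local instance] W.normedCommRing W.algebra W.normedAlgebra

variable {ρ : ℝ} [Fact (1 < ρ)]

theorem WRplus.ext {u v : WRplus ρ} (h : ∀ k : ℕ, (u : W ρ).coeff k = (v : W ρ).coeff k) : u = v := by
  refine Subtype.ext (W.ext_coeff fun k => ?_)
  rcases lt_or_ge k 0 with hk | hk
  · rw [u.2.1 k hk, v.2.1 k hk]
  · lift k to ℕ using hk
    exact h k

/-- The projection onto the real parts of the coefficients with nonnegative index, as a map. -/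
def plusFun (h : W ρ) : W ρ :=
  W.mk (fun k => if k < 0 then 0 else ((h.coeff k).re : ℂ)) (by
    refine h.summable.of_nonneg_of_le
      (fun k => mul_nonneg (norm_nonneg _) (weight_pos k).le) fun k => ?_
    refine mul_le_mul_of_nonneg_right ?_ (weight_pos k).le
    split_ifs
    · simp
    · rw [Complex.norm_real]
      exact Complex.abs_re_le_norm _)

theorem coeff_plusFun (h : W ρ) (k : ℤ) :
    (plusFun h).coeff k = if k < 0 then 0 else ((h.coeff k).re : ℂ) := rfl

/-- The projection onto the real parts of the coefficients with nonnegative index. -/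
def plusPart : W ρ →L[ℝ] WRplus ρ :=
  LinearMap.mkContinuous
    { toFun := fun h => ⟨plusFun h, fun k hk => if_pos hk,
        fun k => by rw [coeff_plusFun]; split_ifs <;> simp⟩
      map_add' := fun f g => WRplus.ext fun k => by
        change (plusFun (f + g)).coeff k = (plusFun f).coeff k + (plusFun g).coeff k
        simp only [coeff_plusFun, W.coeff_add]
        split_ifs <;> simp
      map_smul' := fun c f => WRplus.ext fun k => by
        change (plusFun (c • f)).coeff k = (c : ℂ) * (plusFun f).coeff k
        simp only [coeff_plusFun, W.coeff_real_smul]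
        split_ifs <;> simp }
    1 fun h => by
      rw [one_mul]
      change ‖plusFun h‖ ≤ ‖h‖
      rw [W.norm_def, W.norm_def]
      refine Summable.tsum_le_tsum (fun k => ?_) (W.summable _) h.summable
      refine mul_le_mul_of_nonneg_right ?_ (weight_pos k).le
      rw [coeff_plusFun]
      split_ifs
      · simp
      · rw [Complex.norm_real]
        exact Complex.abs_re_le_norm _

theorem coeff_plusPart (h : W ρ) (k : ℕ) :
    ((plusPart h : WRplus ρ) : W ρ).coeff k = ((h.coeff k).re : ℂ) := by
  change (plusFun h).coeff k = _
  rw [coeff_plusFun, if_neg (by omega)]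

theorem WRplus.ofReal_re_coeff (u : WRplus ρ) (k : ℤ) :
    (((u : W ρ).coeff k).re : ℂ) = (u : W ρ).coeff k := Complex.conj_eq_iff_re.1 (u.2.2 k)

theorem plusPart_coe (u : WRplus ρ) : plusPart (u : W ρ) = u :=
  WRplus.ext fun k => by rw [coeff_plusPart, WRplus.ofReal_re_coeff u]

/-- The involution `h(λ) ↦ h(1/λ)`. -/
def W.rev : W ρ →L[ℝ] W ρ :=
  LinearMap.mkContinuous
    { toFun := fun h => W.mk (fun k => h.coeff (-k)) (by
        have := (Equiv.neg ℤ).summable_iff.2 h.summable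
        refine this.congr fun k => ?_
        simp)
      map_add' := fun _ _ => rfl
      map_smul' := fun _ _ => rfl }
    1 fun h => by
      rw [one_mul, W.norm_def, W.norm_def,
        ← (Equiv.neg ℤ).tsum_eq fun k => ‖h.coeff k‖ * ρ ^ k.natAbs]
      refine le_of_eq (tsum_congr fun k => ?_)
      change ‖h.coeff (-k)‖ * _ = ‖h.coeff (-k)‖ * _
      rw [Equiv.neg_apply, Int.natAbs_neg]

theorem W.coeff_rev (h : W ρ) (k : ℤ) : (W.rev h).coeff k = h.coeff (-k) := rfl

/-- The monomial `λ^n` as an element of `𝒲_{ℝ,ρ}^{≥0}`. -/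
def plusMono (n : ℕ) : WRplus ρ := plusPart (W.mono n 1)

theorem coe_plusMono (n : ℕ) : ((plusMono n : WRplus ρ) : W ρ) = W.mono n 1 := by
  refine W.ext_coeff fun k => ?_
  rcases lt_or_ge k 0 with hk | hk
  · rw [(plusMono n : WRplus ρ).2.1 k hk, W.coeff_mono, if_neg (by omega)]
  · lift k to ℕ using hk
    rw [plusMono, coeff_plusPart, W.coeff_mono]
    split_ifs <;> simp

theorem norm_exp_I_mul (θ : ℝ) : ‖Complex.exp (Complex.I * θ)‖ = 1 := by
  rw [mul_comm, Complex.norm_exp_ofReal_mul_I]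

theorem summable_pow_mul_inv_weight (n : ℕ) :
    Summable fun k : ℤ => (k.natAbs : ℝ) ^ n * (ρ ^ k.natAbs)⁻¹ := by
  have h : Summable fun k : ℕ => (k : ℝ) ^ n * (ρ⁻¹) ^ k := by
    refine summable_pow_mul_geometric_of_norm_lt_one n ?_
    have h1 : 1 < ρ := Fact.out
    rw [norm_inv, Real.norm_of_nonneg (by linarith)]
    exact inv_lt_one_of_one_lt₀ h1
  refine Summable.of_nat_of_neg ?_ ?_ <;> simpa [inv_pow] using h

/-- The functional `h ↦ Re h(e^{iθ})`. -/
def circleValue (θ : ℝ) : W ρ →L[ℝ] ℝ :=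
  Complex.reCLM.comp ((W.evalL (Complex.exp (Complex.I * θ)) (norm_exp_I_mul θ)).restrictScalars ℝ)

theorem circleValue_apply (θ : ℝ) (h : W ρ) :
    circleValue θ h = (h.eval (Complex.exp (Complex.I * θ))).re := rfl

/-- The series converges in operator norm and may be differentiated termwise, its derivative being
dominated by $|k|\rho^{-|k|}$. This matters since the evaluation point moves with the unknown
$\theta$. -/
theorem evalL_eq_tsum (θ : ℝ) :
    (W.evalL (Complex.exp (Complex.I * θ)) (norm_exp_I_mul θ) : W ρ →L[ℂ] ℂ) =
      ∑' k : ℤ, Complex.exp (Complex.I * k * θ) • W.coeffL k := by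
  have hs : Summable fun k : ℤ =>
      Complex.exp (Complex.I * k * θ) • (W.coeffL k : W ρ →L[ℂ] ℂ) := by
    refine Summable.of_norm_bounded (summable_pow_mul_inv_weight (ρ := ρ) 0) fun k => ?_
    have : Complex.exp (Complex.I * k * θ) = Complex.exp (Complex.I * ((k * θ : ℝ) : ℂ)) := by
      push_cast
      ring_nf
    rw [norm_smul, this, norm_exp_I_mul, pow_zero]
    exact mul_le_mul_of_nonneg_left (W.norm_coeffL_le k) zero_le_one
  ext h
  have := (ContinuousLinearMap.apply ℂ ℂ h).map_tsum hs
  refine Eq.trans ?_ this.symm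
  rw [W.evalL_apply, W.eval]
  refine tsum_congr fun k => ?_
  change _ = Complex.exp (Complex.I * k * θ) * h.coeff k
  rw [← Complex.exp_int_mul, mul_comm]
  ring_nf

theorem contDiff_circleValue : ContDiff ℝ 1 (fun θ => (circleValue θ : W ρ →L[ℝ] ℝ)) := by
  have hd : ∀ (k : ℤ) (θ : ℝ), HasDerivAt
      (fun θ : ℝ => Complex.exp (Complex.I * k * θ) • (W.coeffL k : W ρ →L[ℂ] ℂ))
      ((Complex.exp (Complex.I * k * θ) * (Complex.I * k)) • (W.coeffL k : W ρ →L[ℂ] ℂ)) θ := by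
    intro k θ
    have h1 : HasDerivAt (fun θ : ℝ => Complex.exp (Complex.I * k * θ))
        (Complex.exp (Complex.I * k * θ) * (Complex.I * k)) θ := by
      have := ((Complex.ofRealCLM.hasDerivAt (x := θ)).const_mul (Complex.I * k)).cexp
      simpa using this
    exact HasDerivAt.smul_const h1 (W.coeffL k : W ρ →L[ℂ] ℂ)
  have hn : ∀ (k : ℤ) (θ : ℝ), ‖Complex.exp (Complex.I * k * θ)‖ = 1 := by
    intro k θ
    have : Complex.exp (Complex.I * k * θ) = Complex.exp (Complex.I * ((k * θ : ℝ) : ℂ)) := by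
      push_cast
      ring_nf
    rw [this, norm_exp_I_mul]
  have hC : ContDiff ℝ 1 fun θ : ℝ =>
      (W.evalL (Complex.exp (Complex.I * θ)) (norm_exp_I_mul θ) : W ρ →L[ℂ] ℂ) := by
    simp only [evalL_eq_tsum]
    refine contDiff_tsum (N := 1)
      (v := fun n (k : ℤ) => (k.natAbs : ℝ) ^ n * (ρ ^ k.natAbs)⁻¹) (fun k => ?_)
      (fun n _ => summable_pow_mul_inv_weight n) fun n k θ hn' => ?_
    · have : ContDiff ℝ 1 fun θ : ℝ => Complex.exp (Complex.I * k * θ) :=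
        (contDiff_const.mul Complex.ofRealCLM.contDiff).cexp
      exact this.smul contDiff_const
    · have hle : n ≤ 1 := by exact_mod_cast hn'
      interval_cases n
      · rw [norm_iteratedFDeriv_zero, norm_smul, hn, pow_zero]
        exact mul_le_mul_of_nonneg_left (W.norm_coeffL_le k) zero_le_one
      · rw [norm_iteratedFDeriv_one, ← norm_deriv_eq_norm_fderiv, (hd k θ).deriv, norm_smul,
          norm_mul, hn, one_mul, norm_mul, Complex.norm_I, one_mul, pow_one]
        have : ‖(k : ℂ)‖ = (k.natAbs : ℝ) := by
          rw [Complex.norm_intCast, Nat.cast_natAbs, Int.cast_abs]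
        rw [this]
        exact mul_le_mul_of_nonneg_left (W.norm_coeffL_le k) (Nat.cast_nonneg _)
  have h2 : ContDiff ℝ 1 fun θ : ℝ =>
      (W.evalL (Complex.exp (Complex.I * θ)) (norm_exp_I_mul θ) : W ρ →L[ℂ] ℂ).restrictScalars ℝ :=
    (ContinuousLinearMap.restrictScalarsL ℂ (W ρ) ℂ ℝ ℝ :
      (W ρ →L[ℂ] ℂ) →L[ℝ] (W ρ →L[ℝ] ℂ)).contDiff.comp hC
  exact (ContinuousLinearMap.compL ℝ (W ρ) ℂ ℝ Complex.reCLM).contDiff.comp h2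

/-- The operator whose components of positive index measure the failure of `h = h*`, and whose
constant component is `Re h(e^{iθ})`. -/
def boundaryOp (θ : ℝ) : W ρ →L[ℝ] WRplus ρ :=
  plusPart.comp (ContinuousLinearMap.id ℝ _ - W.rev) + (circleValue θ).smulRight (plusMono 0)

theorem boundaryOp_apply (θ : ℝ) (h : W ρ) :
    boundaryOp θ h = plusPart (h - W.rev h) + circleValue θ h • plusMono 0 := rfl

theorem contDiff_boundaryOp : ContDiff ℝ 1 (fun θ => (boundaryOp θ : W ρ →L[ℝ] WRplus ρ)) := by
  refine contDiff_const.add ?_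
  exact ((ContinuousLinearMap.smulRightL ℝ (W ρ) (WRplus ρ)).flip (plusMono 0)).contDiff.comp
    contDiff_circleValue

theorem coeff_boundaryOp_zero (θ : ℝ) (h : W ρ) :
    ((boundaryOp θ h : WRplus ρ) : W ρ).coeff 0 = circleValue θ h := by
  change ((plusPart (h - W.rev h) : WRplus ρ) : W ρ).coeff ((0 : ℕ) : ℤ) +
    (circleValue θ h : ℂ) * ((plusMono 0 : WRplus ρ) : W ρ).coeff 0 = _
  rw [coeff_plusPart, coe_plusMono, W.coeff_mono, W.coeff_sub, W.coeff_rev]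
  simp

theorem coeff_boundaryOp_succ (θ : ℝ) (h : W ρ) (k : ℕ) :
    ((boundaryOp θ h : WRplus ρ) : W ρ).coeff (k + 1 : ℕ) =
      ((h.coeff (k + 1 : ℕ) - h.coeff (-(k + 1 : ℕ))).re : ℂ) := by
  change ((plusPart (h - W.rev h) : WRplus ρ) : W ρ).coeff ((k + 1 : ℕ) : ℤ) +
    (circleValue θ h : ℂ) * ((plusMono 0 : WRplus ρ) : W ρ).coeff _ = _
  rw [coeff_plusPart, coe_plusMono, W.coeff_mono, if_neg (by omega), W.coeff_sub, W.coeff_rev,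
    mul_zero, add_zero]

/-- On loops with real coefficients the kernel of the boundary operator consists of the loops
with `h = h*` which vanish at `e^{iθ}`. -/
theorem boundaryOp_eq_zero_iff (θ : ℝ) (f : RealLoops ρ) :
    boundaryOp θ f.val = 0 ↔
      (∀ l : ℂ, ‖l‖ = 1 → f.val.eval l - starRingEnd ℂ (f.val.eval l) = 0) ∧
        f.val.eval (Complex.exp (Complex.I * θ)) = 0 := by
  have hre : ∀ k, ((f.val.coeff k).re : ℂ) = f.val.coeff k := fun k =>
    Complex.conj_eq_iff_re.1 (f.conj_coeff k)
  -- For real coefficients conjugating the value at a point of the circle amounts to replacing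
  -- $\lambda$ by $\lambda^{-1}$, so $h=h^*$ is the symmetry $h_k=h_{-k}$.
  have hconj : ∀ l : ℂ, ‖l‖ = 1 → starRingEnd ℂ (f.val.eval l) = (W.rev f.val).eval l := by
    intro l hl
    have hl' : starRingEnd ℂ l = l⁻¹ := (Complex.inv_eq_conj hl).symm
    rw [W.eval, W.eval, Complex.conj_tsum, ← (Equiv.neg ℤ).tsum_eq]
    refine tsum_congr fun k => ?_
    rw [map_mul, f.conj_coeff, map_zpow₀, hl', W.coeff_rev, inv_zpow', Equiv.neg_apply, neg_neg]
  have hsym : (∀ l : ℂ, ‖l‖ = 1 → f.val.eval l - starRingEnd ℂ (f.val.eval l) = 0) ↔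
      ∀ k : ℤ, f.val.coeff k = f.val.coeff (-k) := by
    constructor
    · intro h k
      have : f.val = W.rev f.val := W.ext_eval fun l hl => by
        rw [← hconj l hl]
        exact sub_eq_zero.1 (h l hl)
      conv_lhs => rw [this]
      rfl
    · intro h l hl
      have : f.val = W.rev f.val := W.ext_coeff h
      rw [hconj l hl, ← this, sub_self]
  -- A loop with $h=h^*$ is real on the circle, so the vanishing of its real part at $e^{i\theta}$
  -- is the vanishing of its value.
  have hval : (∀ l : ℂ, ‖l‖ = 1 → f.val.eval l - starRingEnd ℂ (f.val.eval l) = 0) →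
      (f.val.eval (Complex.exp (Complex.I * θ)) = 0 ↔ circleValue θ f.val = 0) := by
    intro h
    have h1 := Complex.conj_eq_iff_re.1 (sub_eq_zero.1 (h _ (norm_exp_I_mul θ))).symm
    rw [circleValue_apply, ← h1]
    simp
  constructor
  · intro h
    have hs := hsym.2 (by
      have hpos : ∀ k : ℕ, f.val.coeff k = f.val.coeff (-k) := by
        intro k
        rcases k with _ | k
        · simp
        · have := coeff_boundaryOp_succ θ f.val k
          rw [h, Complex.sub_re, Complex.ofReal_sub, hre, hre] at this
          exact (sub_eq_zero.1 this.symm)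
      intro k
      rcases Int.eq_nat_or_neg k with ⟨n, rfl | rfl⟩
      · exact hpos n
      · rw [neg_neg]
        exact (hpos n).symm)
    refine ⟨hs, (hval hs).2 ?_⟩
    have := coeff_boundaryOp_zero θ f.val
    rw [h] at this
    exact Complex.ofReal_eq_zero.1 this.symm
  · rintro ⟨h1, h2⟩
    refine WRplus.ext fun k => ?_
    rcases k with _ | k
    · change ((boundaryOp θ f.val : WRplus ρ) : W ρ).coeff 0 = 0
      rw [coeff_boundaryOp_zero, (hval h1).1 h2, Complex.ofReal_zero]
    · rw [coeff_boundaryOp_succ, ← hsym.1 h1, sub_self]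
      rfl

/-- The boundary operator on `𝒲_{ℝ,ρ}^{≥0}`. -/
theorem boundaryOp_coe (θ : ℝ) (u : WRplus ρ) :
    boundaryOp θ (u : W ρ) = u + (circleValue θ (u : W ρ) - ((u : W ρ).coeff 0).re) • plusMono 0 := by
  refine WRplus.ext fun k => ?_
  change _ = (u : W ρ).coeff k + ((circleValue θ (u : W ρ) - ((u : W ρ).coeff 0).re : ℝ) : ℂ) *
    ((plusMono 0 : WRplus ρ) : W ρ).coeff k
  rw [coe_plusMono, W.coeff_mono]
  rcases k with _ | k
  · refine (coeff_boundaryOp_zero θ (u : W ρ)).trans ?_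
    rw [if_pos rfl, mul_one, Complex.ofReal_sub, WRplus.ofReal_re_coeff u]
    exact (add_sub_cancel _ _).symm
  · rw [coeff_boundaryOp_succ, if_neg (by omega), u.2.1 (-(k + 1 : ℕ)) (by omega), sub_zero,
      WRplus.ofReal_re_coeff u, mul_zero, add_zero]

theorem circleValue_plusMono_zero (θ : ℝ) : circleValue θ ((plusMono 0 : WRplus ρ) : W ρ) = 1 := by
  rw [coe_plusMono, circleValue_apply, W.eval_mono]
  simp

theorem boundaryOp_plusMono_zero (θ : ℝ) :
    boundaryOp θ ((plusMono 0 : WRplus ρ) : W ρ) = plusMono 0 := by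
  rw [boundaryOp_coe, circleValue_plusMono_zero, coe_plusMono, W.coeff_mono]
  simp

/-- By `boundaryOp_coe` the restricted operator is $1+N$ with $N$ of rank at most one, taking values
in the constants and killing them. Thus $N^2=0$ and the inverse is $1-N$, which also supplies the
witness in `boundaryOp_coe_surjective`. -/
theorem boundaryOp_coe_injective (θ : ℝ) {u : WRplus ρ} (h : boundaryOp θ (u : W ρ) = 0) : u = 0 := by
  have h1 := h
  rw [boundaryOp_coe, add_comm, add_eq_zero_iff_eq_neg] at h1
  have h2 : u = -(circleValue θ (u : W ρ) - ((u : W ρ).coeff 0).re) • plusMono 0 := by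
    rw [neg_smul, h1, neg_neg]
  generalize -(circleValue θ (u : W ρ) - ((u : W ρ).coeff 0).re) = c at h2
  have h3 : boundaryOp θ (u : W ρ) = c • plusMono 0 := by
    rw [h2, Submodule.coe_smul, map_smul, boundaryOp_plusMono_zero]
  rw [h2, ← h3, h]

theorem boundaryOp_coe_surjective (θ : ℝ) (y : WRplus ρ) :
    ∃ u : WRplus ρ, boundaryOp θ (u : W ρ) = y := by
  refine ⟨y + (((y : W ρ).coeff 0).re - circleValue θ (y : W ρ)) • plusMono 0, ?_⟩
  rw [Submodule.coe_add, Submodule.coe_smul, map_add, map_smul, boundaryOp_plusMono_zero,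
    boundaryOp_coe, add_assoc, ← add_smul]
  simp

/-- Division of a power series by `1 - λ²`. -/
theorem exists_division (w : WRplus ρ) : ∃ (v : WRplus ρ) (α β : ℝ),
    (w : W ρ) = (1 - W.mono 2 1) * (v : W ρ) + W.mono 0 (α : ℂ) + W.mono 1 (β : ℂ) := by
  -- $S$ is the backward shift by two places, $(Su)_k=u_{k+2}$; its norm is at most $\rho^{-2}<1$,
  -- so $1-S$ is invertible.
  let S : WRplus ρ →L[ℝ] WRplus ρ := plusPart.comp
    (((ContinuousLinearMap.mul ℝ (W ρ)) (W.mono (-2) 1)).comp (WRplus ρ).subtypeL)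
  have hcoeff : ∀ (u : WRplus ρ) (k : ℕ), ((S u : WRplus ρ) : W ρ).coeff k = (u : W ρ).coeff (k + 2 : ℕ) := by
    intro u k
    change ((plusPart (W.mono (-2) 1 * (u : W ρ)) : WRplus ρ) : W ρ).coeff k = _
    rw [coeff_plusPart, W.coeff_mono_mul, one_mul]
    exact WRplus.ofReal_re_coeff u _
  have hρ : 1 < ρ := Fact.out
  have hnorm : ‖S‖ < 1 := by
    refine lt_of_le_of_lt (ContinuousLinearMap.opNorm_le_bound _ (inv_nonneg.2 (by positivity : 0 ≤ ρ ^ 2))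
      fun u => ?_) (inv_lt_one_of_one_lt₀ (one_lt_pow₀ hρ two_ne_zero))
    rw [inv_mul_eq_div, le_div_iff₀ (by positivity)]
    change ‖((S u : WRplus ρ) : W ρ)‖ * _ ≤ ‖(u : W ρ)‖
    rw [W.norm_def, W.norm_def, ← tsum_mul_right]
    have hu := (u : W ρ).summable
    rw [← (Equiv.addRight (2 : ℤ)).tsum_eq fun k : ℤ => ‖(u : W ρ).coeff k‖ * ρ ^ k.natAbs]
    refine Summable.tsum_le_tsum (fun k => ?_) ((W.summable _).mul_right _)
      ((Equiv.addRight (2 : ℤ)).summable_iff.2 hu)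
    rcases lt_or_ge k 0 with hk | hk
    · rw [(S u).2.1 k hk, norm_zero, zero_mul, zero_mul]
      exact mul_nonneg (norm_nonneg _) (weight_pos _).le
    · lift k to ℕ using hk
      rw [hcoeff, mul_assoc, ← pow_add]
      exact le_of_eq rfl
  obtain ⟨U, hU⟩ :=
    isUnit_one_sub_of_norm_lt_one (R := WRplus ρ →L[ℝ] WRplus ρ) hnorm
  let u : WRplus ρ := (↑U⁻¹ : WRplus ρ →L[ℝ] WRplus ρ) w
  have hu : u - S u = w := by
    have := congrArg (fun L : WRplus ρ →L[ℝ] WRplus ρ => L w) U.mul_inv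
    rw [hU] at this
    exact this
  -- Substituting $u=u_0+u_1\lambda+\lambda^2Su$ in $w=u-Su$ gives
  -- $w=(1-\lambda^2)(-Su)+u_0+u_1\lambda$.
  refine ⟨-S u, ((u : W ρ).coeff 0).re, ((u : W ρ).coeff 1).re, W.ext_coeff fun k => ?_⟩
  rw [sub_mul, one_mul, W.coeff_add, W.coeff_add, W.coeff_sub, W.coeff_mono_mul, W.coeff_mono,
    W.coeff_mono, WRplus.ofReal_re_coeff u, WRplus.ofReal_re_coeff u]
  have hneg : ∀ k, ((-S u : WRplus ρ) : W ρ).coeff k = -((S u : WRplus ρ) : W ρ).coeff k := fun _ => rfl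
  rw [hneg, hneg]
  rcases lt_or_ge k 0 with hk | hk
  · rw [w.2.1 k hk, (S u).2.1 k hk, (S u).2.1 (k - 2) (by omega), if_neg (by omega),
      if_neg (by omega)]
    simp
  · lift k to ℕ using hk
    have hw : (w : W ρ).coeff k = (u : W ρ).coeff k - (u : W ρ).coeff (k + 2 : ℕ) := by
      rw [← hcoeff, ← hu]
      rfl
    rw [hw, hcoeff]
    rcases k with _ | _ | k
    · rw [(S u).2.1 _ (by norm_num)]
      simp
      ring_nf
    · rw [(S u).2.1 _ (by norm_num)]
      simp
      ring_nf
    · have : (((k + 1 + 1 : ℕ) : ℤ) - 2) = (k : ℕ) := by push_cast; ring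
      rw [this, hcoeff, if_neg (by omega), if_neg (by omega)]
      simp
      ring_nf

/-- The coefficients satisfy $v_k=v_{k-2}$, and descending by twos reaches negative indices, where
they vanish. -/
theorem eq_zero_of_one_sub_mono_two_mul {v : WRplus ρ}
    (h : (1 - W.mono 2 1) * (v : W ρ) = 0) : v = 0 := by
  have hrec : ∀ k : ℤ, (v : W ρ).coeff k = (v : W ρ).coeff (k - 2) := by
    intro k
    have := congrArg (fun f => W.coeff f k) h
    simp only [sub_mul, one_mul, W.coeff_sub, W.coeff_mono_mul, W.coeff_zero] at this
    exact sub_eq_zero.1 this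
  refine WRplus.ext fun k => ?_
  change _ = (0 : ℂ)
  induction k using Nat.strong_induction_on with
  | _ k ih =>
    rw [hrec]
    rcases lt_or_ge k 2 with hk | hk
    · exact v.2.1 _ (by omega)
    · have := ih (k - 2) (by omega)
      rwa [Nat.cast_sub hk] at this

end LoopOperators

/-! ### The Monodromy Problem as an equation between Banach spaces, and its differentiability. -/

section System

attribute [local instance] W.normedCommRing W.algebra W.normedAlgebra

variable {ρ : ℝ} [Fact (1 < ρ)]

theorem W.eval_sub (f g : W ρ) {l : ℂ} (hl : ‖l‖ = 1) :
    (f - g).eval l = f.eval l - g.eval l := map_sub (W.evalL l hl) f g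

theorem W.eval_real_smul (c : ℝ) (f : W ρ) (l : ℂ) : (c • f).eval l = c * f.eval l :=
  W.eval_smul (c : ℂ) f l

theorem W.mul_mem_WRplus {f g : W ρ} (hf : f ∈ WRplus ρ) (hg : g ∈ WRplus ρ) :
    f * g ∈ WRplus ρ := by
  refine ⟨fun n hn => ?_, (realLoops ρ).mul_mem hf.2 hg.2⟩
  rw [W.coeff_mul]
  refine (tsum_congr fun k => ?_).trans tsum_zero
  rcases lt_or_ge k 0 with hk | hk
  · rw [hf.1 k hk, zero_mul]
  · rw [hg.1 (n - k) (by omega), mul_zero]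

/-- The inclusion of `𝒲_{ℝ,ρ}^{≥0}` in `𝒲_ρ`. -/
def plusSub : WRplus ρ →L[ℝ] W ρ := (WRplus ρ).subtypeL

theorem plusSub_apply (u : WRplus ρ) : plusSub u = (u : W ρ) := rfl

/-- The linear part of `λ (det (r A₁) + 1)` at the central value, up to the term in `r`. -/
def detLin (φ : ℝ) : Param ρ →L[ℝ] W ρ :=
  (ContinuousLinearMap.mul ℝ (W ρ) (1 - W.mono 2 1)).comp (plusSub.comp Param.aL) +
    (ContinuousLinearMap.mul ℝ (W ρ) (1 + W.mono 2 1)).comp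
      (plusSub.comp (Real.sin φ • Param.bL + Real.cos φ • Param.cL))

theorem detLin_apply (φ : ℝ) (x : Param ρ) : detLin φ x =
    (1 - W.mono 2 1) * (Param.aL x : W ρ) + (1 + W.mono 2 1) *
      (Real.sin φ • (Param.bL x : W ρ) + Real.cos φ • (Param.cL x : W ρ)) := rfl

/-- The loop `λ (det (r A₁) + 1)`. -/
def detLoop (φ : ℝ) (x : Param ρ) : W ρ :=
  x.r ^ 2 • (detLin φ x + W.mono 1 1 * (plusSub (Param.aL x) * plusSub (Param.aL x) -
    plusSub (Param.bL x) * plusSub (Param.bL x) - plusSub (Param.cL x) * plusSub (Param.cL x))) +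
    (1 - x.r ^ 2) • W.mono 1 1

/-- Since $\det A_1=a^2-b^2-c^2$ equals $-1$ for the central loops, the $\lambda^{-2}$ terms cancel,
and one factor $\lambda$ clears the remaining pole. -/
theorem eval_detLoop (φ : ℝ) (x : Param ρ) {l : ℂ} (hl : ‖l‖ = 1) :
    (detLoop φ x).eval l = l * (((x.r : ℂ) • A φ x l 0).det + 1) := by
  have hl0 : l ≠ 0 := by rintro rfl; simp at hl
  have hlm : l * l⁻¹ = 1 := mul_inv_cancel₀ hl0
  have hsc : (Real.sin φ : ℂ) ^ 2 + (Real.cos φ : ℂ) ^ 2 = 1 := by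
    exact_mod_cast Real.sin_sq_add_cos_sq φ
  have hdet : ((x.r : ℂ) • A φ x l 0).det =
      (x.r : ℂ) ^ 2 * (x.a.eval l ^ 2 - (x.b φ).eval l ^ 2 - (x.c φ).eval l ^ 2) := by
    rw [A, residueMatrix, Matrix.det_fin_two]
    simp only [Matrix.cons_val_zero, Matrix.smul_apply, Matrix.of_apply, Matrix.cons_val_one,
      Matrix.cons_val', smul_eq_mul]
    linear_combination (x.r : ℂ) ^ 2 * ((x.c φ).eval l ^ 2 - x.a.eval l ^ 2) * Complex.I_sq
  rw [hdet, detLoop, detLin_apply]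
  simp only [plusSub_apply, W.eval_add, W.eval_sub, W.eval_mul, W.eval_real_smul, W.eval_mono,
    W.eval_one, hl, Param.a, Param.b, Param.c]
  change _ * ((1 - _) * W.eval (x.1 : W ρ) l + (1 + _) * (_ * W.eval (x.2.1 : W ρ) l +
    _ * W.eval (x.2.2.1 : W ρ) l) + _ * (W.eval (x.1 : W ρ) l * W.eval (x.1 : W ρ) l -
    W.eval (x.2.1 : W ρ) l * W.eval (x.2.1 : W ρ) l -
    W.eval (x.2.2.1 : W ρ) l * W.eval (x.2.2.1 : W ρ) l)) + _ = _
  generalize W.eval (x.1 : W ρ) l = a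
  generalize W.eval (x.2.1 : W ρ) l = b
  generalize W.eval (x.2.2.1 : W ρ) l = c
  rw [zpow_neg_one, zpow_one, show (l ^ (2 : ℤ)) = l ^ 2 from rfl]
  push_cast at hsc ⊢
  generalize Complex.sin (φ : ℂ) = s at *
  generalize Complex.cos (φ : ℂ) = u at *
  generalize l⁻¹ = m at *
  generalize (x.r : ℂ) = r at *
  linear_combination (r ^ 2 * (l - a - (s * b + u * c))) * hlm +
    (r ^ 2 * l / 4 * (m + l) ^ 2) * hsc

theorem mono_mem_WRplus (n : ℕ) : (W.mono n 1 : W ρ) ∈ WRplus ρ := by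
  rw [← coe_plusMono]
  exact (plusMono n).2

theorem detLoop_mem_WRplus (φ : ℝ) (x : Param ρ) : detLoop φ x ∈ WRplus ρ := by
  have h0 : (1 : W ρ) ∈ WRplus ρ := mono_mem_WRplus 0
  have h1 : (W.mono 1 1 : W ρ) ∈ WRplus ρ := mono_mem_WRplus 1
  have h2 : (W.mono 2 1 : W ρ) ∈ WRplus ρ := mono_mem_WRplus 2
  have hsq : ∀ u : WRplus ρ, plusSub u * plusSub u ∈ WRplus ρ := fun u =>
    W.mul_mem_WRplus u.2 u.2
  rw [detLoop, detLin_apply]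
  refine add_mem (Submodule.smul_mem _ _ (add_mem (add_mem ?_ ?_) ?_)) (Submodule.smul_mem _ _ h1)
  · exact W.mul_mem_WRplus (sub_mem h0 h2) (Param.aL x).2
  · exact W.mul_mem_WRplus (add_mem h0 h2) (add_mem (Submodule.smul_mem _ _ (Param.bL x).2)
      (Submodule.smul_mem _ _ (Param.cL x).2))
  · exact W.mul_mem_WRplus h1 (sub_mem (sub_mem (hsq _) (hsq _)) (hsq _))

theorem plusPart_detLoop_eq_zero_iff (φ : ℝ) (x : Param ρ) :
    plusPart (detLoop φ x) = 0 ↔ ∀ l : ℂ, ‖l‖ = 1 → ((x.r : ℂ) • A φ x l 0).det = -1 := by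
  have h1 : plusPart (detLoop φ x) = ⟨detLoop φ x, detLoop_mem_WRplus φ x⟩ :=
    plusPart_coe ⟨detLoop φ x, detLoop_mem_WRplus φ x⟩
  have h2 : plusPart (detLoop φ x) = 0 ↔ detLoop φ x = 0 := by
    rw [h1, Subtype.ext_iff]
    rfl
  rw [h2]
  constructor
  · intro h l hl
    have hl0 : l ≠ 0 := by rintro rfl; simp at hl
    have := eval_detLoop φ x hl
    rw [h, W.eval_zero] at this
    exact eq_neg_of_add_eq_zero_left ((mul_eq_zero.1 this.symm).resolve_left hl0)
  · intro h
    refine W.ext_eval fun l hl => ?_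
    rw [eval_detLoop φ x hl, h l hl, W.eval_zero]
    ring

/-- The derivative of `λ (det (r A₁) + 1)` at the central value. -/
def detDeriv (φ : ℝ) : Param ρ →L[ℝ] WRplus ρ :=
  plusPart.comp (detLin φ - (2 : ℝ) • (Param.rL.smulRight (W.mono 1 1)))

theorem hasStrictFDerivAt_detLoop (φ : ℝ) :
    HasStrictFDerivAt (fun x : Param ρ => plusPart (detLoop φ x)) (detDeriv φ)
      (Param.center ρ) := by
  have hsq : ∀ L : Param ρ →L[ℝ] WRplus ρ, L (Param.center ρ) = 0 →
      HasStrictFDerivAt (fun x => plusSub (L x) * plusSub (L x)) (0 : Param ρ →L[ℝ] W ρ)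
        (Param.center ρ) := by
    intro L hL
    have h1 : HasStrictFDerivAt (fun x => plusSub (L x)) (plusSub.comp L) (Param.center ρ) :=
      (plusSub.comp L).hasStrictFDerivAt
    have h2 := h1.mul' h1
    refine h2.congr_fderiv ?_
    rw [hL, map_zero]
    ext1 v
    simp
  have hr : HasStrictFDerivAt (fun x : Param ρ => x.r ^ 2) ((2 : ℝ) • Param.rL)
      (Param.center ρ) := by
    have h1 : HasStrictFDerivAt (fun x : Param ρ => x.r) Param.rL (Param.center ρ) :=
      Param.rL.hasStrictFDerivAt
    have hc : (Param.center ρ).r = 1 := rfl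
    have h2 := h1.pow 2
    rw [hc] at h2
    refine h2.congr_fderiv ?_
    simp
  have hquad : HasStrictFDerivAt (fun x : Param ρ => detLin φ x + W.mono 1 1 *
      (plusSub (Param.aL x) * plusSub (Param.aL x) - plusSub (Param.bL x) * plusSub (Param.bL x) -
        plusSub (Param.cL x) * plusSub (Param.cL x))) (detLin φ) (Param.center ρ) := by
    have h := (((hsq Param.aL rfl).sub (hsq Param.bL rfl)).sub (hsq Param.cL rfl))
    have h2 := (ContinuousLinearMap.mul ℝ (W ρ) (W.mono 1 1)).hasStrictFDerivAt.comp
      (Param.center ρ) h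
    have h3 := (detLin φ).hasStrictFDerivAt (x := Param.center ρ) |>.add h2
    refine h3.congr_fderiv ?_
    ext1 v
    simp
  refine plusPart.hasStrictFDerivAt.comp _ ?_
  have h := (hr.smul hquad).add ((hr.const_sub 1).smul_const (W.mono 1 1 : W ρ))
  refine h.congr_fderiv ?_
  have h0 : detLin φ (Param.center ρ) = 0 := by
    rw [detLin_apply]
    change (1 - W.mono 2 1) * (0 : W ρ) + (1 + W.mono 2 1) *
      (Real.sin φ • (0 : W ρ) + Real.cos φ • (0 : W ρ)) = 0
    simp
  have ha : plusSub (Param.aL (Param.center ρ)) = 0 := rfl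
  have hb : plusSub (Param.bL (Param.center ρ)) = 0 := rfl
  have hc : plusSub (Param.cL (Param.center ρ)) = 0 := rfl
  have hr' : (Param.center ρ).r = 1 := rfl
  rw [h0, ha, hb, hc, hr']
  ext1 v
  simp [sub_eq_add_neg, smul_smul]

/-- The linearization at the central value of the boundary operator applied to a loop
`r (κ (λ⁻¹ + λ) + u)`. -/
def boundaryDeriv (κ : ℝ) (L : Param ρ →L[ℝ] WRplus ρ) : Param ρ →L[ℝ] WRplus ρ :=
  (boundaryOp (Real.pi / 2)).comp (plusSub.comp L) -
    (2 * κ) • (Param.θL.smulRight (plusMono 0))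

/-- The loop is symmetric, so only its value at $e^{i\theta}$ remains. This is how $\theta$ enters
the linearized equations. -/
theorem boundaryOp_mono_add_mono (θ κ : ℝ) :
    boundaryOp θ (W.mono (-1) κ + W.mono 1 κ : W ρ) = (2 * κ * Real.cos θ) • plusMono 0 := by
  have h1 : (W.mono (-1) κ + W.mono 1 κ : W ρ) - W.rev (W.mono (-1) κ + W.mono 1 κ) = 0 := by
    refine W.ext_coeff fun k => ?_
    rw [W.coeff_sub, W.coeff_rev, W.coeff_add, W.coeff_add, W.coeff_mono, W.coeff_mono,
      W.coeff_mono, W.coeff_mono, W.coeff_zero]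
    have : (-k = 1) ↔ (k = -1) := by omega
    simp only [neg_inj, this]
    ring
  have h2 : circleValue θ (W.mono (-1) κ + W.mono 1 κ : W ρ) = 2 * κ * Real.cos θ := by
    rw [circleValue_apply, W.eval_add _ _ (norm_exp_I_mul θ), W.eval_mono, W.eval_mono,
      ← mul_add, zpow_neg_one, zpow_one, ← Complex.exp_neg, mul_comm Complex.I]
    have : Complex.exp (-(θ * Complex.I)) + Complex.exp (θ * Complex.I) = 2 * Complex.cos θ := by
      rw [Complex.two_cos, add_comm, neg_mul]
    rw [this]
    have : (κ : ℂ) * (2 * Complex.cos θ) = ((2 * κ * Real.cos θ : ℝ) : ℂ) := by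
      push_cast
      ring
    rw [this, Complex.ofReal_re]
  rw [boundaryOp_apply, h1, h2, map_zero, zero_add]

/-- At $\theta=\pi/2$ the operator annihilates the central loop, so varying $r$ contributes nothing;
varying $\theta$ contributes the derivative $-1$ of the cosine. -/
theorem hasStrictFDerivAt_boundaryOp_leading (κ : ℝ) {L : Param ρ →L[ℝ] WRplus ρ}
    (hL : L (Param.center ρ) = 0) :
    HasStrictFDerivAt (fun x : Param ρ => boundaryOp (Param.θL x)
      (Param.rL x • (realMono (-1) κ + realMono 1 κ + plusIncl (L x))).val)
      (boundaryDeriv κ L) (Param.center ρ) := by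
  have heq : (fun x : Param ρ => boundaryOp (Param.θL x)
      (Param.rL x • (realMono (-1) κ + realMono 1 κ + plusIncl (L x))).val) =
      fun x => Param.rL x • ((2 * κ * Real.cos (Param.θL x)) • plusMono 0 +
        boundaryOp (Param.θL x) (plusSub (L x))) := by
    funext x
    rw [map_smul, map_smul, map_add, map_add, map_add, val_realMono, val_realMono, val_plusIncl,
      ← boundaryOp_mono_add_mono, map_add, plusSub_apply]
  have hθ : HasStrictFDerivAt (fun x : Param ρ => Param.θL x) Param.θL (Param.center ρ) :=
    Param.θL.hasStrictFDerivAt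
  have hr : HasStrictFDerivAt (fun x : Param ρ => Param.rL x) Param.rL (Param.center ρ) :=
    Param.rL.hasStrictFDerivAt
  have hB : HasStrictFDerivAt (fun x : Param ρ => (boundaryOp (Param.θL x) : W ρ →L[ℝ] WRplus ρ))
      _ (Param.center ρ) :=
    ((contDiff_boundaryOp.comp Param.θL.contDiff).contDiffAt (x := Param.center ρ)).hasStrictFDerivAt
      one_ne_zero
  have hu : HasStrictFDerivAt (fun x : Param ρ => plusSub (L x)) (plusSub.comp L)
      (Param.center ρ) := (plusSub.comp L).hasStrictFDerivAt
  have h := hr.smul ((((hθ.cos).const_mul (2 * κ)).smul_const (plusMono 0 : WRplus ρ)).add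
    (hB.clm_apply hu))
  rw [heq]
  refine h.congr_fderiv ?_
  have hθ0 : Param.θL (Param.center ρ) = Real.pi / 2 := rfl
  have hr0 : Param.rL (Param.center ρ) = 1 := rfl
  rw [hL, map_zero, hθ0, hr0, boundaryDeriv]
  ext1 v
  simp [smul_smul, hL, hθ0]
  abel

/-- The boundary operator at `e^{iθ}` applied to `𝔭̂` or `𝔮̂`. -/
def hatSystem (φ : ℝ) (hφ : Real.sin φ ≠ 0)
    (T : Param ρ → RealLoops ρ × RealLoops ρ × RealLoops ρ) (q : ℝ × Param ρ) : WRplus ρ :=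
  boundaryOp (Param.θL q.2) (hatLoop φ hφ q.1 (T q.2)).val

/-- The remainder carries a factor $t$, so at $t=0$ only its value enters the derivative, never its
own derivative. -/
theorem hasStrictFDerivAt_hatSystem (φ : ℝ) (hφ : Real.sin φ ≠ 0)
    {T : Param ρ → RealLoops ρ × RealLoops ρ × RealLoops ρ} (hT : ContDiff ℝ 1 T)
    {x : Param ρ} {D : Param ρ →L[ℝ] WRplus ρ}
    (hD : HasStrictFDerivAt (fun x => boundaryOp (Param.θL x) (T x).2.2.val) D x) :
    HasStrictFDerivAt (hatSystem φ hφ T)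
      (((2 * Real.pi) • D).comp (ContinuousLinearMap.snd ℝ ℝ (Param ρ)) +
        (ContinuousLinearMap.fst ℝ ℝ (Param ρ)).smulRight
          (boundaryOp (Param.θL x) (hatRem φ hφ 0 (T x)).val)) (0, x) := by
  have hθ : ContDiff ℝ 1 fun q : ℝ × Param ρ => (boundaryOp (Param.θL q.2) : W ρ →L[ℝ] WRplus ρ) :=
    contDiff_boundaryOp.comp (Param.θL.contDiff.comp contDiff_snd)
  have hR : ContDiffAt ℝ 1 (fun q : ℝ × Param ρ => hatRem φ hφ q.1 (T q.2)) (0, x) :=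
    ContDiffAt.comp (0, x) (contDiffAt_hatRem φ hφ (T x))
      ((contDiff_fst.prodMk (hT.comp contDiff_snd)).contDiffAt)
  have hV : ContDiffAt ℝ 1 (fun q : ℝ × Param ρ => (hatRem φ hφ q.1 (T q.2)).val) (0, x) :=
    RealLoops.val.contDiff.contDiffAt.comp (0, x) hR
  have hg : HasStrictFDerivAt (fun q : ℝ × Param ρ => boundaryOp (Param.θL q.2)
      (hatRem φ hφ q.1 (T q.2)).val) _ (0, x) :=
    (hθ.contDiffAt.clm_apply hV).hasStrictFDerivAt one_ne_zero
  have ht : HasStrictFDerivAt (fun q : ℝ × Param ρ => q.1) (ContinuousLinearMap.fst ℝ ℝ (Param ρ))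
      (0, x) := hasStrictFDerivAt_fst
  have hD' : HasStrictFDerivAt (fun q : ℝ × Param ρ => boundaryOp (Param.θL q.2) (T q.2).2.2.val)
      (D.comp (ContinuousLinearMap.snd ℝ ℝ (Param ρ))) (0, x) :=
    HasStrictFDerivAt.comp (g := fun x => boundaryOp (Param.θL x) (T x).2.2.val) (f := Prod.snd)
      ((0 : ℝ), x) hD hasStrictFDerivAt_snd
  have heq : hatSystem φ hφ T = fun q => (2 * Real.pi) • boundaryOp (Param.θL q.2) (T q.2).2.2.val +
      q.1 • boundaryOp (Param.θL q.2) (hatRem φ hφ q.1 (T q.2)).val := by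
    funext q
    rw [hatSystem, hatLoop, map_add, map_add, map_smul, map_smul, map_smul, map_smul]
  rw [heq]
  refine ((hD'.const_smul (2 * Real.pi)).add (ht.smul hg)).congr_fderiv ?_
  refine ContinuousLinearMap.ext fun v => ?_
  simp

theorem contDiff_loopA : ContDiff ℝ 1 (loopA : Param ρ → RealLoops ρ) :=
  contDiff_const.add (plusIncl.contDiff.comp Param.aL.contDiff)

theorem contDiff_loopB (φ : ℝ) : ContDiff ℝ 1 (loopB φ : Param ρ → RealLoops ρ) :=
  contDiff_const.add (plusIncl.contDiff.comp Param.bL.contDiff)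

theorem contDiff_loopC (φ : ℝ) : ContDiff ℝ 1 (loopC φ : Param ρ → RealLoops ρ) :=
  contDiff_const.add (plusIncl.contDiff.comp Param.cL.contDiff)

theorem contDiff_r : ContDiff ℝ 1 (Param.r : Param ρ → ℝ) := Param.rL.contDiff

theorem contDiff_tripleP (φ : ℝ) : ContDiff ℝ 1 (tripleP φ : Param ρ → _) :=
  (contDiff_r.smul contDiff_loopA).prodMk
    ((contDiff_r.smul (contDiff_loopB φ)).prodMk (contDiff_r.smul (contDiff_loopC φ)))

theorem contDiff_tripleQ (φ : ℝ) : ContDiff ℝ 1 (tripleQ φ : Param ρ → _) :=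
  (contDiff_r.smul contDiff_loopA).neg.prodMk
    ((contDiff_r.smul (contDiff_loopC φ)).prodMk (contDiff_r.smul (contDiff_loopB φ)))

/-- A single $\delta$ serves all nearby parameters and all $|t|<\delta$, as `dslope_eq_of_eq_mul`
requires at each fixed parameter. -/
theorem eventually_mul_potentialNorm_lt (φ : ℝ) (hφ : Real.sin φ ≠ 0)
    {T : Param ρ → RealLoops ρ × RealLoops ρ × RealLoops ρ} (hT : Continuous T) (x₀ : Param ρ) :
    ∃ δ > 0, ∀ᶠ x in 𝓝 x₀, ∀ t : ℝ, |t| < δ → |t| * potentialNorm φ hφ (T x) < 1 := by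
  have hc : Continuous fun x => potentialNorm φ hφ (T x) :=
    (continuous_potentialNorm φ hφ).comp hT
  set M := |potentialNorm φ hφ (T x₀)| + 1 with hM
  have hM0 : 0 < M := by positivity
  refine ⟨M⁻¹, inv_pos.2 hM0, ?_⟩
  have : ∀ᶠ x in 𝓝 x₀, potentialNorm φ hφ (T x) < M := by
    refine hc.continuousAt.eventually_lt continuousAt_const ?_
    exact (le_abs_self _).trans_lt (lt_add_one _)
  filter_upwards [this] with x hx t ht
  calc |t| * potentialNorm φ hφ (T x) ≤ |t| * M :=
        mul_le_mul_of_nonneg_left hx.le (abs_nonneg t)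
    _ < M⁻¹ * M := mul_lt_mul_of_pos_right ht hM0
    _ = 1 := inv_mul_cancel₀ hM0.ne'

theorem eventually_hatP {φ : ℝ} (h : φ ∈ Set.Ioo 0 Real.pi) (hφ : Real.sin φ ≠ 0)
    (x₀ : Param ρ) : ∀ᶠ q : ℝ × Param ρ in 𝓝 (0, x₀), ∀ l : ℂ, ‖l‖ = 1 →
      hatP φ q.1 q.2 l = (hatLoop φ hφ q.1 (tripleP φ q.2)).val.eval l := by
  obtain ⟨δ, hδ, hev⟩ := eventually_mul_potentialNorm_lt φ hφ (contDiff_tripleP φ).continuous x₀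
  have ht : ∀ᶠ t in 𝓝 (0 : ℝ), |t| < δ := by
    filter_upwards [Metric.ball_mem_nhds (0 : ℝ) hδ] with t ht
    simpa using ht
  rw [nhds_prod_eq]
  filter_upwards [ht.prod_mk hev] with q ⟨h1, h2⟩ l hl
  exact dslope_eq_of_eq_mul (fun s hs => frakP_eq h hφ (h2 s hs) l hl)
    (differentiableAt_realEval_hatLoop φ hφ l hl _) h1

theorem eventually_hatQ {φ ψ : ℝ} (hψ : ψ = Real.pi / 2 - φ) (h : ψ ∈ Set.Ioo 0 Real.pi)
    (hφ : Real.sin ψ ≠ 0) (x₀ : Param ρ) :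
    ∀ᶠ q : ℝ × Param ρ in 𝓝 (0, x₀), ∀ l : ℂ, ‖l‖ = 1 →
      hatQ φ q.1 q.2 l = (hatLoop ψ hφ q.1 (tripleQ φ q.2)).val.eval l := by
  obtain ⟨δ, hδ, hev⟩ := eventually_mul_potentialNorm_lt ψ hφ (contDiff_tripleQ φ).continuous x₀
  have ht : ∀ᶠ t in 𝓝 (0 : ℝ), |t| < δ := by
    filter_upwards [Metric.ball_mem_nhds (0 : ℝ) hδ] with t ht
    simpa using ht
  rw [nhds_prod_eq]
  filter_upwards [ht.prod_mk hev] with q ⟨h1, h2⟩ l hl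
  exact dslope_eq_of_eq_mul (fun s hs => frakQ_eq hψ h hφ (h2 s hs) l hl)
    (differentiableAt_realEval_hatLoop ψ hφ l hl _) h1

theorem starInv_eq {f : ℂ → ℂ} {l : ℂ} (hl : ‖l‖ = 1) : starInv f l = starRingEnd ℂ (f l) := by
  rw [starInv, ← Complex.inv_eq_conj hl, one_div, inv_inv]

/-- The equations of the Monodromy Problem. -/
def monodromySystem (φ : ℝ) (hs : Real.sin φ ≠ 0) (hc : Real.sin (Real.pi / 2 - φ) ≠ 0)
    (q : ℝ × Param ρ) : WRplus ρ × WRplus ρ × WRplus ρ :=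
  (hatSystem φ hs (tripleP φ) q, hatSystem (Real.pi / 2 - φ) hc (tripleQ φ) q,
    plusPart (detLoop φ q.2))

theorem eventually_solvesMonodromyProblem_iff {φ : ℝ} (hφ : φ ∈ Set.Ioo 0 (Real.pi / 2))
    (hs : Real.sin φ ≠ 0) (hc : Real.sin (Real.pi / 2 - φ) ≠ 0) :
    ∀ᶠ q : ℝ × Param ρ in 𝓝 (0, Param.center ρ),
      SolvesMonodromyProblem φ q.1 q.2 ↔ monodromySystem φ hs hc q = 0 := by
  have hθ : ∀ᶠ q : ℝ × Param ρ in 𝓝 (0, Param.center ρ), q.2.θ ∈ Set.Ioo 0 Real.pi := by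
    have : Continuous fun q : ℝ × Param ρ => Param.θL q.2 := Param.θL.continuous.comp continuous_snd
    refine this.continuousAt.eventually_mem (Ioo_mem_nhds ?_ ?_)
    · exact Real.pi_div_two_pos
    · exact half_lt_self Real.pi_pos
  have hπ := Real.pi_pos
  filter_upwards [hθ, eventually_hatP ⟨hφ.1, by linarith [hφ.2]⟩ hs _,
    eventually_hatQ rfl ⟨by linarith [hφ.2], by linarith [hφ.1]⟩ hc _] with q hθ hP hQ
  have hstar : ∀ {f : ℂ → ℂ} {g : RealLoops ρ}, (∀ l : ℂ, ‖l‖ = 1 → f l = g.val.eval l) →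
      (boundaryOp q.2.θ g.val = 0 ↔ (∀ l : ℂ, ‖l‖ = 1 → f l - starInv f l = 0) ∧
        f (Complex.exp (Complex.I * q.2.θ)) = 0) := by
    intro f g hfg
    rw [boundaryOp_eq_zero_iff, hfg _ (norm_exp_I_mul _)]
    refine and_congr_left fun _ => forall₂_congr fun l hl => ?_
    rw [starInv_eq hl, hfg l hl]
  have h1 := hstar hP
  have h2 := hstar hQ
  have h3 := plusPart_detLoop_eq_zero_iff φ q.2
  rw [monodromySystem, Prod.mk_eq_zero, Prod.mk_eq_zero]
  change _ ↔ boundaryOp q.2.θ (hatLoop φ hs q.1 (tripleP φ q.2)).val = 0 ∧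
    boundaryOp q.2.θ (hatLoop (Real.pi / 2 - φ) hc q.1 (tripleQ φ q.2)).val = 0 ∧ _
  rw [h1, h2, h3]
  exact ⟨fun h => ⟨⟨h.F_eq, h.H₁_eq⟩, ⟨h.G_eq, h.H₂_eq⟩, h.K_eq⟩,
    fun ⟨⟨hF, hH₁⟩, ⟨hG, hH₂⟩, hK⟩ => ⟨hF, hG, hK, hθ, hH₁, hH₂⟩⟩

end System

/-! ### Invertibility of the linearized system and its explicit solution. -/

section Linearization

attribute [local instance] W.normedCommRing W.algebra W.normedAlgebra

variable {ρ : ℝ} [Fact (1 < ρ)]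

/-- The derivative of the Monodromy Problem with respect to the parameters. -/
def systemDeriv (φ : ℝ) : Param ρ →L[ℝ] WRplus ρ × WRplus ρ × WRplus ρ :=
  ((2 * Real.pi) • boundaryDeriv (-(1 / 2) * Real.cos φ) Param.cL).prod
    (((2 * Real.pi) • boundaryDeriv (-(1 / 2) * Real.sin φ) Param.bL).prod (detDeriv φ))

theorem boundaryDeriv_apply (κ : ℝ) (L : Param ρ →L[ℝ] WRplus ρ) (v : Param ρ) :
    boundaryDeriv κ L v = boundaryOp (Real.pi / 2) ((L v : WRplus ρ) : W ρ) -
      (2 * κ * Param.θL v) • plusMono 0 := by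
  change boundaryOp (Real.pi / 2) ((L v : WRplus ρ) : W ρ) -
      (2 * κ) • (Param.θL v • plusMono 0) = _
  rw [smul_smul]

theorem detDeriv_apply (φ : ℝ) (v : Param ρ) :
    ((detDeriv φ v : WRplus ρ) : W ρ) = detLin φ v - (2 * Param.rL v) • W.mono 1 1 := by
  have h0 : (1 : W ρ) ∈ WRplus ρ := mono_mem_WRplus 0
  have h1 : (W.mono 1 1 : W ρ) ∈ WRplus ρ := mono_mem_WRplus 1
  have h2 : (W.mono 2 1 : W ρ) ∈ WRplus ρ := mono_mem_WRplus 2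
  have hmem : detLin φ v - (2 * Param.rL v) • W.mono 1 1 ∈ WRplus ρ := by
    rw [detLin_apply]
    refine sub_mem (add_mem ?_ ?_) (Submodule.smul_mem _ _ h1)
    · exact W.mul_mem_WRplus (sub_mem h0 h2) (Param.aL v).2
    · exact W.mul_mem_WRplus (add_mem h0 h2) (add_mem (Submodule.smul_mem _ _ (Param.bL v).2)
        (Submodule.smul_mem _ _ (Param.cL v).2))
  have h : detDeriv φ v = plusPart (detLin φ v - (2 * Param.rL v) • W.mono 1 1) := by
    rw [mul_smul]
    rfl
  rw [h]
  exact congrArg Subtype.val (plusPart_coe ⟨_, hmem⟩)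

theorem systemDeriv_eq_iff (φ : ℝ) (v : Param ρ) (y₁ y₂ y₃ : WRplus ρ) :
    systemDeriv φ v = ((2 * Real.pi) • y₁, (2 * Real.pi) • y₂, y₃) ↔
      boundaryOp (Real.pi / 2) ((Param.cL v : WRplus ρ) : W ρ) +
        (Real.cos φ * Param.θL v) • plusMono 0 = y₁ ∧
      boundaryOp (Real.pi / 2) ((Param.bL v : WRplus ρ) : W ρ) +
        (Real.sin φ * Param.θL v) • plusMono 0 = y₂ ∧
      detLin φ v - (2 * Param.rL v) • W.mono 1 1 = (y₃ : W ρ) := by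
  have hpi : (2 * Real.pi) ≠ 0 := by positivity
  have hb : ∀ (κ : ℝ) (L : Param ρ →L[ℝ] WRplus ρ), boundaryDeriv (-(1 / 2) * κ) L v =
      boundaryOp (Real.pi / 2) ((L v : WRplus ρ) : W ρ) + (κ * Param.θL v) • plusMono 0 := by
    intro κ L
    rw [boundaryDeriv_apply, sub_eq_add_neg, ← neg_smul]
    congr 2
    ring
  change ((2 * Real.pi) • boundaryDeriv (-(1 / 2) * Real.cos φ) Param.cL v,
    (2 * Real.pi) • boundaryDeriv (-(1 / 2) * Real.sin φ) Param.bL v, detDeriv φ v) = _ ↔ _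
  rw [Prod.mk_inj, Prod.mk_inj, smul_right_inj hpi, smul_right_inj hpi, hb, hb, ← detDeriv_apply,
    Subtype.coe_inj]

theorem Param.ext_components {v w : Param ρ} (ha : Param.aL v = Param.aL w) (hb : Param.bL v = Param.bL w)
    (hc : Param.cL v = Param.cL w) (hr : Param.rL v = Param.rL w)
    (hθ : Param.θL v = Param.θL w) : v = w :=
  Prod.ext ha (Prod.ext hb (Prod.ext hc (Prod.ext hr hθ)))

theorem coe_smul_plusMono_zero (c : ℝ) : ((c • plusMono 0 : WRplus ρ) : W ρ) = c • (1 : W ρ) := by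
  rw [Submodule.coe_smul, coe_plusMono]
  rfl

theorem sin_smul_add_cos_smul (φ c : ℝ) (f : W ρ) :
    Real.sin φ • (-(Real.sin φ * c)) • f + Real.cos φ • (-(Real.cos φ * c)) • f = (-c) • f := by
  rw [smul_smul, smul_smul, ← add_smul]
  congr 1
  linear_combination (-c) * Real.sin_sq_add_cos_sq φ

/-- The first two equations force $c'=-\theta'\cos\varphi$ and $b'=-\theta'\sin\varphi$. The third
is then $(1-\lambda^2)a'-(1+\lambda^2)\theta'-2r'\lambda=0$; its values at $\lambda=\pm1$ give
$r'=\theta'=0$. -/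
theorem systemDeriv_injective (φ : ℝ) {v : Param ρ} (h : systemDeriv φ v = 0) : v = 0 := by
  have h0 : systemDeriv φ v = ((2 * Real.pi) • (0 : WRplus ρ), (2 * Real.pi) • (0 : WRplus ρ), 0) := by
    rw [h, smul_zero]
    rfl
  obtain ⟨h1, h2, h3⟩ := (systemDeriv_eq_iff φ v 0 0 0).1 h0
  have hker : ∀ (u : WRplus ρ) (c : ℝ),
      boundaryOp (Real.pi / 2) (u : W ρ) + c • plusMono 0 = 0 → u = (-c) • plusMono 0 := by
    intro u c hu
    refine sub_eq_zero.1 (boundaryOp_coe_injective (Real.pi / 2) ?_)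
    rw [Submodule.coe_sub, map_sub, Submodule.coe_smul, map_smul, boundaryOp_plusMono_zero,
      neg_smul, sub_neg_eq_add, hu]
  have hc := hker _ _ h1
  have hb := hker _ _ h2
  rw [detLin_apply, hb, hc, coe_smul_plusMono_zero, coe_smul_plusMono_zero,
    sin_smul_add_cos_smul] at h3
  have hev : ∀ l : ℂ, ‖l‖ = 1 → (1 - l ^ 2) * W.eval (Param.aL v : W ρ) l +
      (1 + l ^ 2) * -(Param.θL v : ℂ) - 2 * Param.rL v * l = 0 := by
    intro l hl
    have := congrArg (fun f => W.eval f l) h3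
    change W.eval _ l = W.eval (0 : W ρ) l at this
    simp only [W.eval_sub _ _ hl, W.eval_add _ _ hl, W.eval_mul _ _ hl, W.eval_one,
      W.eval_mono, W.eval_real_smul, W.eval_zero, one_mul, mul_one] at this
    push_cast at this
    rw [show l ^ (2 : ℤ) = l ^ 2 from rfl, zpow_one] at this
    exact this
  have e1 := hev 1 norm_one
  have e2 := hev (-1) (by rw [norm_neg, norm_one])
  have hr : Param.rL v = 0 := by
    have : (Param.rL v : ℂ) = 0 := by linear_combination (e2 - e1) / 4
    exact_mod_cast this
  have hθ : Param.θL v = 0 := by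
    have : (Param.θL v : ℂ) = 0 := by linear_combination -(e2 + e1) / 4
    exact_mod_cast this
  rw [hθ, mul_zero, neg_zero, zero_smul] at hb hc
  rw [hθ, hr, neg_zero, zero_smul, mul_zero, mul_zero, zero_smul, add_zero, sub_zero] at h3
  exact Param.ext_components (eq_zero_of_one_sub_mono_two_mul h3) hb hc hr hθ

theorem systemDeriv_surjective (φ : ℝ) : Function.Surjective (systemDeriv φ : Param ρ →L[ℝ] _) := by
  rintro ⟨y₁, y₂, y₃⟩
  have hpi : (2 * Real.pi) ≠ 0 := by positivity
  obtain ⟨c, hc⟩ := boundaryOp_coe_surjective (Real.pi / 2) ((2 * Real.pi)⁻¹ • y₁)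
  obtain ⟨b, hb⟩ := boundaryOp_coe_surjective (Real.pi / 2) ((2 * Real.pi)⁻¹ • y₂)
  have hw : (y₃ : W ρ) - (1 + W.mono 2 1) * (Real.sin φ • (b : W ρ) + Real.cos φ • (c : W ρ)) ∈
      WRplus ρ := by
    have h0 : (1 : W ρ) ∈ WRplus ρ := mono_mem_WRplus 0
    have h2 : (W.mono 2 1 : W ρ) ∈ WRplus ρ := mono_mem_WRplus 2
    exact sub_mem y₃.2 (W.mul_mem_WRplus (add_mem h0 h2)
      (add_mem (Submodule.smul_mem _ _ b.2) (Submodule.smul_mem _ _ c.2)))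
  obtain ⟨u, α, β, hu⟩ := exists_division ⟨_, hw⟩
  -- Writing $\alpha=\tfrac\alpha2\left((1-\lambda^2)+(1+\lambda^2)\right)$ shares the constant
  -- remainder between $a'$ and $\theta'$; the remainder $\beta\lambda$ fixes $r'$. The constants
  -- added to $b$ and $c$ compensate $\theta'$ in the first two equations.
  let v : Param ρ := (u + (α / 2) • plusMono 0, b + (-(Real.sin φ * -(α / 2))) • plusMono 0,
    c + (-(Real.cos φ * -(α / 2))) • plusMono 0, -(β / 2), -(α / 2))
  refine ⟨v, ?_⟩
  have hy : ∀ y : WRplus ρ, (2 * Real.pi) • (2 * Real.pi)⁻¹ • y = y := fun y =>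
    smul_inv_smul₀ hpi y
  rw [← hy y₁, ← hy y₂, systemDeriv_eq_iff, ← hc, ← hb]
  have hbd : ∀ (f : WRplus ρ) (κ : ℝ), boundaryOp (Real.pi / 2)
      ((f + (-κ) • plusMono 0 : WRplus ρ) : W ρ) + κ • plusMono 0 =
      boundaryOp (Real.pi / 2) (f : W ρ) := by
    intro f κ
    rw [Submodule.coe_add, Submodule.coe_smul, map_add, map_smul, boundaryOp_plusMono_zero,
      neg_smul, neg_add_cancel_right]
  refine ⟨hbd _ _, hbd _ _, ?_⟩
  change detLin φ v - (2 * -(β / 2)) • W.mono 1 1 = _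
  rw [detLin_apply]
  change (1 - W.mono 2 1) * ((u + (α / 2) • plusMono 0 : WRplus ρ) : W ρ) + (1 + W.mono 2 1) *
    (Real.sin φ • ((b + (-(Real.sin φ * -(α / 2))) • plusMono 0 : WRplus ρ) : W ρ) +
      Real.cos φ • ((c + (-(Real.cos φ * -(α / 2))) • plusMono 0 : WRplus ρ) : W ρ)) - _ = _
  have hsc := sin_smul_add_cos_smul (ρ := ρ) φ (-(α / 2)) 1
  have hu' : (y₃ : W ρ) = (1 + W.mono 2 1) * (Real.sin φ • (b : W ρ) + Real.cos φ • (c : W ρ)) +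
      ((1 - W.mono 2 1) * (u : W ρ) + W.mono 0 (α : ℂ) + W.mono 1 (β : ℂ)) := by
    rw [← hu]
    exact (add_sub_cancel _ _).symm
  have hα : (W.mono 0 (α : ℂ) : W ρ) = α • 1 := by
    refine W.ext_coeff fun k => ?_
    rw [W.coeff_real_smul, W.one_def, W.coeff_mono, W.coeff_mono, mul_ite, mul_one, mul_zero]
  have hβ : (W.mono 1 (β : ℂ) : W ρ) = β • W.mono 1 1 := by
    refine W.ext_coeff fun k => ?_
    rw [W.coeff_real_smul, W.coeff_mono, W.coeff_mono, mul_ite, mul_one, mul_zero]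
  rw [hu', hα, hβ, Submodule.coe_add, Submodule.coe_add, Submodule.coe_add,
    coe_smul_plusMono_zero, coe_smul_plusMono_zero, coe_smul_plusMono_zero]
  generalize (u : W ρ) = u at *
  generalize (b : W ρ) = b at *
  generalize (c : W ρ) = c at *
  rw [smul_add, smul_add, add_add_add_comm, hsc, neg_neg, mul_add, mul_add, mul_smul_comm,
    mul_smul_comm, mul_one, mul_one]
  module

/-- The derivative of the Monodromy Problem with respect to the parameters as an isomorphism. -/
def systemEquiv (φ : ℝ) : Param ρ ≃L[ℝ] WRplus ρ × WRplus ρ × WRplus ρ :=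
  ContinuousLinearEquiv.ofBijective (systemDeriv φ)
    (LinearMap.ker_eq_bot'.2 fun _ => systemDeriv_injective φ)
    (LinearMap.range_eq_top.2 (systemDeriv_surjective φ))

/-- The loop is antisymmetric under $\lambda\mapsto1/\lambda$, which doubles its coefficient, and it
vanishes at $\lambda=i$ because $i^{-2}=i^2$. -/
theorem boundaryOp_mono_sub_mono (κ : ℝ) :
    boundaryOp (Real.pi / 2) (W.mono (-2) κ - W.mono 2 κ : W ρ) = (-(2 * κ)) • plusMono 2 := by
  have h1 : plusPart ((W.mono (-2) κ - W.mono 2 κ : W ρ) - W.rev (W.mono (-2) κ - W.mono 2 κ)) =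
      (-(2 * κ)) • plusMono 2 := by
    refine WRplus.ext fun k => ?_
    rw [coeff_plusPart, Submodule.coe_smul, W.coeff_real_smul, coe_plusMono, W.coeff_sub,
      W.coeff_rev, W.coeff_sub, W.coeff_sub, W.coeff_mono, W.coeff_mono, W.coeff_mono,
      W.coeff_mono, W.coeff_mono, if_neg (by omega : ¬(k : ℤ) = -2),
      if_neg (by omega : ¬-(k : ℤ) = 2)]
    have : (-(k : ℤ) = -2) ↔ ((k : ℤ) = (2 : ℕ)) := by omega
    simp only [this, Nat.cast_ofNat]
    split_ifs
    · simp
      ring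
    · simp
  have h2 : circleValue (Real.pi / 2) (W.mono (-2) κ - W.mono 2 κ : W ρ) = 0 := by
    rw [circleValue_apply, W.eval_sub _ _ (norm_exp_I_mul _), W.eval_mono, W.eval_mono]
    have : Complex.exp (Complex.I * ((Real.pi / 2 : ℝ) : ℂ)) = Complex.I := by
      rw [mul_comm]
      push_cast
      exact Complex.exp_pi_div_two_mul_I
    rw [this, zpow_neg, show Complex.I ^ (2 : ℤ) = Complex.I ^ 2 from rfl, Complex.I_sq]
    norm_num
  rw [boundaryOp_apply, h1, h2, zero_smul, add_zero]

theorem boundaryOp_plusMono_two :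
    boundaryOp (Real.pi / 2) ((plusMono 2 : WRplus ρ) : W ρ) = plusMono 2 - plusMono 0 := by
  have h : circleValue (Real.pi / 2) ((plusMono 2 : WRplus ρ) : W ρ) = -1 := by
    rw [coe_plusMono, circleValue_apply, W.eval_mono]
    have : Complex.exp (Complex.I * ((Real.pi / 2 : ℝ) : ℂ)) = Complex.I := by
      rw [mul_comm]
      push_cast
      exact Complex.exp_pi_div_two_mul_I
    rw [this, show Complex.I ^ ((2 : ℕ) : ℤ) = Complex.I ^ 2 from rfl, Complex.I_sq]
    norm_num
  rw [boundaryOp_coe, h, coe_plusMono, W.coeff_mono, if_neg (by norm_num)]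
  simp [sub_eq_add_neg]

theorem val_loopA_mul (κ : ℝ) :
    (W.mono (-1) (1 / 2) - W.mono 1 (1 / 2) : W ρ) * (W.mono (-1) κ + W.mono 1 κ) =
      W.mono (-2) (κ / 2 : ℝ) - W.mono 2 (κ / 2 : ℝ) := by
  rw [sub_mul, mul_add, mul_add, W.mono_mul_mono, W.mono_mul_mono, W.mono_mul_mono,
    W.mono_mul_mono]
  have h : (1 / 2 : ℂ) * κ = (κ / 2 : ℝ) := by
    push_cast
    ring
  rw [h]
  norm_num
  abel

/-- At the central value $ab=-\tfrac14\sin\varphi\,(\lambda^{-2}-\lambda^2)$. In the counterpart for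
$\mathcal Q$ the product is $-ac$, which flips the sign. -/
theorem hatRem_tripleP_center {φ : ℝ} (h : φ ∈ Set.Ioo 0 (Real.pi / 2)) (hφ : Real.sin φ ≠ 0) :
    boundaryOp (Real.pi / 2) (hatRem φ hφ 0 (tripleP φ (Param.center ρ))).val =
      (-(4 * Real.pi * Real.sin φ * Real.log (Real.sin φ))) • plusMono 2 := by
  have hA : (loopA (Param.center ρ)).val = W.mono (-1) (1 / 2) - W.mono 1 (1 / 2) := by
    rw [val_loopA]
    exact add_zero _
  have hB : (loopB φ (Param.center ρ)).val =
      W.mono (-1) ((-(1 / 2) * Real.sin φ : ℝ) : ℂ) + W.mono 1 ((-(1 / 2) * Real.sin φ : ℝ) : ℂ) := by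
    have hκ : ((-(1 / 2) * Real.sin φ : ℝ) : ℂ) = -(1 / 2) * (Real.sin φ : ℂ) := by push_cast; rfl
    rw [val_loopB, hκ]
    exact add_zero _
  have h1 : (tripleP φ (Param.center ρ)).1 = loopA (Param.center ρ) := one_smul ℝ _
  have h2 : (tripleP φ (Param.center ρ)).2.1 = loopB φ (Param.center ρ) := one_smul ℝ _
  rw [hatRem_zero h, h1, h2, map_smul, map_smul, RealLoops.val_mul, hA, hB, val_loopA_mul,
    boundaryOp_mono_sub_mono, smul_smul]
  congr 1
  ring

theorem hatRem_tripleQ_center {φ : ℝ} (h : φ ∈ Set.Ioo 0 (Real.pi / 2))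
    (hφ : Real.sin (Real.pi / 2 - φ) ≠ 0) :
    boundaryOp (Real.pi / 2) (hatRem (Real.pi / 2 - φ) hφ 0 (tripleQ φ (Param.center ρ))).val =
      (4 * Real.pi * Real.cos φ * Real.log (Real.cos φ)) • plusMono 2 := by
  have hA : (loopA (Param.center ρ)).val = W.mono (-1) (1 / 2) - W.mono 1 (1 / 2) := by
    rw [val_loopA]
    exact add_zero _
  have hB : (loopC φ (Param.center ρ)).val =
      W.mono (-1) ((-(1 / 2) * Real.cos φ : ℝ) : ℂ) + W.mono 1 ((-(1 / 2) * Real.cos φ : ℝ) : ℂ) := by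
    have hκ : ((-(1 / 2) * Real.cos φ : ℝ) : ℂ) = -(1 / 2) * (Real.cos φ : ℂ) := by push_cast; rfl
    rw [val_loopC, hκ]
    exact add_zero _
  have h1 : (tripleQ φ (Param.center ρ)).1 = -loopA (Param.center ρ) :=
    congrArg Neg.neg (one_smul ℝ _)
  have h2 : (tripleQ φ (Param.center ρ)).2.1 = loopC φ (Param.center ρ) := one_smul ℝ _
  rw [hatRem_zero ⟨by linarith [h.2], by linarith [h.1]⟩, h1, h2, map_smul, map_smul, neg_mul,
    map_neg, map_neg, RealLoops.val_mul, hA, hB, val_loopA_mul, boundaryOp_mono_sub_mono,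
    Real.sin_pi_div_two_sub, ← neg_smul, smul_smul]
  congr 1
  ring

theorem hasStrictFDerivAt_monodromySystem {φ : ℝ} (h : φ ∈ Set.Ioo 0 (Real.pi / 2))
    (hs : Real.sin φ ≠ 0) (hc : Real.sin (Real.pi / 2 - φ) ≠ 0) :
    HasStrictFDerivAt (monodromySystem φ hs hc)
      ((systemDeriv φ).comp (ContinuousLinearMap.snd ℝ ℝ (Param ρ)) +
        (ContinuousLinearMap.fst ℝ ℝ (Param ρ)).smulRight
          ((-(4 * Real.pi * Real.sin φ * Real.log (Real.sin φ))) • plusMono 2,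
            (4 * Real.pi * Real.cos φ * Real.log (Real.cos φ)) • plusMono 2, 0))
      (0, Param.center ρ) := by
  have h1 := hasStrictFDerivAt_hatSystem φ hs (contDiff_tripleP φ)
    (hasStrictFDerivAt_boundaryOp_leading (ρ := ρ) (-(1 / 2) * Real.cos φ) (L := Param.cL) rfl)
  have h2 := hasStrictFDerivAt_hatSystem (Real.pi / 2 - φ) hc (contDiff_tripleQ φ)
    (hasStrictFDerivAt_boundaryOp_leading (ρ := ρ) (-(1 / 2) * Real.sin φ) (L := Param.bL) rfl)
  have h3 : HasStrictFDerivAt (fun q : ℝ × Param ρ => plusPart (detLoop φ q.2))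
      ((detDeriv φ).comp (ContinuousLinearMap.snd ℝ ℝ (Param ρ))) (0, Param.center ρ) :=
    HasStrictFDerivAt.comp (g := fun x => plusPart (detLoop φ x)) (f := Prod.snd)
      ((0 : ℝ), Param.center ρ) (hasStrictFDerivAt_detLoop φ) hasStrictFDerivAt_snd
  have hθ : Param.θL (Param.center ρ) = Real.pi / 2 := rfl
  rw [hθ, hatRem_tripleP_center h hs] at h1
  rw [hθ, hatRem_tripleQ_center h hc] at h2
  refine (h1.prodMk (h2.prodMk h3)).congr_fderiv ?_
  refine ContinuousLinearMap.ext fun v => ?_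
  refine Prod.ext rfl (Prod.ext rfl ?_)
  change _ = _ + v.1 • (0 : WRplus ρ)
  rw [smul_zero, add_zero]
  rfl

/-- The first-order deformation of the parameters. -/
def paramDeriv (φ a₀ b₀ b₂ c₀ c₂ : ℝ) : Param ρ :=
  (a₀ • plusMono 0 + a₀ • plusMono 2, b₀ • plusMono 0 + b₂ • plusMono 2,
    c₀ • plusMono 0 + c₂ • plusMono 2, 0, 2 * Real.sin (2 * φ) * Real.log (Real.tan φ))

theorem coe_smul_plusMono_add (p q : ℝ) :
    ((p • plusMono 0 + q • plusMono 2 : WRplus ρ) : W ρ) = W.mono 0 p + W.mono 2 q := by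
  refine W.ext_coeff fun k => ?_
  rw [Submodule.coe_add, Submodule.coe_smul, Submodule.coe_smul, coe_plusMono, coe_plusMono,
    W.coeff_add, W.coeff_add, W.coeff_real_smul, W.coeff_real_smul, W.coeff_mono, W.coeff_mono,
    W.coeff_mono, W.coeff_mono, mul_ite, mul_ite, mul_one, mul_one, mul_zero, mul_zero]
  rfl

/-- The $\lambda^2$ terms of the first two equations give $c'_2$ and $b'_2$, and the constant terms
give $c'_0=c'_2-\theta'\cos\varphi$, $b'_0=b'_2-\theta'\sin\varphi$. With $r'=0$, the determinant
equation requires $a'_2=b'_2\sin\varphi+c'_2\cos\varphi$ and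
$a'_0=-(b'_0\sin\varphi+c'_0\cos\varphi)=\theta'-a'_2$. The $\lambda^2$ term then forces
$a'_0=a'_2$, so $\theta'=2a'_0$. -/
theorem systemDeriv_paramDeriv {φ : ℝ} (h : φ ∈ Set.Ioo 0 (Real.pi / 2)) {a₀ b₀ b₂ c₀ c₂ : ℝ}
    (ha : a₀ = Real.sin (2 * φ) * Real.log (Real.tan φ))
    (hb₂ : b₂ = -2 * Real.cos φ * Real.log (Real.cos φ))
    (hc₂ : c₂ = 2 * Real.sin φ * Real.log (Real.sin φ))
    (hb₀ : b₀ = b₂ * Real.cos (2 * φ) - c₂ * Real.sin (2 * φ))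
    (hc₀ : c₀ = -b₂ * Real.sin (2 * φ) - c₂ * Real.cos (2 * φ)) :
    systemDeriv φ (paramDeriv φ a₀ b₀ b₂ c₀ c₂ : Param ρ) =
      -((-(4 * Real.pi * Real.sin φ * Real.log (Real.sin φ))) • plusMono 2,
        (4 * Real.pi * Real.cos φ * Real.log (Real.cos φ)) • plusMono 2, 0) := by
  have hs : Real.sin φ ≠ 0 := (Real.sin_pos_of_pos_of_lt_pi h.1 (by linarith [h.2, Real.pi_pos])).ne'
  have hc : Real.cos φ ≠ 0 := (Real.cos_pos_of_mem_Ioo ⟨by linarith [h.1, Real.pi_pos], h.2⟩).ne'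
  have hlog : Real.log (Real.tan φ) = Real.log (Real.sin φ) - Real.log (Real.cos φ) := by
    rw [Real.tan_eq_sin_div_cos, Real.log_div hs hc]
  have hsc := Real.sin_sq_add_cos_sq φ
  rw [hlog] at ha
  rw [Real.sin_two_mul] at ha hb₀ hc₀
  rw [Real.cos_two_mul'] at hb₀ hc₀
  have hneg : (-((-(4 * Real.pi * Real.sin φ * Real.log (Real.sin φ))) • plusMono 2,
        (4 * Real.pi * Real.cos φ * Real.log (Real.cos φ)) • plusMono 2, 0) :
      WRplus ρ × WRplus ρ × WRplus ρ) =
      ((2 * Real.pi) • c₂ • plusMono 2, (2 * Real.pi) • b₂ • plusMono 2, 0) := by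
    rw [Prod.neg_mk, Prod.neg_mk, neg_zero, ← neg_smul, ← neg_smul, smul_smul, smul_smul, hb₂, hc₂]
    refine Prod.ext ?_ (Prod.ext ?_ rfl) <;> exact congrArg (· • (plusMono 2 : WRplus ρ)) (by ring)
  rw [hneg, systemDeriv_eq_iff]
  have hθ : Param.θL (paramDeriv φ a₀ b₀ b₂ c₀ c₂ : Param ρ) = 2 * a₀ := by
    change 2 * Real.sin (2 * φ) * Real.log (Real.tan φ) = _
    rw [ha, hlog, Real.sin_two_mul]
    ring
  have hbd : ∀ p q κ : ℝ, p - q + κ = 0 → boundaryOp (Real.pi / 2)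
      ((p • plusMono 0 + q • plusMono 2 : WRplus ρ) : W ρ) + κ • plusMono 0 =
      (q • plusMono 2 : WRplus ρ) := by
    intro p q κ hpq
    rw [Submodule.coe_add, Submodule.coe_smul, Submodule.coe_smul, map_add, map_smul, map_smul,
      boundaryOp_plusMono_zero, boundaryOp_plusMono_two]
    have hp : p = q - κ := by linarith
    rw [hp]
    module
  rw [hθ]
  refine ⟨hbd _ _ _ ?_, hbd _ _ _ ?_, ?_⟩
  · rw [hc₀, hb₂, hc₂, ha]
    linear_combination 2 * Real.sin φ * Real.log (Real.sin φ) * hsc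
  · rw [hb₀, hb₂, hc₂, ha]
    linear_combination -(2 * Real.cos φ * Real.log (Real.cos φ)) * hsc
  · have hr : Param.rL (paramDeriv φ a₀ b₀ b₂ c₀ c₂ : Param ρ) = 0 := rfl
    rw [hr, mul_zero, zero_smul, sub_zero, detLin_apply]
    change (1 - W.mono 2 1) * ((a₀ • plusMono 0 + a₀ • plusMono 2 : WRplus ρ) : W ρ) +
      (1 + W.mono 2 1) *
        (Real.sin φ • ((b₀ • plusMono 0 + b₂ • plusMono 2 : WRplus ρ) : W ρ) +
          Real.cos φ • ((c₀ • plusMono 0 + c₂ • plusMono 2 : WRplus ρ) : W ρ)) = 0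
    have h2 : Real.sin φ * b₂ + Real.cos φ * c₂ = a₀ := by
      rw [hb₂, hc₂, ha]
      ring
    have h0 : Real.sin φ * b₀ + Real.cos φ * c₀ = -a₀ := by
      rw [hb₀, hc₀, ← h2]
      linear_combination -(Real.sin φ * b₂ + Real.cos φ * c₂) * hsc
    have hlin : Real.sin φ • ((b₀ • plusMono 0 + b₂ • plusMono 2 : WRplus ρ) : W ρ) +
        Real.cos φ • ((c₀ • plusMono 0 + c₂ • plusMono 2 : WRplus ρ) : W ρ) =
        (-a₀) • 1 + a₀ • W.mono 2 1 := by
      rw [← h0, Submodule.coe_add, Submodule.coe_add, coe_smul_plusMono_zero,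
        coe_smul_plusMono_zero, Submodule.coe_smul, Submodule.coe_smul, coe_plusMono]
      rw [← h2]
      push_cast
      module
    rw [hlin, Submodule.coe_add, coe_smul_plusMono_zero, Submodule.coe_smul, coe_plusMono]
    push_cast
    simp only [mul_add, mul_smul_comm, mul_one, sub_mul, add_mul, one_mul]
    module

end Linearization

/-! ### The implicit function theorem and the family of solutions. -/

section Family

attribute [local instance] W.normedCommRing W.algebra W.normedAlgebra

variable {ρ : ℝ} [Fact (1 < ρ)]

theorem monodromySystem_center {φ : ℝ} (hs : Real.sin φ ≠ 0)
    (hc : Real.sin (Real.pi / 2 - φ) ≠ 0) :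
    monodromySystem φ hs hc (0, Param.center ρ) = 0 := by
  have hval : ∀ κ : ℝ, ∀ L : Param ρ →L[ℝ] WRplus ρ, L (Param.center ρ) = 0 →
      boundaryOp (Real.pi / 2) ((2 * Real.pi) • ((1 : ℝ) • (realMono (-1) κ + realMono 1 κ +
        plusIncl (L (Param.center ρ))))).val = 0 := by
    intro κ L hL
    rw [hL, map_zero, add_zero, one_smul, map_smul, map_smul, map_add, val_realMono, val_realMono,
      boundaryOp_mono_add_mono, Real.cos_pi_div_two, mul_zero, zero_smul, smul_zero]
  have h1 : hatSystem φ hs (tripleP φ) (0, Param.center ρ) = 0 := by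
    rw [hatSystem, hatLoop, zero_smul, add_zero]
    exact hval _ Param.cL rfl
  have h2 : hatSystem (Real.pi / 2 - φ) hc (tripleQ φ) (0, Param.center ρ) = 0 := by
    rw [hatSystem, hatLoop, zero_smul, add_zero]
    exact hval _ Param.bL rfl
  have h3 : detLoop φ (Param.center ρ) = 0 := by
    have ha : plusSub (Param.aL (Param.center ρ)) = 0 := rfl
    have hb : plusSub (Param.bL (Param.center ρ)) = 0 := rfl
    have hc : plusSub (Param.cL (Param.center ρ)) = 0 := rfl
    have hr : (Param.center ρ).r = 1 := rfl
    have hl : detLin φ (Param.center ρ) = 0 := by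
      rw [detLin_apply, ← plusSub_apply, ← plusSub_apply, ← plusSub_apply, ha, hb, hc]
      simp
    rw [detLoop, hl, ha, hb, hc, hr]
    simp
  rw [monodromySystem, h1, h2, h3, map_zero]
  rfl

theorem exists_family {φ : ℝ} (hφ : φ ∈ Set.Ioo 0 (Real.pi / 2)) {a₀ b₀ b₂ c₀ c₂ : ℝ}
    (ha : a₀ = Real.sin (2 * φ) * Real.log (Real.tan φ))
    (hb₂ : b₂ = -2 * Real.cos φ * Real.log (Real.cos φ))
    (hc₂ : c₂ = 2 * Real.sin φ * Real.log (Real.sin φ))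
    (hb₀ : b₀ = b₂ * Real.cos (2 * φ) - c₂ * Real.sin (2 * φ))
    (hc₀ : c₀ = -b₂ * Real.sin (2 * φ) - c₂ * Real.cos (2 * φ)) :
    ∃ x : ℝ → Param ρ, x 0 = Param.center ρ ∧
      HasDerivAt x (paramDeriv φ a₀ b₀ b₂ c₀ c₂) 0 ∧
      (∀ᶠ t in 𝓝 (0 : ℝ), SolvesMonodromyProblem φ t (x t)) ∧
      ∀ᶠ q : ℝ × Param ρ in 𝓝 (0, Param.center ρ),
        SolvesMonodromyProblem φ q.1 q.2 → q.2 = x q.1 := by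
  have hs : Real.sin φ ≠ 0 :=
    (Real.sin_pos_of_pos_of_lt_pi hφ.1 (by linarith [hφ.2, Real.pi_pos])).ne'
  have hc : Real.sin (Real.pi / 2 - φ) ≠ 0 := by
    rw [Real.sin_pi_div_two_sub]
    exact (Real.cos_pos_of_mem_Ioo ⟨by linarith [hφ.1, Real.pi_pos], hφ.2⟩).ne'
  have hF := hasStrictFDerivAt_monodromySystem (ρ := ρ) hφ hs hc
  have hv := systemDeriv_paramDeriv (ρ := ρ) hφ ha hb₂ hc₂ hb₀ hc₀
  set g : WRplus ρ × WRplus ρ × WRplus ρ :=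
    ((-(4 * Real.pi * Real.sin φ * Real.log (Real.sin φ))) • plusMono 2,
      (4 * Real.pi * Real.cos φ * Real.log (Real.cos φ)) • plusMono 2, 0)
  set F' := (systemDeriv φ).comp (ContinuousLinearMap.snd ℝ ℝ (Param ρ)) +
    (ContinuousLinearMap.fst ℝ ℝ (Param ρ)).smulRight g with hF'
  have hr : F'.comp (ContinuousLinearMap.inr ℝ ℝ (Param ρ)) =
      ((systemEquiv φ : Param ρ ≃L[ℝ] _) : Param ρ →L[ℝ] _) := by
    refine ContinuousLinearMap.ext fun v => ?_
    change systemDeriv φ v + (0 : ℝ) • g = systemDeriv φ v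
    rw [zero_smul, add_zero]
  have hl : F'.comp (ContinuousLinearMap.inl ℝ ℝ (Param ρ)) 1 = g := by
    change systemDeriv φ 0 + (1 : ℝ) • g = g
    rw [map_zero, one_smul, zero_add]
  have hinv : (F'.comp (ContinuousLinearMap.inr ℝ ℝ (Param ρ))).IsInvertible :=
    ⟨systemEquiv φ, hr.symm⟩
  have h0 := monodromySystem_center (ρ := ρ) hs hc
  have hiff := eventually_solvesMonodromyProblem_iff (ρ := ρ) hφ hs hc
  have huniq := hF.eventually_apply_eq_iff_implicitFunctionOfProdDomain hinv
  have hsol := hF.eventually_apply_implicitFunctionOfProdDomain hinv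
  have hlim := hF.tendsto_implicitFunctionOfProdDomain hinv
  have hder := (hF.hasStrictFDerivAt_implicitFunctionOfProdDomain hinv).hasFDerivAt.hasDerivAt
  rw [h0] at huniq hsol
  -- The base point is itself a zero, so the local characterization of zeros, read at that point,
  -- gives the initial value.
  refine ⟨hF.implicitFunctionOfProdDomain hinv, (huniq.self_of_nhds).1 h0, ?_, ?_, ?_⟩
  · refine hder.congr_deriv ?_
    -- The derivative of the implicit function is $-(\partial_xF)^{-1}\partial_tF$, and `hv`
    -- exhibits `paramDeriv` as the preimage of $-\partial_tF$.
    change -((F'.comp (ContinuousLinearMap.inr ℝ ℝ (Param ρ))).inverse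
      (F'.comp (ContinuousLinearMap.inl ℝ ℝ (Param ρ)) 1)) = _
    rw [hl, hr, ContinuousLinearMap.inverse_equiv, ← map_neg, ← hv]
    exact (systemEquiv φ).symm_apply_apply _
  · have hpair : Tendsto (fun t => (t, hF.implicitFunctionOfProdDomain hinv t)) (𝓝 0)
        (𝓝 (0, Param.center ρ)) := by
      rw [nhds_prod_eq]
      exact tendsto_id.prodMk hlim
    filter_upwards [hsol, hpair.eventually hiff] with t h1 h2
    exact h2.2 h1
  · filter_upwards [huniq, hiff] with q h1 h2 h3
    exact (h1.1 (h2.1 h3)).symm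

end Family

end DPW

end

theorem mainTheorem10 (φ : ℝ) (hφ : φ ∈ Set.Ioo 0 (Real.pi / 2)) (ρ : ℝ) [Fact (1 < ρ)] :
    ∃ x : ℝ → DPW.Param ρ,
      -- `x` is the family of solutions of the Monodromy Problem through the central value,
      -- and locally the only one
      x 0 = DPW.Param.center ρ ∧
      ContinuousAt x 0 ∧
      (∀ᶠ t in 𝓝 (0 : ℝ), DPW.SolvesMonodromyProblem φ t (x t)) ∧
      (∀ᶠ q : ℝ × DPW.Param ρ in 𝓝 (0, DPW.Param.center ρ),
        DPW.SolvesMonodromyProblem φ q.1 q.2 → q.2 = x q.1) ∧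
      -- its derivatives at `t = 0`
      ∃ a₀ a₂ b₀ b₂ c₀ c₂ : ℝ,
        HasDerivAt (fun t => (x t).a) (DPW.W.mono 0 a₀ + DPW.W.mono 2 a₂) 0 ∧
        HasDerivAt (fun t => (x t).b φ) (DPW.W.mono 0 b₀ + DPW.W.mono 2 b₂) 0 ∧
        HasDerivAt (fun t => (x t).c φ) (DPW.W.mono 0 c₀ + DPW.W.mono 2 c₂) 0 ∧
        a₀ = Real.sin (2 * φ) * Real.log (Real.tan φ) ∧
        a₂ = Real.sin (2 * φ) * Real.log (Real.tan φ) ∧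
        b₂ = -2 * Real.cos φ * Real.log (Real.cos φ) ∧
        c₂ = 2 * Real.sin φ * Real.log (Real.sin φ) ∧
        b₀ = b₂ * Real.cos (2 * φ) - c₂ * Real.sin (2 * φ) ∧
        c₀ = -b₂ * Real.sin (2 * φ) - c₂ * Real.cos (2 * φ) ∧
        HasDerivAt (fun t => (x t).r) 0 0 ∧
        HasDerivAt (fun t => (x t).θ) (2 * Real.sin (2 * φ) * Real.log (Real.tan φ)) 0 := by
  obtain ⟨x, h0, hx, hsol, huniq⟩ := DPW.exists_family (ρ := ρ) hφ rfl rfl rfl rfl rfl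
  -- Each of $a,b,c$ is a fixed loop plus a continuous linear image of the parameter vector, so its
  -- derivative is that image of `paramDeriv`.
  have hL : ∀ (L : DPW.Param ρ →L[ℝ] DPW.WRplus ρ) (f : DPW.W ρ),
      HasDerivAt (fun t => f + DPW.plusSub (L (x t))) (DPW.plusSub (L _)) 0 := fun L f =>
    ((DPW.plusSub.comp L).hasFDerivAt.comp_hasDerivAt (0 : ℝ) hx).const_add f
  refine ⟨x, h0, hx.continuousAt, hsol, huniq, _, _, _, _, _, _,
    (hL DPW.Param.aL _).congr_deriv (DPW.coe_smul_plusMono_add _ _),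
    (hL DPW.Param.bL _).congr_deriv (DPW.coe_smul_plusMono_add _ _),
    (hL DPW.Param.cL _).congr_deriv (DPW.coe_smul_plusMono_add _ _),
    rfl, rfl, rfl, rfl, rfl, rfl,
    DPW.Param.rL.hasFDerivAt.comp_hasDerivAt (0 : ℝ) hx,
    DPW.Param.θL.hasFDerivAt.comp_hasDerivAt (0 : ℝ) hx⟩
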